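/- Let $m \ge 1$ and $n \ge 2$ be integers with $m \le \lceil 2n/3\rceil$, and let $G$ be a finite simple connected claw-free graph (that is, $G$ has no induced subgraph isomorphic to $K_{1,3}$). Write $|G|$ for the number of vertices of $G$. For $k \ge 1$ let $\sigma_k(G)$ be the minimum of $\sum_{v\in S}\deg_G(v)$ over all independent sets $S$ of exactly $k$ vertices of $G$, with $\sigma_k(G) = +\infty$ if $G$ has no independent set of $k$ vertices. If $$\sigma_{m+1}(G) \ge |G| - n + m - 1,$$ then $G$ has a spanning tree $T$ with $|L(T)| + |B(T)| \le n$, where $L(T)$ is the set of vertices of degree one in $T$ (leaves) and $B(T)$ is the set of vertices of degree at least three in $T$ (branch vertices). -/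

import Mathlib

open scoped Classical in
/-- `σ_k(G)`: the minimum of the degree sums of the independent sets of exactly `k` vertices of `G`.
It is `⊤` (an infimum over the empty family) when `G` has no independent set of `k` vertices,
that is, when `α(G) < k`. -/
noncomputable def SimpleGraph.sigmaIndep {V : Type*} [Fintype V] (G : SimpleGraph V) (k : ℕ) :
    ℕ∞ :=
  ⨅ (s : Finset V) (_ : G.IsNIndepSet k s), ((∑ v ∈ s, G.degree v : ℕ) : ℕ∞)

/-- `G` is claw-free: `K_{1,3}` is not an induced subgraph of `G`. -/
def SimpleGraph.ClawFree {V : Type*} (G : SimpleGraph V) : Prop :=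
  ¬ (completeBipartiteGraph (Fin 1) (Fin 3)).IsIndContained G

/-- `T` is a spanning tree of `G`: a tree on all the vertices of `G`, with edges among those
of `G`. -/
def SimpleGraph.IsSpanningTreeOf {V : Type*} (T G : SimpleGraph V) : Prop :=
  T ≤ G ∧ T.IsTree

open scoped Classical in
/-- `L(T)`: the vertices of degree one. -/
noncomputable def SimpleGraph.leafSet {V : Type*} [Fintype V] (T : SimpleGraph V) : Finset V :=
  Finset.univ.filter fun v => T.degree v = 1

open scoped Classical in
/-- `B(T)`: the vertices of degree greater than two. -/
noncomputable def SimpleGraph.branchSet {V : Type*} [Fintype V] (T : SimpleGraph V) : Finset V :=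
  Finset.univ.filter fun v => 2 < T.degree v

/-! Suppose that every spanning tree has more than n leaves and branch vertices together. As n ≥ 2,
every spanning tree then has a branch vertex, and an extremal pair (T, ρ) exists (`exists_opt`): T
minimises a weight in which a leaf costs K and a branch vertex of degree d costs 2K + d², with K
large against one change of d²; among the minimisers, ρ is a branch vertex of least degree; and then
the branch vertices crowd around ρ as much as possible (`pot`). Replacing edges of T by edges of G
shows that many adjacencies of G would contradict this choice. Each contradiction is reached either
directly by an exchange, or by finding a vertex with three neighbours among which all adjacencies
are excluded, that is, a claw.

Say that s hits the edge yz of T if s is adjacent in G to the end of yz farther from s (`Hit`). A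
neighbour z of s in G singles out the edge of T at z towards s, and distinct neighbours give
distinct edges, so deg_G(s) is at most the number of edges that s hits (`degree_le_hits`). Let S
consist of the leaves and of a set X of cubic vertices (degree three in T), other than ρ and
pairwise not in the relation `Conf`. Exchanges show that S is independent in G (`Sel.nonadj`), that
no edge is hit by two members of S (`Sel.hit_unique`), and that every branch vertex outside S has at
least two unhit edges (`Sel.not_two_hit`, `Sel.not_three_hit`). At most one of these leads to the
parent, and none at ρ, so the degree sum of S is at most |G| - 2 - |B \ X| (`Sel.sum_degree_le`).

In each direction from a cubic vertex there is at most one cubic vertex related to it by `Conf`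
(`Opt.conf_unique`). A greedy choice from the vertices farthest from ρ therefore keeps half of the
cubic vertices other than ρ. With |L| + (number of cubic vertices) ≥ 2 + 2|B|, this makes S have at
least m + 1 members, which is where m ≤ ⌈2n/3⌉ enters. Applying the degree condition to m + 1 of
them, and counting at least 1 for each of the others, yields |L| + |B| ≤ n, a contradiction. -/

namespace LeafBranch

open SimpleGraph
open scoped Classical

/-! ### Sides of a tree edge, medians and distances -/

section

variable {V : Type*} {T : SimpleGraph V}

/-- `r` lies on the `q`-side of the edge `pq` of `T`. -/
def side (T : SimpleGraph V) (p q r : V) : Prop := (T.deleteEdges {s(p, q)}).Reachable q r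

theorem side_self (p q : V) : side T p q q := Reachable.refl _

theorem side_step {p q r s : V} (h : T.Adj r s) (h1 : ¬ (r = p ∧ s = q)) (h2 : ¬ (r = q ∧ s = p)) :
    side T p q r ↔ side T p q s := by
  have hrs : (T.deleteEdges {s(p, q)}).Adj r s := by
    rw [deleteEdges_adj]; simp [h]; tauto
  exact ⟨fun H => H.trans hrs.reachable, fun H => H.trans hrs.symm.reachable⟩

theorem not_side (hT : T.IsTree) {p q : V} (h : T.Adj p q) : ¬ side T p q p := by
  have := isAcyclic_iff_forall_adj_isBridge.mp hT.isAcyclic h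
  rw [isBridge_iff] at this
  intro H
  exact this H.symm

theorem side_iff_not (hT : T.IsTree) {p q : V} (h : T.Adj p q) (r : V) :
    side T p q r ↔ ¬ side T q p r := by
  constructor
  · intro h1 h2
    refine not_side hT h (h1.trans ?_)
    have := h2.symm
    rwa [Sym2.eq_swap] at this
  · intro h1
    by_contra h2
    have key : ∀ a b, T.Reachable a b → (side T p q a ∨ side T q p a) →
        (side T p q b ∨ side T q p b) := by
      rintro a b ⟨w⟩
      induction w with
      | nil => exact id
      | @cons a b c hab w ih =>
        intro H
        apply ih
        by_cases c1 : a = p ∧ b = q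
        · rw [c1.2]; exact Or.inl (side_self _ _)
        by_cases c2 : a = q ∧ b = p
        · rw [c2.2]; exact Or.inr (side_self _ _)
        rwa [side_step hab c1 c2, side_step hab c2 c1] at H
    rcases key q r (hT.connected.preconnected q r) (Or.inl (side_self _ _)) with h | h
    · exact h2 h
    · exact h1 h

/-- The part of the tree beyond `rs` does not contain `p`, so it is untouched by the removal of `pq`
and lies wholly on one side of that edge. -/
theorem side_branch {p q r s v : V} (h : ¬ side T r s p) (hv : side T r s v) : side T p q v ↔ side T p q s := by
  have key : ∀ a b, (T.deleteEdges {s(r, s)}).Reachable a b → side T r s a →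
      (side T p q a ↔ side T p q b) := by
    rintro a b ⟨w⟩
    induction w with
    | nil => exact fun _ => Iff.rfl
    | @cons a b c hab w ih =>
      intro ha
      have hb : side T r s b := ha.trans hab.reachable
      rw [← ih hb]
      rw [deleteEdges_adj] at hab
      apply side_step hab.1
      · rintro ⟨rfl, -⟩; exact h ha
      · rintro ⟨-, rfl⟩; exact h hb
  exact (key s v hv (side_self _ _)).symm

theorem side_disjoint (hT : T.IsTree) {w e f v : V} (he : T.Adj w e) (hef : e ≠ f)
    (hf : T.Adj w f) (hv : side T w e v) : ¬ side T w f v := by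
  rw [side_branch (not_side hT he) hv, ← side_step he (by tauto) (fun h => hf.ne h.1)]
  exact not_side hT hf

theorem exists_side (hT : T.IsTree) {w v : V} (h : w ≠ v) : ∃ e, T.Adj w e ∧ side T w e v := by
  have key : ∀ a b, T.Reachable a b → (w = a ∨ ∃ e, T.Adj w e ∧ side T w e a) →
      (w = b ∨ ∃ e, T.Adj w e ∧ side T w e b) := by
    rintro a b ⟨p⟩
    induction p with
    | nil => exact id
    | @cons a b c hab p ih =>
      intro H
      apply ih
      rcases H with rfl | ⟨e, he, hs⟩
      · exact Or.inr ⟨b, hab, side_self _ _⟩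
      · by_cases hb : w = b
        · exact Or.inl hb
        · refine Or.inr ⟨e, he, (side_step hab ?_ ?_).1 hs⟩
          · rintro ⟨rfl, -⟩; exact not_side hT he hs
          · rintro ⟨-, rfl⟩; exact hb rfl
  rcases key w v (hT.connected.preconnected w v) (Or.inl rfl) with h' | h'
  · exact absurd h' h
  · exact h'

theorem side_dist (hT : T.IsTree) {r s v p : V} (hrs : T.Adj r s) (hv : side T r s v)
    (hp : ¬ side T r s p) : T.dist v p = T.dist v s + 1 + T.dist r p := by
  apply le_antisymm
  · have h1 := hT.connected.dist_triangle (u := v) (v := s) (w := p)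
    have h2 := hT.connected.dist_triangle (u := s) (v := r) (w := p)
    have h3 : T.dist s r = 1 := dist_eq_one_iff_adj.2 hrs.symm
    omega
  · have key : ∀ a b, ∀ w : T.Walk a b, side T r s a → ¬ side T r s b →
        T.dist a s + 1 + T.dist r b ≤ w.length := by
      intro a b w
      induction w with
      | nil => intro h h'; exact absurd h h'
      | @cons a b c hab w ih =>
        intro ha hc
        by_cases hb : side T r s b
        · have h1 := ih hb hc
          have h2 := hT.connected.dist_triangle (u := a) (v := b) (w := s)
          have h3 : T.dist a b = 1 := dist_eq_one_iff_adj.2 hab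
          simp only [Walk.length_cons]; omega
        · have : (a = r ∧ b = s) ∨ (a = s ∧ b = r) := by
            by_contra hcon
            push Not at hcon
            exact hb ((side_step hab (by tauto) (by tauto)).1 ha)
          rcases this with ⟨rfl, rfl⟩ | ⟨rfl, rfl⟩
          · exact absurd ha (not_side hT hrs)
          · simp only [Walk.length_cons, dist_self]
            have := dist_le w; omega
    obtain ⟨w, hw⟩ := hT.connected.exists_walk_length_eq_dist v p
    rw [← hw]; exact key v p w hv hp

theorem side_dist_self (hT : T.IsTree) {r s v : V} (hrs : T.Adj r s) (hv : side T r s v) :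
    T.dist v r = T.dist v s + 1 := by
  simpa using side_dist hT hrs hv (not_side hT hrs)

/-- A vertex minimising the sum of the three distances: a step along an edge leading towards two of
the three vertices would lower the sum. -/
theorem exists_median [Finite V] (hT : T.IsTree) (a b c : V) : ∃ w, ∀ e, T.Adj w e →
    ¬ (side T w e a ∧ side T w e b) ∧ ¬ (side T w e a ∧ side T w e c) ∧
    ¬ (side T w e b ∧ side T w e c) := by
  have : Nonempty V := ⟨a⟩
  obtain ⟨w, hw⟩ := Finite.exists_min (fun w => T.dist a w + T.dist b w + T.dist c w)
  refine ⟨w, fun e he => ?_⟩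
  have hd : T.dist w e = 1 := dist_eq_one_iff_adj.2 he
  have h0 := hw e
  have h : ∀ x, T.dist x e ≤ T.dist x w + 1 := fun x => by
    have := hT.connected.dist_triangle (u := x) (v := w) (w := e); omega
  have ha := h a
  have hb := h b
  have hc := h c
  refine ⟨?_, ?_, ?_⟩ <;> rintro ⟨h1, h2⟩ <;>
    · have h1 := side_dist_self hT he h1
      have h2 := side_dist_self hT he h2
      omega

/-! ### Exchanging edges -/

/-- Remove the edge `pq`. -/
def del (T : SimpleGraph V) (e : V × V) : SimpleGraph V := T.deleteEdges {s(e.1, e.2)}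

theorem del_adj {p q a b : V} : (del T (p, q)).Adj a b ↔
    T.Adj a b ∧ ¬ (a = p ∧ b = q) ∧ ¬ (a = q ∧ b = p) := by
  simp [del]

/-- Add the edge `pq`. -/
def add (T : SimpleGraph V) (e : V × V) : SimpleGraph V := T ⊔ edge e.1 e.2

/-- Remove the edges in `R` and add those in `A`. -/
def mv (T : SimpleGraph V) (R A : List (V × V)) : SimpleGraph V := (R.foldl del T |> A.foldl add)

theorem foldl_del_adj (R : List (V × V)) (T : SimpleGraph V) (a b : V) : (R.foldl del T).Adj a b ↔
    T.Adj a b ∧ (a, b) ∉ R ∧ (b, a) ∉ R := by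
  induction R generalizing T with
  | nil => simp
  | cons e R ih =>
    rw [List.foldl_cons, ih]
    obtain ⟨p, q⟩ := e
    simp [del]
    tauto

theorem foldl_add_adj (A : List (V × V)) (T : SimpleGraph V) (a b : V) : (A.foldl add T).Adj a b ↔
    T.Adj a b ∨ (a ≠ b ∧ ((a, b) ∈ A ∨ (b, a) ∈ A)) := by
  induction A generalizing T with
  | nil => simp
  | cons e A ih =>
    rw [List.foldl_cons, ih]
    obtain ⟨p, q⟩ := e
    simp [add, edge_adj]
    tauto

theorem mv_adj {R A : List (V × V)} {a b : V} : (mv T R A).Adj a b ↔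
    (T.Adj a b ∧ (a, b) ∉ R ∧ (b, a) ∉ R) ∨ (a ≠ b ∧ ((a, b) ∈ A ∨ (b, a) ∈ A)) := by
  rw [mv, foldl_add_adj, foldl_del_adj]

/-- The path of `T` from `r` to `s` crosses exactly the edges that separate them, so it survives
when no removed edge does. -/
theorem mv_reach (hT : T.IsTree) {R A : List (V × V)} {r s : V}
    (h : ∀ e ∈ R, (side T e.1 e.2 r ↔ side T e.1 e.2 s)) :
    ∃ w : (mv T R A).Walk r s, w.length = T.dist r s := by
  obtain ⟨n, hn⟩ : ∃ n, T.dist r s = n := ⟨_, rfl⟩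
  induction n generalizing r with
  | zero =>
    have : r = s := by rwa [← hT.connected.dist_eq_zero_iff]
    subst this
    exact ⟨Walk.nil, by simp⟩
  | succ n ih =>
    have hne : r ≠ s := by rintro rfl; simp at hn
    obtain ⟨e, he, hs⟩ := exists_side hT hne
    have h1 := side_dist_self hT he hs
    rw [dist_comm] at h1
    rw [T.dist_comm (u := s)] at h1
    have n1 : (r, e) ∉ R := fun H => not_side hT he ((h _ H).2 hs)
    have n2 : (e, r) ∉ R := fun H => by
      have := (h _ H).1 (side_self _ _)
      rw [side_iff_not hT he.symm] at this
      exact this hs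
    obtain ⟨w, hw⟩ := ih (r := e) (fun d hd => by
      rw [← h d hd]
      refine (side_step he ?_ ?_).symm
      · rintro ⟨rfl, rfl⟩; exact n1 hd
      · rintro ⟨rfl, rfl⟩; exact n2 hd) (by omega)
    refine ⟨Walk.cons (mv_adj.2 (Or.inl ⟨he, n1, n2⟩)) w, ?_⟩
    simp [hw]; omega

theorem mv_dist_le (hT : T.IsTree) {R A : List (V × V)} {r s : V}
    (h : ∀ e ∈ R, (side T e.1 e.2 r ↔ side T e.1 e.2 s)) :
    (mv T R A).dist r s ≤ T.dist r s := by
  obtain ⟨w, hw⟩ := mv_reach (A := A) hT h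
  rw [← hw]; exact dist_le w

/-- `K` stands for membership in a fixed component of the new graph. Testing against all such
predicates turns connectedness into propositional reasoning about sides, with no walks to build. -/
theorem mv_connected (hT : T.IsTree) {R A : List (V × V)}
    (H : ∀ K : V → Prop, (∀ r s, (∀ e ∈ R, (side T e.1 e.2 r ↔ side T e.1 e.2 s)) → (K r ↔ K s)) →
      (∀ e ∈ A, (K e.1 ↔ K e.2)) → ∀ e ∈ R, (K e.1 ↔ K e.2)) : (mv T R A).Connected := by
  have : Nonempty V := hT.connected.nonempty
  obtain ⟨v0⟩ := this
  have hcl : ∀ r s, (mv T R A).Reachable r s →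
      ((mv T R A).Reachable v0 r ↔ (mv T R A).Reachable v0 s) :=
    fun r s h => ⟨fun h' => h'.trans h, fun h' => h'.trans h.symm⟩
  have hK := H (fun v => (mv T R A).Reachable v0 v) (fun r s h => hcl r s
    (mv_reach hT h).choose.reachable) (fun e he => by
      by_cases hne : e.1 = e.2
      · rw [hne]
      · exact hcl _ _ (Adj.reachable (mv_adj.2 (Or.inr ⟨hne, Or.inl he⟩))))
  have key : ∀ a b, T.Adj a b →
      ((mv T R A).Reachable v0 a ↔ (mv T R A).Reachable v0 b) := by
    intro a b hab
    by_cases c1 : (a, b) ∈ R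
    · exact hK _ c1
    by_cases c2 : (b, a) ∈ R
    · exact (hK _ c2).symm
    exact hcl _ _ (Adj.reachable (mv_adj.2 (Or.inl ⟨hab, c1, c2⟩)))
  have key2 : ∀ a b, T.Reachable a b → (mv T R A).Reachable v0 a → (mv T R A).Reachable v0 b := by
    rintro a b ⟨w⟩
    induction w with
    | nil => exact id
    | cons h w ih => exact fun H => ih ((key _ _ h).1 H)
  have := fun v => key2 v0 v (hT.connected.preconnected v0 v) (Reachable.refl _)
  exact { preconnected := fun a b => (this a).symm.trans (this b), nonempty := ⟨v0⟩ }

variable [Fintype V]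

/-- Degree, for graphs without a chosen decidability instance. -/
noncomputable def dg (T : SimpleGraph V) (v : V) : ℕ := (Finset.univ.filter (T.Adj v)).card

/-- Indicator of a vertex. -/
noncomputable def ι (a v : V) : ℕ := if v = a then 1 else 0

theorem dg_eq_degree (T : SimpleGraph V) (v : V) : dg T v = T.degree v := by
  rw [dg, ← card_neighborFinset_eq_degree]
  congr 1; ext; simp

theorem dg_del {e : V × V} (he : T.Adj e.1 e.2) (v : V) :
    dg (del T e) v + (ι e.1 v + ι e.2 v) = dg T v := by
  obtain ⟨p, q⟩ := e
  simp only at he ⊢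
  have hne := he.ne
  by_cases h1 : v = p
  · subst h1
    have : Finset.univ.filter ((del T (v, q)).Adj v) = (Finset.univ.filter (T.Adj v)).erase q := by
      ext x; simp only [Finset.mem_filter, Finset.mem_univ, del_adj, Finset.mem_erase]; grind [he.ne]
    rw [dg, dg, this, Finset.card_erase_of_mem (by simpa using he)]
    have : 0 < (Finset.univ.filter (T.Adj v)).card := Finset.card_pos.2 ⟨q, by simpa using he⟩
    simp [ι, hne]; omega
  · by_cases h2 : v = q
    · subst h2
      have : Finset.univ.filter ((del T (p, v)).Adj v) =
          (Finset.univ.filter (T.Adj v)).erase p := by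
        ext x; simp only [Finset.mem_filter, Finset.mem_univ, del_adj, Finset.mem_erase]; grind [he.ne]
      rw [dg, dg, this, Finset.card_erase_of_mem (by simpa using he.symm)]
      have : 0 < (Finset.univ.filter (T.Adj v)).card :=
        Finset.card_pos.2 ⟨p, by simpa using he.symm⟩
      simp [ι, h1]; omega
    · have : Finset.univ.filter ((del T (p, q)).Adj v) = Finset.univ.filter (T.Adj v) := by
        ext x; simp only [Finset.mem_filter, Finset.mem_univ, del_adj]; grind
      rw [dg, dg, this]; simp [ι, h1, h2]

theorem dg_add (T : SimpleGraph V) (e : V × V) (v : V) :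
    dg (add T e) v ≤ dg T v + (ι e.1 v + ι e.2 v) := by
  obtain ⟨p, q⟩ := e
  have : Finset.univ.filter ((add T (p, q)).Adj v) ⊆ Finset.univ.filter (T.Adj v) ∪
      ((if v = p then {q} else ∅) ∪ (if v = q then {p} else ∅)) := by
    intro x
    simp only [add, sup_adj, edge_adj, Finset.mem_filter, Finset.mem_univ, Finset.mem_union]
    split_ifs <;> simp <;> grind
  refine (Finset.card_le_card this).trans ((Finset.card_union_le _ _).trans ?_)
  refine Nat.add_le_add_left ((Finset.card_union_le _ _).trans ?_) _
  unfold ι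
  split_ifs <;> simp

theorem dg_foldl_add (A : List (V × V)) (T : SimpleGraph V) (v : V) :
    dg (A.foldl add T) v ≤ dg T v + (A.map fun e => ι e.1 v + ι e.2 v).sum := by
  induction A generalizing T with
  | nil => simp
  | cons e A ih =>
    have h1 := ih (add T e)
    have h2 := dg_add T e v
    simp only [List.foldl_cons, List.map_cons, List.sum_cons]
    omega

theorem dg_foldl_del (R : List (V × V)) (T : SimpleGraph V) (hR : ∀ e ∈ R, T.Adj e.1 e.2)
    (hp : R.Pairwise fun e f => f ≠ e ∧ f ≠ e.swap) (v : V) :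
    dg (R.foldl del T) v + (R.map fun e => ι e.1 v + ι e.2 v).sum = dg T v := by
  induction R generalizing T with
  | nil => simp
  | cons e R ih =>
    rw [List.pairwise_cons] at hp
    have h1 := ih (del T e) (fun f hf => by
      have h := hp.1 f hf
      have h' := hR f (by simp [hf])
      obtain ⟨a, b⟩ := e
      obtain ⟨c, d⟩ := f
      simp [del] at h h' ⊢
      grind) hp.2
    have h2 := dg_del (hR e (by simp)) v
    simp only [List.foldl_cons, List.map_cons, List.sum_cons]
    omega

theorem sum_ι (a : V) : ∑ v, ι a v = 1 := by simp [ι]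

theorem sum_list_ι (R : List (V × V)) :
    ∑ v, (R.map fun e => ι e.1 v + ι e.2 v).sum = 2 * R.length := by
  induction R with
  | nil => simp
  | cons e R ih =>
    simp only [List.map_cons, List.sum_cons, List.length_cons, Finset.sum_add_distrib, sum_ι, ih]
    ring

theorem sum_dg (T : SimpleGraph V) : ∑ v, dg T v = 2 * T.edgeFinset.card := by
  simp_rw [dg_eq_degree]; exact sum_degrees_eq_twice_card_edges T

theorem sum_dg_tree (hT : T.IsTree) : ∑ v, dg T v + 2 = 2 * Fintype.card V := by
  rw [sum_dg, ← hT.card_edgeFinset]; ring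

theorem le_sum_dg (hT : T.Connected) : 2 * Fintype.card V ≤ ∑ v, dg T v + 2 := by
  have := hT.card_vert_le_card_edgeSet_add_one
  rw [sum_dg, edgeFinset_card]
  simp only [Nat.card_eq_fintype_card] at this
  omega

/-- Added edges might coincide with each other or with edges still present, so a priori the degrees
are only bounded above. A connected graph has at least |V| - 1 edges, which forces equality at every
vertex; hence the added edges need not be checked to be new. -/
theorem mv_isTree (hT : T.IsTree) {R A : List (V × V)} (hR : ∀ e ∈ R, T.Adj e.1 e.2)
    (hp : R.Pairwise fun e f => f ≠ e ∧ f ≠ e.swap) (hl : A.length = R.length)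
    (hc : (mv T R A).Connected) : (mv T R A).IsTree ∧ ∀ v,
      dg (mv T R A) v + (R.map fun e => ι e.1 v + ι e.2 v).sum =
        dg T v + (A.map fun e => ι e.1 v + ι e.2 v).sum := by
  have h1 : ∀ v, dg (mv T R A) v + (R.map fun e => ι e.1 v + ι e.2 v).sum ≤
        dg T v + (A.map fun e => ι e.1 v + ι e.2 v).sum := by
    intro v
    have := dg_foldl_add A (R.foldl del T) v
    have := dg_foldl_del R T hR hp v
    change dg (A.foldl add (R.foldl del T)) v + _ ≤ _
    omega
  have h2 : ∑ v, (dg T v + (A.map fun e => ι e.1 v + ι e.2 v).sum) ≤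
      ∑ v, (dg (mv T R A) v + (R.map fun e => ι e.1 v + ι e.2 v).sum) := by
    have := sum_dg_tree hT
    have := le_sum_dg hc
    simp only [Finset.sum_add_distrib, sum_list_ι, hl]
    omega
  have h3 := (Finset.sum_eq_sum_iff_of_le (fun v _ => h1 v)).1
    (le_antisymm (Finset.sum_le_sum fun v _ => h1 v) h2)
  refine ⟨?_, fun v => h3 v (Finset.mem_univ v)⟩
  rw [isTree_iff_connected_and_card]
  refine ⟨hc, ?_⟩
  have h4 := Finset.sum_congr rfl h3
  simp only [Finset.sum_add_distrib, sum_list_ι, hl] at h4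
  have h5 := sum_dg_tree hT
  have h6 := sum_dg (mv T R A)
  simp only [Nat.card_eq_fintype_card]
  rw [← edgeFinset_card]
  omega

end

/-! ### Exchanges inside `G` and their degree changes -/

section

variable {V : Type*} [Fintype V] {G T T' : SimpleGraph V}

/-- `T'` is a spanning tree of `G` whose degrees are those of `T`, except that they are lower by `r`
and higher by `a`. -/
structure Exch (G T T' : SimpleGraph V) (r a : V → ℕ) : Prop where
  le : T' ≤ G
  isTree : T'.IsTree
  deg : ∀ v, dg T' v + r v = dg T v + a v

theorem exch_mv (hTG : T ≤ G) (hT : T.IsTree) {R A : List (V × V)} (hR : ∀ e ∈ R, T.Adj e.1 e.2)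
    (hp : R.Pairwise fun e f => f ≠ e ∧ f ≠ e.swap) (hl : A.length = R.length)
    (hA : ∀ e ∈ A, G.Adj e.1 e.2)
    (H : ∀ K : V → Prop, (∀ r s, (∀ e ∈ R, (side T e.1 e.2 r ↔ side T e.1 e.2 s)) → (K r ↔ K s)) →
      (∀ e ∈ A, (K e.1 ↔ K e.2)) → ∀ e ∈ R, (K e.1 ↔ K e.2)) :
    Exch G T (mv T R A) (fun v => (R.map fun e => ι e.1 v + ι e.2 v).sum)
      fun v => (A.map fun e => ι e.1 v + ι e.2 v).sum := by
  obtain ⟨h1, h2⟩ := mv_isTree hT hR hp hl (mv_connected hT H)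
  refine ⟨fun a b h => ?_, h1, h2⟩
  rcases mv_adj.1 h with h | h
  · exact hTG h.1
  · rcases h.2 with h | h
    · exact hA _ h
    · exact (hA _ h).symm

theorem exch1 (hTG : T ≤ G) (hT : T.IsTree) {p q r s : V} (h1 : T.Adj p q) (a1 : G.Adj r s)
    (H : side T p q r ↔ ¬ side T p q s) :
    Exch G T (mv T [(p, q)] [(r, s)]) (fun v => ι p v + ι q v) fun v => ι r v + ι s v := by
  have := exch_mv (R := [(p, q)]) (A := [(r, s)]) hTG hT (by simpa) (by simp) rfl (by simpa) (by
    simp only [List.mem_singleton, forall_eq]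
    intro K hK hA
    have := side_self (T := T) p q
    have := not_side hT h1
    grind)
  simpa using this

theorem exch2 (hTG : T ≤ G) (hT : T.IsTree) {p q p' q' r s r' s' : V} (h1 : T.Adj p q)
    (h2 : T.Adj p' q') (n1 : ¬ (p' = p ∧ q' = q)) (n2 : ¬ (p' = q ∧ q' = p)) (a1 : G.Adj r s)
    (a2 : G.Adj r' s')
    (H : ∀ K : V → Prop, (∀ a b, (side T p q a ↔ side T p q b) →
      (side T p' q' a ↔ side T p' q' b) → (K a ↔ K b)) → (K r ↔ K s) → (K r' ↔ K s') →
      (K p ↔ K q) ∧ (K p' ↔ K q')) :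
    Exch G T (mv T [(p, q), (p', q')] [(r, s), (r', s')])
      (fun v => ι p v + ι q v + (ι p' v + ι q' v)) fun v => ι r v + ι s v + (ι r' v + ι s' v) := by
  have := exch_mv (R := [(p, q), (p', q')]) (A := [(r, s), (r', s')]) hTG hT (by simp [h1, h2])
    (by simp; tauto) rfl (by simp [a1, a2]) (by
      simp only [List.mem_cons, List.not_mem_nil, or_false, forall_eq_or_imp, forall_eq]
      intro K hK hA
      exact H K (fun a b h h' => hK a b ⟨h, h'⟩) hA.1 hA.2)
  simpa using this

theorem exch3 (hTG : T ≤ G) (hT : T.IsTree) {p q p' q' p'' q'' r s r' s' r'' s'' : V}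
    (h1 : T.Adj p q) (h2 : T.Adj p' q') (h3 : T.Adj p'' q'')
    (n1 : ¬ (p' = p ∧ q' = q)) (n2 : ¬ (p' = q ∧ q' = p))
    (n3 : ¬ (p'' = p ∧ q'' = q)) (n4 : ¬ (p'' = q ∧ q'' = p))
    (n5 : ¬ (p'' = p' ∧ q'' = q')) (n6 : ¬ (p'' = q' ∧ q'' = p'))
    (a1 : G.Adj r s) (a2 : G.Adj r' s') (a3 : G.Adj r'' s'')
    (H : ∀ K : V → Prop, (∀ a b, (side T p q a ↔ side T p q b) →
      (side T p' q' a ↔ side T p' q' b) → (side T p'' q'' a ↔ side T p'' q'' b) →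
      (K a ↔ K b)) → (K r ↔ K s) → (K r' ↔ K s') → (K r'' ↔ K s'') →
      (K p ↔ K q) ∧ (K p' ↔ K q') ∧ (K p'' ↔ K q'')) :
    Exch G T (mv T [(p, q), (p', q'), (p'', q'')] [(r, s), (r', s'), (r'', s'')])
      (fun v => ι p v + ι q v + (ι p' v + ι q' v + (ι p'' v + ι q'' v)))
      fun v => ι r v + ι s v + (ι r' v + ι s' v + (ι r'' v + ι s'' v)) := by
  have := exch_mv (R := [(p, q), (p', q'), (p'', q'')])
    (A := [(r, s), (r', s'), (r'', s'')]) hTG hT (by simp [h1, h2, h3])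
    (by simp; tauto) rfl (by simp [a1, a2, a3]) (by
      simp only [List.mem_cons, List.not_mem_nil, or_false, forall_eq_or_imp, forall_eq]
      intro K hK hA
      exact H K (fun a b h h' h'' => hK a b ⟨h, h', h''⟩) hA.1 hA.2.1 hA.2.2)
  simpa using this

end

section

variable {V : Type*} [Fintype V] {G T T' : SimpleGraph V} {ρ : V}

/-! ### The weight of a spanning tree -/

/-- The weight of a vertex of degree `d` in a tree, when leaves and branch vertices cost `K`. -/
def wt (K : ℤ) (d : ℕ) : ℤ := if d = 1 then K else if d ≤ 2 then 0 else 2 * K + d ^ 2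

/-- The change of weight when the degree `d` increases by one. -/
def dW (K : ℤ) (d : ℕ) : ℤ := wt K (d + 1) - wt K d

/-- Lowering the degree of a vertex costs at most one new leaf. This suffices for the vertices `e`
below, whose degree is not known. -/
theorem neg_le_dW {K : ℤ} (hK : 0 ≤ K) {d : ℕ} (h : 1 ≤ d) : -K ≤ dW K d := by
  unfold dW wt
  rcases (by omega : d = 1 ∨ 2 ≤ d) with rfl | h
  · simp
  · have h1 : d + 1 ≠ 1 := by omega
    have h2 : ¬ d + 1 ≤ 2 := by omega
    have h3 : d ≠ 1 := by omega
    simp only [h1, h2, h3, if_false]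
    push_cast
    split_ifs <;> nlinarith

/-- Since d < |V|, the increments 2d + 1 stay below half of `cost V`, so a few of them cannot
outweigh a leaf or a branch vertex. The small values 7 (from 3 to 4) and 9 (from 4 to 5, and the 9
in 2K + 9) decide the ties. -/
theorem dW_eq (K : ℤ) {d : ℕ} (h : 1 ≤ d) :
    dW K d = if d = 1 then -K else if d = 2 then 2 * K + 9 else 2 * d + 1 := by
  rcases (by omega : d = 1 ∨ d = 2 ∨ 3 ≤ d) with rfl | rfl | h
  · simp [dW, wt]
  · simp [dW, wt]
  · have h1 : d + 1 ≠ 1 := by omega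
    have h2 : ¬ d + 1 ≤ 2 := by omega
    have h3 : d ≠ 1 := by omega
    have h4 : ¬ d ≤ 2 := by omega
    have h5 : d ≠ 2 := by omega
    simp only [dW, wt, h1, h2, h3, h4, h5, if_false]
    push_cast; ring

/-- Total change of weight when the degrees `f` are increased along the list. -/
noncomputable def incr (K : ℤ) : (V → ℕ) → List V → ℤ
  | _, [] => 0
  | f, a :: l => dW K (f a) + incr K (fun v => f v + ι a v) l

theorem sum_wt_incr (K : ℤ) (l : List V) (f : V → ℕ) :
    ∑ v, wt K (f v + (l.map fun a => ι a v).sum) = ∑ v, wt K (f v) + incr K f l := by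
  induction l generalizing f with
  | nil => simp [incr]
  | cons a l ih =>
    have h := ih (fun v => f v + ι a v)
    simp only [incr, List.map_cons, List.sum_cons]
    simp only [add_assoc] at h ⊢
    rw [h]
    have : ∑ v, wt K (f v + ι a v) = ∑ v, (wt K (f v) + if v = a then dW K (f a) else 0) := by
      refine Finset.sum_congr rfl fun v _ => ?_
      by_cases hv : v = a
      · subst hv; simp [ι, dW]
      · simp [ι, hv]
    rw [this, Finset.sum_add_distrib]
    simp [add_assoc]

/-- The cost of a leaf. -/
noncomputable def cost (V : Type*) [Fintype V] : ℤ := 4 * Fintype.card V + 100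

/-- The weight of a tree. -/
noncomputable def W (T : SimpleGraph V) : ℤ := ∑ v, wt (cost V) (dg T v)

/-- Gains `l` are counted up from `T` and losses `l'` up from `T'`, both ending at the same degree
function; no subtraction of degrees is needed. -/
theorem W_incr {l l' : List V} (h : ∀ v, dg T' v + (l'.map fun a => ι a v).sum =
    dg T v + (l.map fun a => ι a v).sum) :
    W T' + incr (cost V) (dg T') l' = W T + incr (cost V) (dg T) l := by
  rw [W, W, ← sum_wt_incr, ← sum_wt_incr]
  exact Finset.sum_congr rfl fun v _ => by rw [h]

/-- Weighted count of the branch vertices, dominated by those near `ρ`. -/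
noncomputable def pot (T : SimpleGraph V) (ρ : V) : ℕ :=
  ∑ v with 3 ≤ dg T v, (Fintype.card V + 1) ^ (Fintype.card V - T.dist ρ v)

theorem dist_lt_card (hT : T.Connected) (a b : V) : T.dist a b < Fintype.card V := by
  obtain ⟨p, hp, h⟩ := hT.exists_path_of_dist a b
  rw [← h]; exact hp.length_lt

/-- With N = |V|, a branch vertex gained within distance `k` contributes at least (N + 1)^(N - k).
The old branch vertices beyond `k` are at most N in number and contribute at most (N + 1)^(N - k -
1) each, so losing all of them does not matter. -/
theorem pot_lt (hT : T.Connected) {k : ℕ} (hi : ∀ v, 3 ≤ dg T v → T.dist ρ v ≤ k → 3 ≤ dg T' v ∧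
    T'.dist ρ v ≤ T.dist ρ v) {g : V} (hg : 3 ≤ dg T' g) (hgk : T'.dist ρ g ≤ k)
    (hg' : 3 ≤ dg T g → k < T.dist ρ g) : pot T ρ < pot T' ρ := by
  set N := Fintype.card V with hN
  set A := (Finset.univ.filter fun v => 3 ≤ dg T v).filter fun v => T.dist ρ v ≤ k with hA
  set C := (Finset.univ.filter fun v => 3 ≤ dg T v).filter fun v => ¬ T.dist ρ v ≤ k with hC
  have hgA : g ∉ A := by
    simp only [hA, Finset.mem_filter, Finset.mem_univ, true_and, not_and, not_le]; exact hg'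
  have h1 : pot T ρ = ∑ v ∈ A, (N + 1) ^ (N - T.dist ρ v) + ∑ v ∈ C, (N + 1) ^ (N - T.dist ρ v) :=
    (Finset.sum_filter_add_sum_filter_not _ _ _).symm
  have h2 : ∑ v ∈ A, (N + 1) ^ (N - T.dist ρ v) ≤ ∑ v ∈ A, (N + 1) ^ (N - T'.dist ρ v) := by
    refine Finset.sum_le_sum fun v hv => Nat.pow_le_pow_right (by omega) ?_
    simp only [hA, Finset.mem_filter, Finset.mem_univ, true_and] at hv
    have := (hi v hv.1 hv.2).2
    omega
  have h3 : ∑ v ∈ insert g A, (N + 1) ^ (N - T'.dist ρ v) ≤ pot T' ρ := by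
    refine Finset.sum_le_sum_of_subset fun v hv => ?_
    simp only [Finset.mem_insert, hA, Finset.mem_filter, Finset.mem_univ, true_and] at hv ⊢
    rcases hv with rfl | hv
    · exact hg
    · exact (hi v hv.1 hv.2).1
  rw [Finset.sum_insert hgA] at h3
  have h4 : (N + 1) ^ (N - k) ≤ (N + 1) ^ (N - T'.dist ρ g) :=
    Nat.pow_le_pow_right (by omega) (by omega)
  have h5 : ∑ v ∈ C, (N + 1) ^ (N - T.dist ρ v) < (N + 1) ^ (N - k) := by
    by_cases hk : k < N
    · calc ∑ v ∈ C, (N + 1) ^ (N - T.dist ρ v) ≤ ∑ v ∈ C, (N + 1) ^ (N - k - 1) := by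
            refine Finset.sum_le_sum fun v hv => Nat.pow_le_pow_right (by omega) ?_
            simp only [hC, Finset.mem_filter, Finset.mem_univ, true_and] at hv
            omega
        _ = C.card * (N + 1) ^ (N - k - 1) := by simp
        _ ≤ N * (N + 1) ^ (N - k - 1) := Nat.mul_le_mul_right _ (Finset.card_le_univ _)
        _ < (N + 1) * (N + 1) ^ (N - k - 1) :=
            Nat.mul_lt_mul_of_pos_right (by omega) (by positivity)
        _ = (N + 1) ^ (N - k) := by rw [← pow_succ']; congr 1; omega
    · have : C = ∅ := by
        rw [hC, Finset.filter_eq_empty_iff]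
        intro v _
        have := dist_lt_card hT ρ v
        omega
      rw [this]; simp
  omega

/-- `T` is an optimal spanning tree of the graph `G` and `ρ` an optimal root. -/
structure Opt (G T : SimpleGraph V) (ρ : V) : Prop where
  le : T ≤ G
  isTree : T.IsTree
  root : 3 ≤ dg T ρ
  weight : ∀ T' ≤ G, T'.IsTree → W T ≤ W T'
  rootDeg : ∀ T' ≤ G, T'.IsTree → W T' ≤ W T → ∀ r, 3 ≤ dg T' r → dg T ρ ≤ dg T' r
  potential : ∀ T' ≤ G, T'.IsTree → W T' ≤ W T → 3 ≤ dg T' ρ → dg T' ρ ≤ dg T ρ →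
    pot T' ρ ≤ pot T ρ

theorem exists_opt (hG : ∃ T ≤ G, T.IsTree) (hB : ∀ T ≤ G, T.IsTree → ∃ v, 3 ≤ dg T v) :
    ∃ T ρ, Opt G T ρ := by
  let s : Finset (SimpleGraph V × V) :=
    Finset.univ.filter fun x => x.1 ≤ G ∧ x.1.IsTree ∧ 3 ≤ dg x.1 x.2
  have hs : s.Nonempty := by
    obtain ⟨T, hT, hT'⟩ := hG
    obtain ⟨v, hv⟩ := hB T hT hT'
    exact ⟨(T, v), by simp [s, hT, hT', hv]⟩
  -- Lexicographic minimum: weight, then degree of the root, then the negated potential.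
  obtain ⟨⟨T, ρ⟩, hm, hmin⟩ := s.exists_min_image
    (fun x => toLex (W x.1, toLex (dg x.1 x.2, -(pot x.1 x.2 : ℤ)))) hs
  have hmin' : ∀ T' ≤ G, T'.IsTree → ∀ r, 3 ≤ dg T' r → W T < W T' ∨ (W T = W T' ∧
      (dg T ρ < dg T' r ∨ (dg T ρ = dg T' r ∧ pot T' r ≤ pot T ρ))) := by
    intro T' h1 h2 r h3
    have := hmin (T', r) (by simp [s, h1, h2, h3])
    simpa [Prod.Lex.le_iff] using this
  simp only [s, Finset.mem_filter, Finset.mem_univ, true_and] at hm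
  refine ⟨T, ρ, hm.1, hm.2.1, hm.2.2, fun T' h1 h2 => ?_, fun T' h1 h2 hW r h3 => ?_,
    fun T' h1 h2 hW h3 h4 => ?_⟩
  · obtain ⟨v, hv⟩ := hB T' h1 h2
    rcases hmin' T' h1 h2 v hv with h | h
    · exact h.le
    · exact h.1.le
  · rcases hmin' T' h1 h2 r h3 with h | ⟨-, h | h⟩
    · omega
    · exact h.le
    · exact h.1.le
  · rcases hmin' T' h1 h2 ρ h3 with h | ⟨-, h | h⟩
    · omega
    · omega
    · exact h.2

theorem dg_lt_card (T : SimpleGraph V) (v : V) : dg T v < Fintype.card V := by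
  rw [dg_eq_degree]; exact T.degree_lt_card_verts v

theorem Opt.pos (o : Opt G T ρ) (hT' : T'.IsTree) (v : V) : 1 ≤ dg T' v := by
  have h := dg_lt_card T ρ
  have h' := o.root
  have : Nontrivial V := Fintype.one_lt_card_iff_nontrivial.1 (by omega)
  rw [dg_eq_degree]
  exact hT'.connected.preconnected.degree_pos_of_nontrivial v

theorem cost_pos : 100 ≤ cost V := by unfold cost; linarith [Nat.cast_nonneg (α := ℤ) (Fintype.card V)]

/-! ### Balance sheets: degree changes that lower or keep the weight (K denotes `cost V`) -/

section patterns

variable {r a : V → ℕ} {u u' v w e x x' g c z p p' : V}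

/-- If the degree changes do not increase the weight, they keep it. -/
theorem Opt.le_of_incr (o : Opt G T ρ) (h : Exch G T T' r a) {l l' : List V}
    (hd : ∀ v, dg T' v + (l'.map fun a => ι a v).sum = dg T v + (l.map fun a => ι a v).sum) :
    0 ≤ incr (cost V) (dg T) l - incr (cost V) (dg T') l' ∧
    (incr (cost V) (dg T) l - incr (cost V) (dg T') l' ≤ 0 → W T' ≤ W T) := by
  have h1 := W_incr hd
  have h2 := o.weight T' h.le h.isTree
  constructor
  · linarith
  · intro; linarith

theorem Opt.leaf_branch (o : Opt G T ρ) (h : Exch G T T' r a)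
    (hd : ∀ t, dg T' t + (ι v t) = dg T t + (ι u t))
    (hu : dg T u = 1) (hv : 3 ≤ dg T v) :
    False := by
  have h0 := o.le_of_incr h (l := [u]) (l' := [v]) (fun t => by simpa [add_assoc] using hd t)
  simp only [incr] at h0
  have d_u := hd u
  have p_u := o.pos h.isTree u
  have q_u := o.pos o.isTree u
  have c_u : (dg T u : ℤ) < Fintype.card V := by exact_mod_cast dg_lt_card T u
  have d_v := hd v
  have p_v := o.pos h.isTree v
  have q_v := o.pos o.isTree v
  have c_v : (dg T v : ℤ) < Fintype.card V := by exact_mod_cast dg_lt_card T v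
  have hc := cost_pos (V := V)
  have hc' : cost V = 4 * (Fintype.card V : ℤ) + 100 := rfl
  grind (splits := 40) [ι, dW_eq]

theorem Opt.two_leaves (o : Opt G T ρ) (h : Exch G T T' r a)
    (hd : ∀ t, dg T' t + (ι e t + ι w t) = dg T t + (ι u t + ι u' t))
    (hu : dg T u = 1) (hu' : dg T u' = 1) (hn : u ≠ u') (hw : 3 ≤ dg T w) :
    False := by
  have h0 := o.le_of_incr h (l := [u, u']) (l' := [e, w]) (fun t => by simpa [add_assoc] using hd t)
  simp only [incr] at h0
  have d_e := hd e
  have p_e := o.pos h.isTree e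
  have q_e := o.pos o.isTree e
  have c_e : (dg T e : ℤ) < Fintype.card V := by exact_mod_cast dg_lt_card T e
  have d_u := hd u
  have p_u := o.pos h.isTree u
  have q_u := o.pos o.isTree u
  have c_u : (dg T u : ℤ) < Fintype.card V := by exact_mod_cast dg_lt_card T u
  have d_u1 := hd u'
  have p_u1 := o.pos h.isTree u'
  have q_u1 := o.pos o.isTree u'
  have c_u1 : (dg T u' : ℤ) < Fintype.card V := by exact_mod_cast dg_lt_card T u'
  have d_w := hd w
  have p_w := o.pos h.isTree w
  have q_w := o.pos o.isTree w
  have c_w : (dg T w : ℤ) < Fintype.card V := by exact_mod_cast dg_lt_card T w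
  have hc := cost_pos (V := V)
  have he := neg_le_dW (by linarith : (0 : ℤ) ≤ cost V) p_e
  generalize dW (cost V) (dg T' e) = δ at h0 he
  have hc' : cost V = 4 * (Fintype.card V : ℤ) + 100 := rfl
  grind (splits := 40) [ι, dW_eq]

/-- `x` drops from 3 to 2 and saves 2K + 9; only raising a vertex from 2 to 3 costs as much. -/
theorem Opt.shift_cubic (o : Opt G T ρ) (h : Exch G T T' r a)
    (hd : ∀ t, dg T' t + (ι x t) = dg T t + (ι c t))
    (hx : dg T x = 3) (hn : c ≠ x) :
    dg T c = 2 ∧ W T' ≤ W T := by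
  have h0 := o.le_of_incr h (l := [c]) (l' := [x]) (fun t => by simpa [add_assoc] using hd t)
  simp only [incr] at h0
  have d_c := hd c
  have p_c := o.pos h.isTree c
  have q_c := o.pos o.isTree c
  have c_c : (dg T c : ℤ) < Fintype.card V := by exact_mod_cast dg_lt_card T c
  have d_x := hd x
  have p_x := o.pos h.isTree x
  have q_x := o.pos o.isTree x
  have c_x : (dg T x : ℤ) < Fintype.card V := by exact_mod_cast dg_lt_card T x
  have hc := cost_pos (V := V)
  have hc' : cost V = 4 * (Fintype.card V : ℤ) + 100 := rfl
  grind (splits := 40) [ι, dW_eq]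

/-- The saving K at `u` pays for a possible new leaf `e`, and `x` costs 7. Lowering `w` saves 2K + 9
from degree 3 and 2d - 1 from degree d ≥ 4, so only d = 4 breaks even. -/
theorem Opt.leaf_cubic (o : Opt G T ρ) (h : Exch G T T' r a)
    (hd : ∀ t, dg T' t + (ι e t + ι w t) = dg T t + (ι u t + ι x t))
    (hu : dg T u = 1) (hx : dg T x = 3) (hw : 3 ≤ dg T w) (hn : w ≠ x) :
    dg T w = 4 ∧ W T' ≤ W T := by
  have h0 := o.le_of_incr h (l := [u, x]) (l' := [e, w]) (fun t => by simpa [add_assoc] using hd t)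
  simp only [incr] at h0
  have d_e := hd e
  have p_e := o.pos h.isTree e
  have q_e := o.pos o.isTree e
  have c_e : (dg T e : ℤ) < Fintype.card V := by exact_mod_cast dg_lt_card T e
  have d_u := hd u
  have p_u := o.pos h.isTree u
  have q_u := o.pos o.isTree u
  have c_u : (dg T u : ℤ) < Fintype.card V := by exact_mod_cast dg_lt_card T u
  have d_w := hd w
  have p_w := o.pos h.isTree w
  have q_w := o.pos o.isTree w
  have c_w : (dg T w : ℤ) < Fintype.card V := by exact_mod_cast dg_lt_card T w
  have d_x := hd x
  have p_x := o.pos h.isTree x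
  have q_x := o.pos o.isTree x
  have c_x : (dg T x : ℤ) < Fintype.card V := by exact_mod_cast dg_lt_card T x
  have hc := cost_pos (V := V)
  have he := neg_le_dW (by linarith : (0 : ℤ) ≤ cost V) p_e
  generalize dW (cost V) (dg T' e) = δ at h0 he
  have hc' : cost V = 4 * (Fintype.card V : ℤ) + 100 := rfl
  grind (splits := 40) [ι, dW_eq]

theorem Opt.leaf_quartic (o : Opt G T ρ) (h : Exch G T T' r a)
    (hd : ∀ t, dg T' t + (ι w t + ι w t) = dg T t + (ι u t + ι z t))
    (hu : dg T u = 1) (hw : dg T w = 4) :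
    False := by
  have h0 := o.le_of_incr h (l := [u, z]) (l' := [w, w]) (fun t => by simpa [add_assoc] using hd t)
  simp only [incr] at h0
  have d_u := hd u
  have p_u := o.pos h.isTree u
  have q_u := o.pos o.isTree u
  have c_u : (dg T u : ℤ) < Fintype.card V := by exact_mod_cast dg_lt_card T u
  have d_w := hd w
  have p_w := o.pos h.isTree w
  have q_w := o.pos o.isTree w
  have c_w : (dg T w : ℤ) < Fintype.card V := by exact_mod_cast dg_lt_card T w
  have d_z := hd z
  have p_z := o.pos h.isTree z
  have q_z := o.pos o.isTree z
  have c_z : (dg T z : ℤ) < Fintype.card V := by exact_mod_cast dg_lt_card T z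
  have hc := cost_pos (V := V)
  have hc' : cost V = 4 * (Fintype.card V : ℤ) + 100 := rfl
  grind (splits := 40) [ι, dW_eq]

/-- Lowering `w` from 4 to 2 saves 7 + (2K + 9). The 7 pays for `x`, the saving at `u` pays for `e`,
and `g` must use up all of 2K + 9. -/
theorem Opt.leaf_cubic_parent (o : Opt G T ρ) (h : Exch G T T' r a)
    (hd : ∀ t, dg T' t + (ι e t + ι w t + ι w t) = dg T t + (ι u t + ι x t + ι g t))
    (hu : dg T u = 1) (hx : dg T x = 3) (hw : dg T w = 4) (hg : 2 ≤ dg T g) (hn : g ≠ w) :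
    dg T g = 2 ∧ W T' ≤ W T := by
  have h0 := o.le_of_incr h (l := [u, x, g]) (l' := [e, w, w]) (fun t => by simpa [add_assoc] using hd t)
  simp only [incr] at h0
  have d_e := hd e
  have p_e := o.pos h.isTree e
  have q_e := o.pos o.isTree e
  have c_e : (dg T e : ℤ) < Fintype.card V := by exact_mod_cast dg_lt_card T e
  have d_g := hd g
  have p_g := o.pos h.isTree g
  have q_g := o.pos o.isTree g
  have c_g : (dg T g : ℤ) < Fintype.card V := by exact_mod_cast dg_lt_card T g
  have d_u := hd u
  have p_u := o.pos h.isTree u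
  have q_u := o.pos o.isTree u
  have c_u : (dg T u : ℤ) < Fintype.card V := by exact_mod_cast dg_lt_card T u
  have d_w := hd w
  have p_w := o.pos h.isTree w
  have q_w := o.pos o.isTree w
  have c_w : (dg T w : ℤ) < Fintype.card V := by exact_mod_cast dg_lt_card T w
  have d_x := hd x
  have p_x := o.pos h.isTree x
  have q_x := o.pos o.isTree x
  have c_x : (dg T x : ℤ) < Fintype.card V := by exact_mod_cast dg_lt_card T x
  have hc := cost_pos (V := V)
  have he := neg_le_dW (by linarith : (0 : ℤ) ≤ cost V) p_e
  generalize dW (cost V) (dg T' e) = δ at h0 he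
  have hc' : cost V = 4 * (Fintype.card V : ℤ) + 100 := rfl
  grind (splits := 40) [ι, dW_eq]

theorem Opt.leaf_shift (o : Opt G T ρ) (h : Exch G T T' r a)
    (hd : ∀ t, dg T' t + (ι e t + ι x t) = dg T t + (ι u t + ι c t))
    (hu : dg T u = 1) (hx : dg T x = 3) (hc : 2 ≤ dg T c) (hn : c ≠ x) :
    dg T c = 2 ∧ W T' ≤ W T := by
  have h0 := o.le_of_incr h (l := [u, c]) (l' := [e, x]) (fun t => by simpa [add_assoc] using hd t)
  simp only [incr] at h0
  have d_c := hd c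
  have p_c := o.pos h.isTree c
  have q_c := o.pos o.isTree c
  have c_c : (dg T c : ℤ) < Fintype.card V := by exact_mod_cast dg_lt_card T c
  have d_e := hd e
  have p_e := o.pos h.isTree e
  have q_e := o.pos o.isTree e
  have c_e : (dg T e : ℤ) < Fintype.card V := by exact_mod_cast dg_lt_card T e
  have d_u := hd u
  have p_u := o.pos h.isTree u
  have q_u := o.pos o.isTree u
  have c_u : (dg T u : ℤ) < Fintype.card V := by exact_mod_cast dg_lt_card T u
  have d_x := hd x
  have p_x := o.pos h.isTree x
  have q_x := o.pos o.isTree x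
  have c_x : (dg T x : ℤ) < Fintype.card V := by exact_mod_cast dg_lt_card T x
  have hc := cost_pos (V := V)
  have he := neg_le_dW (by linarith : (0 : ℤ) ≤ cost V) p_e
  generalize dW (cost V) (dg T' e) = δ at h0 he
  have hc' : cost V = 4 * (Fintype.card V : ℤ) + 100 := rfl
  grind (splits := 40) [ι, dW_eq]

/-- The cost is at most 7 + 7 + K, against the saving 2K + 9 at `w`. -/
theorem Opt.three_cubics (o : Opt G T ρ) (h : Exch G T T' r a)
    (hd : ∀ t, dg T' t + (ι e t + ι w t) = dg T t + (ι x t + ι x' t))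
    (hx : dg T x = 3) (hx' : dg T x' = 3) (hw : dg T w = 3) (hn : x ≠ x') (hn1 : w ≠ x) (hn2 : w ≠ x') :
    False := by
  have h0 := o.le_of_incr h (l := [x, x']) (l' := [e, w]) (fun t => by simpa [add_assoc] using hd t)
  simp only [incr] at h0
  have d_e := hd e
  have p_e := o.pos h.isTree e
  have q_e := o.pos o.isTree e
  have c_e : (dg T e : ℤ) < Fintype.card V := by exact_mod_cast dg_lt_card T e
  have d_w := hd w
  have p_w := o.pos h.isTree w
  have q_w := o.pos o.isTree w
  have c_w : (dg T w : ℤ) < Fintype.card V := by exact_mod_cast dg_lt_card T w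
  have d_x := hd x
  have p_x := o.pos h.isTree x
  have q_x := o.pos o.isTree x
  have c_x : (dg T x : ℤ) < Fintype.card V := by exact_mod_cast dg_lt_card T x
  have d_x1 := hd x'
  have p_x1 := o.pos h.isTree x'
  have q_x1 := o.pos o.isTree x'
  have c_x1 : (dg T x' : ℤ) < Fintype.card V := by exact_mod_cast dg_lt_card T x'
  have hc := cost_pos (V := V)
  have he := neg_le_dW (by linarith : (0 : ℤ) ≤ cost V) p_e
  generalize dW (cost V) (dg T' e) = δ at h0 he
  have hc' : cost V = 4 * (Fintype.card V : ℤ) + 100 := rfl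
  grind (splits := 40) [ι, dW_eq]

/-- The cost is 7 + 7; two steps down at `w` save at least 9 + 7, or even a whole branch vertex if
its degree is 4. -/
theorem Opt.two_cubics (o : Opt G T ρ) (h : Exch G T T' r a)
    (hd : ∀ t, dg T' t + (ι w t + ι w t) = dg T t + (ι x t + ι x' t))
    (hx : dg T x = 3) (hx' : dg T x' = 3) (hw : 4 ≤ dg T w) (hn : x ≠ x') :
    False := by
  have h0 := o.le_of_incr h (l := [x, x']) (l' := [w, w]) (fun t => by simpa [add_assoc] using hd t)
  simp only [incr] at h0
  have d_w := hd w
  have p_w := o.pos h.isTree w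
  have q_w := o.pos o.isTree w
  have c_w : (dg T w : ℤ) < Fintype.card V := by exact_mod_cast dg_lt_card T w
  have d_x := hd x
  have p_x := o.pos h.isTree x
  have q_x := o.pos o.isTree x
  have c_x : (dg T x : ℤ) < Fintype.card V := by exact_mod_cast dg_lt_card T x
  have d_x1 := hd x'
  have p_x1 := o.pos h.isTree x'
  have q_x1 := o.pos o.isTree x'
  have c_x1 : (dg T x' : ℤ) < Fintype.card V := by exact_mod_cast dg_lt_card T x'
  have hc := cost_pos (V := V)
  have hc' : cost V = 4 * (Fintype.card V : ℤ) + 100 := rfl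
  grind (splits := 40) [ι, dW_eq]

theorem Opt.branch_cubic (o : Opt G T ρ) (h : Exch G T T' r a)
    (hd : ∀ t, dg T' t + (ι w t) = dg T t + (ι x t))
    (hx : dg T x = 3) (hw : 3 ≤ dg T w) (hn : w ≠ x) :
    dg T w = 4 ∧ W T' ≤ W T := by
  have h0 := o.le_of_incr h (l := [x]) (l' := [w]) (fun t => by simpa [add_assoc] using hd t)
  simp only [incr] at h0
  have d_w := hd w
  have p_w := o.pos h.isTree w
  have q_w := o.pos o.isTree w
  have c_w : (dg T w : ℤ) < Fintype.card V := by exact_mod_cast dg_lt_card T w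
  have d_x := hd x
  have p_x := o.pos h.isTree x
  have q_x := o.pos o.isTree x
  have c_x : (dg T x : ℤ) < Fintype.card V := by exact_mod_cast dg_lt_card T x
  have hc := cost_pos (V := V)
  have hc' : cost V = 4 * (Fintype.card V : ℤ) + 100 := rfl
  grind (splits := 40) [ι, dW_eq]

/-- Raising `x` from 3 to 5 costs 7 + 9, which is recovered exactly when `w` falls from 5 to 3;
every other degree of `w` gives a strict gain. -/
theorem Opt.branch_cubic_twice (o : Opt G T ρ) (h : Exch G T T' r a)
    (hd : ∀ t, dg T' t + (ι w t + ι w t) = dg T t + (ι x t + ι x t))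
    (hx : dg T x = 3) (hw : 3 ≤ dg T w) (hn : w ≠ x) :
    dg T w = 5 := by
  have h0 := o.le_of_incr h (l := [x, x]) (l' := [w, w]) (fun t => by simpa [add_assoc] using hd t)
  simp only [incr] at h0
  have d_w := hd w
  have p_w := o.pos h.isTree w
  have q_w := o.pos o.isTree w
  have c_w : (dg T w : ℤ) < Fintype.card V := by exact_mod_cast dg_lt_card T w
  have d_x := hd x
  have p_x := o.pos h.isTree x
  have q_x := o.pos o.isTree x
  have c_x : (dg T x : ℤ) < Fintype.card V := by exact_mod_cast dg_lt_card T x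
  have hc := cost_pos (V := V)
  have hc' : cost V = 4 * (Fintype.card V : ℤ) + 100 := rfl
  grind (splits := 40) [ι, dW_eq]

theorem Opt.cubic_cubic_twice (o : Opt G T ρ) (h : Exch G T T' r a)
    (hd : ∀ t, dg T' t + (ι e t + ι p' t) = dg T t + (ι p t + ι p t))
    (hx : dg T p = 3) (hw : dg T p' = 3) (hn : p' ≠ p) :
    False := by
  have h0 := o.le_of_incr h (l := [p, p]) (l' := [e, p']) (fun t => by simpa [add_assoc] using hd t)
  simp only [incr] at h0
  have d_e := hd e
  have p_e := o.pos h.isTree e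
  have q_e := o.pos o.isTree e
  have c_e : (dg T e : ℤ) < Fintype.card V := by exact_mod_cast dg_lt_card T e
  have d_p := hd p
  have p_p := o.pos h.isTree p
  have q_p := o.pos o.isTree p
  have c_p : (dg T p : ℤ) < Fintype.card V := by exact_mod_cast dg_lt_card T p
  have d_p1 := hd p'
  have p_p1 := o.pos h.isTree p'
  have q_p1 := o.pos o.isTree p'
  have c_p1 : (dg T p' : ℤ) < Fintype.card V := by exact_mod_cast dg_lt_card T p'
  have hc := cost_pos (V := V)
  have he := neg_le_dW (by linarith : (0 : ℤ) ≤ cost V) p_e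
  generalize dW (cost V) (dg T' e) = δ at h0 he
  have hc' : cost V = 4 * (Fintype.card V : ℤ) + 100 := rfl
  grind (splits := 40) [ι, dW_eq]

theorem Opt.quintic (o : Opt G T ρ) (h : Exch G T T' r a)
    (hd : ∀ t, dg T' t + (ι e t + ι w t + ι w t + ι w t) = dg T t + (ι p t + ι p t + ι p' t + ι p' t))
    (hx : dg T p = 3) (hx' : dg T p' = 3) (hw : dg T w = 5) (hn : p' ≠ p) :
    False := by
  have h0 := o.le_of_incr h (l := [p, p, p', p']) (l' := [e, w, w, w]) (fun t => by simpa [add_assoc] using hd t)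
  simp only [incr] at h0
  have d_e := hd e
  have p_e := o.pos h.isTree e
  have q_e := o.pos o.isTree e
  have c_e : (dg T e : ℤ) < Fintype.card V := by exact_mod_cast dg_lt_card T e
  have d_p := hd p
  have p_p := o.pos h.isTree p
  have q_p := o.pos o.isTree p
  have c_p : (dg T p : ℤ) < Fintype.card V := by exact_mod_cast dg_lt_card T p
  have d_p1 := hd p'
  have p_p1 := o.pos h.isTree p'
  have q_p1 := o.pos o.isTree p'
  have c_p1 : (dg T p' : ℤ) < Fintype.card V := by exact_mod_cast dg_lt_card T p'
  have d_w := hd w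
  have p_w := o.pos h.isTree w
  have q_w := o.pos o.isTree w
  have c_w : (dg T w : ℤ) < Fintype.card V := by exact_mod_cast dg_lt_card T w
  have hc := cost_pos (V := V)
  have he := neg_le_dW (by linarith : (0 : ℤ) ≤ cost V) p_e
  generalize dW (cost V) (dg T' e) = δ at h0 he
  have hc' : cost V = 4 * (Fintype.card V : ℤ) + 100 := rfl
  grind (splits := 40) [ι, dW_eq]

end patterns

end

section

variable {V : Type*} [Fintype V] {G T T' : SimpleGraph V} {ρ : V}

/-! ### Neighbours and medians in trees -/

theorem card_le_dg {w : V} {s : Finset V} (h : ∀ x ∈ s, T.Adj w x) : s.card ≤ dg T w :=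
  Finset.card_le_card fun x hx => by simpa using h x hx

theorem exists_adj_notMem {w : V} {s : Finset V} (h : s.card < dg T w) : ∃ x, T.Adj w x ∧ x ∉ s := by
  obtain ⟨x, hx, hx'⟩ := Finset.exists_mem_notMem_of_card_lt_card h
  exact ⟨x, by simpa using hx, hx'⟩

theorem three_le_dg {w a b c : V} (ha : T.Adj w a) (hb : T.Adj w b) (hc : T.Adj w c) (hab : a ≠ b)
    (hac : a ≠ c) (hbc : b ≠ c) : 3 ≤ dg T w := by
  have := card_le_dg (T := T) (w := w) (s := {a, b, c}) (by simp [ha, hb, hc])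
  rwa [Finset.card_eq_three.2 ⟨a, b, c, hab, hac, hbc, rfl⟩] at this

theorem two_le_dg {w a b : V} (ha : T.Adj w a) (hb : T.Adj w b) (hab : a ≠ b) : 2 ≤ dg T w := by
  have := card_le_dg (T := T) (w := w) (s := {a, b}) (by simp [ha, hb])
  rwa [Finset.card_pair hab] at this

theorem leaf_unique {w a b : V} (h : dg T w = 1) (ha : T.Adj w a) (hb : T.Adj w b) : a = b := by
  by_contra hab
  have := two_le_dg ha hb hab
  omega

theorem exists_adj_ne {w : V} (a : V) (h : 2 ≤ dg T w) : ∃ x, T.Adj w x ∧ x ≠ a := by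
  obtain ⟨x, hx, hx'⟩ := exists_adj_notMem (T := T) (w := w) (s := {a}) (by simpa)
  exact ⟨x, hx, by simpa using hx'⟩

theorem exists_adj_ne_ne {w : V} (a b : V) (h : 3 ≤ dg T w) : ∃ x, T.Adj w x ∧ x ≠ a ∧ x ≠ b := by
  obtain ⟨x, hx, hx'⟩ := exists_adj_notMem (T := T) (w := w) (s := {a, b})
    (Finset.card_le_two.trans_lt h)
  exact ⟨x, hx, by simpa using hx'⟩

theorem exists_adj_ne_ne_ne {w : V} (a b c : V) (h : 4 ≤ dg T w) :
    ∃ x, T.Adj w x ∧ x ≠ a ∧ x ≠ b ∧ x ≠ c := by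
  obtain ⟨x, hx, hx'⟩ := exists_adj_notMem (T := T) (w := w) (s := {a, b, c})
    (Finset.card_le_three.trans_lt h)
  exact ⟨x, hx, by simpa using hx'⟩

theorem exists_median_sides (hT : T.IsTree) (a b c : V) : ∃ w,
    (w ≠ a → ∃ e, T.Adj w e ∧ side T w e a ∧ ¬ side T w e b ∧ ¬ side T w e c) ∧
    (w ≠ b → ∃ e, T.Adj w e ∧ side T w e b ∧ ¬ side T w e a ∧ ¬ side T w e c) ∧
    (w ≠ c → ∃ e, T.Adj w e ∧ side T w e c ∧ ¬ side T w e a ∧ ¬ side T w e b) := by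
  obtain ⟨w, hw⟩ := exists_median hT a b c
  refine ⟨w, fun h => ?_, fun h => ?_, fun h => ?_⟩ <;>
    · obtain ⟨e, he, hs⟩ := exists_side hT h
      have := hw e he
      exact ⟨e, he, hs, by tauto, by tauto⟩

/-- A branch vertex separating two vertices and `ρ` pairwise, unless it is one of the two. -/
theorem exists_branch_median (hT : T.IsTree) {a b ρ : V} (hρ : 3 ≤ dg T ρ) (hab : a ≠ b)
    (haρ : a ≠ ρ) (hbρ : b ≠ ρ) : ∃ w,
    (w ≠ a → ∃ e, T.Adj w e ∧ side T w e a ∧ ¬ side T w e b ∧ ¬ side T w e ρ) ∧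
    (w ≠ b → ∃ e, T.Adj w e ∧ side T w e b ∧ ¬ side T w e a ∧ ¬ side T w e ρ) ∧
    (w ≠ ρ → ∃ e, T.Adj w e ∧ side T w e ρ ∧ ¬ side T w e a ∧ ¬ side T w e b) ∧
    2 ≤ dg T w ∧ (w ≠ a → w ≠ b → 3 ≤ dg T w) := by
  obtain ⟨w, h1, h2, h3⟩ := exists_median_sides hT a b ρ
  refine ⟨w, h1, h2, h3, ?_, fun ha hb => ?_⟩
  · by_cases ha : w = a
    · obtain ⟨e, he, hs, hs', -⟩ := h2 (by grind)
      obtain ⟨f, hf, ht, ht', hf'⟩ := h3 (by grind)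
      exact two_le_dg he hf (by rintro rfl; contradiction)
    · obtain ⟨e, he, hs, hs', hs''⟩ := h1 ha
      by_cases hb : w = b
      · obtain ⟨f, hf, ht, ht', hf'⟩ := h3 (by grind)
        exact two_le_dg he hf (by rintro rfl; contradiction)
      · obtain ⟨f, hf, ht, ht', hf'⟩ := h2 hb
        exact two_le_dg he hf (by rintro rfl; contradiction)
  · by_cases hc : w = ρ
    · rwa [hc]
    · obtain ⟨e, he, hs, hs', hs''⟩ := h1 ha
      obtain ⟨f, hf, ht, ht', ht''⟩ := h2 hb
      obtain ⟨g, hg, hu, hu', hu''⟩ := h3 hc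
      exact three_le_dg he hf hg (by rintro rfl; contradiction) (by rintro rfl; contradiction)
        (by rintro rfl; contradiction)

/-- The form in which claw-freeness is used. -/
def NoClaw (G : SimpleGraph V) : Prop := ∀ ⦃v a b c⦄, G.Adj v a → G.Adj v b → G.Adj v c → a ≠ b →
  a ≠ c → b ≠ c → G.Adj a b ∨ G.Adj a c ∨ G.Adj b c

/-! ### Leaves of an optimal tree -/

section leaves

variable {u u' v v' y z x a b c : V}

/-- The edge `uu'` closes a cycle through the branch vertex `w` that separates `u`, `u'` and `ρ`.
Opening the cycle at `w` removes two leaves and creates at most one. -/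
theorem Opt.leaves_nonadj (o : Opt G T ρ) (hu : dg T u = 1) (hu' : dg T u' = 1) (hn : u ≠ u') :
    ¬ G.Adj u u' := by
  intro hG
  have hT := o.isTree
  have hr := o.root
  obtain ⟨w, h1, h2, h3, h4, h5⟩ := exists_branch_median hT o.root hn (by grind) (by grind)
  have n1 : w ≠ u := by grind
  have n2 : w ≠ u' := by grind
  obtain ⟨e, he, s1, s2, s3⟩ := h1 n1
  have h := exch1 o.le hT he hG (by grind)
  exact o.two_leaves (e := e) (w := w) (u := u) (u' := u') h (fun t => by have := h.deg t; grind)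
    hu hu' hn (h5 n1 n2)

/-- Otherwise `v'` could be hung from the leaf `u` instead of the branch vertex `v`. -/
theorem Opt.leaf_nonadj_of_branch (o : Opt G T ρ) (hv : 3 ≤ dg T v) (hvv : T.Adj v v')
    (hu : dg T u = 1) (hs : ¬ side T v v' u) : ¬ G.Adj u v' := by
  intro hG
  have hT := o.isTree
  have h := exch1 o.le hT hvv hG (by grind [side_self])
  exact o.leaf_branch (v := v) (u := u) h (fun t => by have := h.deg t; grind) hu hv

/-- Exchange `yz` and `we` for `uz` and `u'y`: the degrees of `y` and `z` are restored, two leaves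
disappear, and only `e` can become one. The other position of `w` follows by exchanging the roles of
the two leaves. -/
theorem Opt.leaves_opposite_aux (o : Opt G T ρ) (hu : dg T u = 1) (hu' : dg T u' = 1)
    (hyz : T.Adj y z) (h1 : ¬ side T y z u) (h2 : side T y z u') (a1 : G.Adj u z)
    (a2 : G.Adj u' y) {w e : V} (hw : 3 ≤ dg T w) (hwe : T.Adj w e) (heu : side T w e u)
    (hwu' : ¬ side T w e u') (hs : ¬ side T y z w) : False := by
  have hT := o.isTree
  have hn : u ≠ u' := by grind
  have h := exch2 o.le hT hyz hwe (by grind [side_self, not_side]) (by grind [side_self, not_side])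
    a1 a2 (by
      intro K hK k1 k2
      grind [side_self, not_side, side_iff_not, side_step, side_disjoint, side_branch])
  exact o.two_leaves (e := e) (w := w) (u := u) (u' := u') h (fun t => by have := h.deg t; grind)
    hu hu' hn hw

theorem Opt.leaves_opposite (o : Opt G T ρ) (hu : dg T u = 1) (hu' : dg T u' = 1)
    (hyz : T.Adj y z) (h1 : ¬ side T y z u) (h2 : side T y z u') (a1 : G.Adj u z)
    (a2 : G.Adj u' y) : False := by
  have hT := o.isTree
  have hr := o.root
  obtain ⟨w, m1, m2, m3, m4, m5⟩ := exists_branch_median hT (a := u) (b := u') o.root (by grind)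
    (by grind) (by grind)
  have n1 : w ≠ u := by grind
  have n2 : w ≠ u' := by grind
  obtain ⟨e, he, s1, s2, s3⟩ := m1 n1
  obtain ⟨f, hf, t1, t2, t3⟩ := m2 n2
  by_cases hs : side T y z w
  · exact o.leaves_opposite_aux hu' hu hyz.symm (by grind [side_iff_not]) (by grind [side_iff_not])
      a2 a1 (m5 n1 n2) hf t1 t2 (by grind [side_iff_not])
  · exact o.leaves_opposite_aux hu hu' hyz h1 h2 a1 a2 (m5 n1 n2) he s1 s2 hs

/-- The vertex `y` has degree two, being neither a leaf nor a branch vertex by the previous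
exclusions. So the median `w` of `u`, `u'` and `y` is a branch vertex other than `y`, and `yz`, `we`
can be exchanged for `u'z`, `uy`. -/
theorem Opt.leaves_same_aux (o : Opt G T ρ) (hu : dg T u = 1) (hu' : dg T u' = 1) (hn : u ≠ u')
    (hyz : T.Adj y z) (h1 : ¬ side T y z u) (h2 : ¬ side T y z u') (a1 : G.Adj u z)
    (a2 : G.Adj u' z) (a3 : G.Adj u y) : False := by
  have hT := o.isTree
  have hr := o.root
  have hy : dg T y = 2 := by
    have := o.pos hT y
    have := fun hy : dg T y = 1 => o.leaves_nonadj hu hy a3.ne a3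
    have := fun hy : 3 ≤ dg T y => o.leaf_nonadj_of_branch hy hyz hu h1 a1
    grind
  obtain ⟨w, m1, m2, m3⟩ := exists_median_sides hT u u' y
  have n1 : w ≠ u := by
    rintro rfl
    obtain ⟨e, he, -, -, s⟩ := m2 hn
    obtain ⟨f, hf, t, -, -⟩ := m3 a3.ne
    exact s (leaf_unique hu hf he ▸ t)
  have n2 : w ≠ u' := by
    rintro rfl
    obtain ⟨e, he, -, -, s⟩ := m1 hn.symm
    obtain ⟨f, hf, t, -, -⟩ := m3 (by grind)
    exact s (leaf_unique hu' hf he ▸ t)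
  obtain ⟨e, he, s1, s2, s3⟩ := m1 n1
  obtain ⟨f, hf, t1, t2, t3⟩ := m2 n2
  have n3 : w ≠ y := by
    rintro rfl
    have := three_le_dg he hf hyz (by grind) (by grind) (by grind)
    omega
  obtain ⟨g, hg, r1, r2, r3⟩ := m3 n3
  have := three_le_dg he hf hg (by grind) (by grind) (by grind)
  have h := exch2 o.le hT hyz he (by grind [side_self, not_side]) (by grind [side_self, not_side])
    a2 a3 (by
      intro K hK k1 k2
      grind [side_self, not_side, side_iff_not, side_step, side_disjoint, side_branch])
  exact o.two_leaves (e := e) (w := w) (u := u) (u' := u') h (fun t => by have := h.deg t; grind)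
    hu hu' hn this

theorem Opt.leaves_same (o : Opt G T ρ) (hG : NoClaw G) (hu : dg T u = 1) (hu' : dg T u' = 1)
    (hn : u ≠ u') (hyz : T.Adj y z) (h1 : ¬ side T y z u) (h2 : ¬ side T y z u') (a1 : G.Adj u z)
    (a2 : G.Adj u' z) : False := by
  have hT := o.isTree
  by_cases c1 : u = y
  · subst c1
    obtain ⟨e, he, s1⟩ := exists_side hT hn
    rw [leaf_unique hu he hyz] at s1
    exact h2 s1
  by_cases c2 : u' = y
  · subst c2
    obtain ⟨e, he, s1⟩ := exists_side hT hn.symm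
    rw [leaf_unique hu' he hyz] at s1
    exact h1 s1
  rcases hG a1.symm a2.symm (o.le hyz).symm hn c1 c2 with h | h | h
  · exact o.leaves_nonadj hu hu' hn h
  · exact o.leaves_same_aux hu hu' hn hyz h1 h2 a1 a2 h
  · exact o.leaves_same_aux hu' hu hn.symm hyz h2 h1 a2 a1 h

end leaves

end

/-! ### Sides after an exchange, and how cubic vertices meet leaves -/

section

variable {V : Type*} {G T T' : SimpleGraph V} {ρ u u' v v' w e f y z x a b c : V}

/-- The same test by predicates as for connectedness; here `K` stands for the side of `f` with
respect to `wf` in the new graph. -/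
theorem mv_side (hT : T.IsTree) {R A : List (V × V)} {w f e : V}
    (H : ∀ K : V → Prop, (∀ r s, (∀ d ∈ R, (side T d.1 d.2 r ↔ side T d.1 d.2 s)) →
      (T.Adj w f → (side T w f r ↔ side T w f s)) → (K r ↔ K s)) →
      (∀ d ∈ A, d ≠ (w, f) → d ≠ (f, w) → (K d.1 ↔ K d.2)) → (K f ↔ K e)) :
    side (mv T R A) w f e := by
  have hcl : ∀ r s, ((mv T R A).deleteEdges {s(w, f)}).Reachable r s →
      (side (mv T R A) w f r ↔ side (mv T R A) w f s) :=
    fun r s h => ⟨fun h' => h'.trans h, fun h' => h'.trans h.symm⟩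
  refine (H (side (mv T R A) w f) (fun r s h1 h2 => hcl _ _ ?_) ?_).1 (side_self _ _)
  · have h3 : ∃ R' : List (V × V), (∀ d ∈ R', (side T d.1 d.2 r ↔ side T d.1 d.2 s)) ∧ (∀ d ∈ R, d ∈ R') ∧
        (T.Adj w f → (w, f) ∈ R') := by
      by_cases hwf : T.Adj w f
      · refine ⟨(w, f) :: R, fun d hd => ?_, by simp +contextual, by simp⟩
        rcases List.mem_cons.1 hd with rfl | hd
        · exact h2 hwf
        · exact h1 d hd
      · exact ⟨R, h1, fun _ => id, fun h => absurd h hwf⟩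
    obtain ⟨R', h3, h4, h5⟩ := h3
    refine (mv_reach (A := []) hT h3).choose.reachable.mono fun a b hab => ?_
    rw [mv_adj] at hab
    rw [deleteEdges_adj, mv_adj]
    have h6 := h4 (a, b)
    have h7 := h4 (b, a)
    simp at hab ⊢
    grind [SimpleGraph.adj_comm]
  · intro d hd n1 n2
    by_cases hne : d.1 = d.2
    · rw [hne]
    refine hcl _ _ (Adj.reachable ?_)
    rw [deleteEdges_adj, mv_adj]
    refine ⟨Or.inr ⟨hne, Or.inl hd⟩, ?_⟩
    obtain ⟨p, q⟩ := d
    simp at n1 n2 ⊢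
    grind

theorem side_toward_of_dist_le (hT : T.IsTree) (hg : T.Adj w a) (hs : side T w a ρ) (hv : v ≠ w)
    (h : T.dist ρ v ≤ T.dist ρ w) : side T w a v := by
  obtain ⟨e, he, hse⟩ := exists_side hT hv.symm
  by_cases hea : e = a
  · exact hea ▸ hse
  · have := side_dist hT he hse (side_disjoint hT hg (Ne.symm hea) he hs)
    rw [dist_comm, T.dist_comm (u := w)] at this
    omega

theorem dist_toward (hT : T.IsTree) (hg : T.Adj w a) (hs : side T w a ρ) :
    T.dist ρ w = T.dist ρ a + 1 := side_dist_self hT hg hs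

/-! ### Cubic vertices of an optimal tree -/

variable [Fintype V]

theorem Opt.not_pot (o : Opt G T ρ) {r a : V → ℕ} (h : Exch G T T' r a) (hW : W T' ≤ W T)
    (hd : dg T' ρ = dg T ρ) {k : ℕ} (hi : ∀ v, 3 ≤ dg T v → T.dist ρ v ≤ k → 3 ≤ dg T' v ∧
      T'.dist ρ v ≤ T.dist ρ v) {g : V} (hg : 3 ≤ dg T' g) (hgk : T'.dist ρ g ≤ k)
    (hg' : 3 ≤ dg T g → k < T.dist ρ g) : False := by
  have h1 := o.potential T' h.le h.isTree hW (hd ▸ o.root) hd.le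
  have h2 := pot_lt o.isTree.connected hi hg hgk hg'
  omega

/-- Moving `a` from `x` to the parent `c` keeps the weight only if `c` has degree two. Then the
cubic vertex moves from `x` to `c`, nearer to `ρ`, against the maximality of the potential. -/
theorem Opt.child_nonadj_parent (o : Opt G T ρ) (hx : dg T x = 3) (hc : T.Adj x c)
    (hcρ : side T x c ρ) (ha : T.Adj x a) (hac : a ≠ c) : ¬ G.Adj a c := by
  intro hG
  have hT := o.isTree
  have hr := o.root
  have h := exch1 o.le hT ha hG.symm (by grind [side_self, side_disjoint])
  have hcx := hc.ne
  obtain ⟨h2, hW⟩ := o.shift_cubic (x := x) (c := c) h (fun t => by have := h.deg t; grind) hx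
    hcx.symm
  have hxρ : x ≠ ρ := by rintro rfl; exact not_side hT hc hcρ
  have hd := dist_toward hT hc hcρ
  have key : ∀ v, T.dist ρ v ≤ T.dist ρ c → side T x c v := fun v hv =>
    side_toward_of_dist_le hT hc hcρ (by rintro rfl; omega) (by omega)
  have hdist : ∀ v, T.dist ρ v ≤ T.dist ρ c →
      (mv T [(x, a)] [(c, a)]).dist ρ v ≤ T.dist ρ v := fun v hv => mv_dist_le hT (by
      have := key v hv
      simp only [List.mem_singleton, forall_eq]
      grind [side_disjoint])
  refine o.not_pot h hW (by have := h.deg ρ; grind [ι]) (k := T.dist ρ c) (fun v h3 hv =>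
    ⟨by have := h.deg v; have : v ≠ x := (by rintro rfl; omega); grind [ι], hdist v hv⟩)
    (g := c) (by have := h.deg c; grind [ι]) (hdist c le_rfl) (by omega)

theorem Opt.children_adj (o : Opt G T ρ) (hG : NoClaw G) (hx : dg T x = 3) (hc : T.Adj x c)
    (hcρ : side T x c ρ) (ha : T.Adj x a) (hac : a ≠ c) (hb : T.Adj x b) (hbc : b ≠ c)
    (hab : a ≠ b) : G.Adj a b := by
  have := o.child_nonadj_parent hx hc hcρ ha hac
  have := o.child_nonadj_parent hx hc hcρ hb hbc
  have := hG (o.le ha) (o.le hb) (o.le hc) hab hac hbc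
  tauto

/-- This treats the tie left open by `Opt.leaf_cubic`: the exchange opens a cycle at the quartic
vertex `w`. In the new tree `w` has degree three, and a claw at `w` formed by `e`, the neighbour `g`
towards `ρ` and the third neighbour `g'` is ruled out by further exchanges. -/
theorem Opt.ring (o : Opt G T ρ) (hG : NoClaw G) (hu : dg T u = 1) (hx : dg T x = 3)
    (hxρ : x ≠ ρ)
    (hw : 3 ≤ dg T w) (hwx : w ≠ x) {R A : List (V × V)} {r a : V → ℕ}
    (h1 : Exch G T (mv T R A) r a)
    (hd : ∀ t, dg (mv T R A) t + (ι e t + ι w t) = dg T t + (ι u t + ι x t))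
    (hwe : G.Adj w e) (hf : (mv T R A).Adj w f) (hfe : side (mv T R A) w f e)
    (hg : ∀ g, T.Adj w g → side T w g ρ → f ≠ g ∧ ¬ side T w g e ∧
      ∀ d ∈ R, ¬ side T w g d.1 ∧ ¬ side T w g d.2) : False := by
  have hT := o.isTree
  have hr := o.root
  have hwe' := hwe.ne
  obtain ⟨hw4, hW⟩ := o.leaf_cubic (e := e) (w := w) (u := u) (x := x) h1 hd hu hx hw hwx
  have hdw : dg (mv T R A) w = 3 := by have := hd w; grind [ι]
  -- If `w` is the root, the new tree has the same weight and a root of degree 3 instead of 4.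
  by_cases hwρ : w = ρ
  · subst hwρ
    have := o.rootDeg _ h1.le h1.isTree hW w hdw.ge
    omega
  obtain ⟨g, hwg, hgρ⟩ := exists_side hT hwρ
  obtain ⟨hfg, hge, hgR⟩ := hg g hwg hgρ
  have hT1 := h1.isTree
  have key : ∀ v, (v = w ∨ side T w g v) → ∀ d ∈ R, (side T d.1 d.2 g ↔ side T d.1 d.2 v) := by
    intro v hv d hd
    have := hgR d hd
    have h1 : side T d.1 d.2 w ↔ side T d.1 d.2 g := side_step hwg (by grind [side_self])
      (by grind [side_self])
    rcases hv with rfl | hv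
    · exact h1.symm
    · exact (side_branch this.1 hv).symm
  have hwg1 : (mv T R A).Adj w g := mv_adj.2 (Or.inl ⟨hwg, fun h => (hgR _ h).2 (side_self _ _),
    fun h => (hgR _ h).1 (side_self _ _)⟩)
  have hside : ∀ v, side T w g v → side (mv T R A) w g v := fun v hv => mv_side hT (by
    intro K h1 h2
    exact h1 _ _ (key v (Or.inr hv)) (fun _ => by simp [hv, side_self]))
  have hdist : ∀ v, side T w g v → (mv T R A).dist ρ v ≤ T.dist ρ v := fun v hv =>
    mv_dist_le hT fun d hd => by rw [← key v (Or.inr hv) d hd, ← key ρ (Or.inr hgρ) d hd]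
  obtain ⟨g', hwg', n1, n2⟩ := exists_adj_ne_ne (T := mv T R A) (w := w) g f hdw.ge
  have heg' : e ≠ g' := by
    rintro rfl; exact side_disjoint hT1 hf (by grind) hwg' hfe (side_self _ _)
  have heg : e ≠ g := by
    rintro rfl; exact hge (side_self _ _)
  -- Replacing `wh` by `eh` gives `e` its degree back and lowers `w` to 2, destroying a branch
  -- vertex. The neighbour `f` is excepted since it lies on the same side as `e`.
  have swap : ∀ h, (mv T R A).Adj w h → h ≠ f → ¬ G.Adj e h := by
    intro h hwh hhf heh
    have h3 := exch1 h1.le hT1 hwh heh (by grind [side_self, side_disjoint])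
    have hd' : ∀ t, dg (mv (mv T R A) [(w, h)] [(e, h)]) t + (ι w t + ι w t) =
      dg T t + (ι u t + ι x t) := fun t => by have := hd t; have := h3.deg t; grind
    exact o.leaf_quartic (w := w) (u := u) (z := x) ⟨h3.le, h3.isTree, hd'⟩ hd' hu hw4
  have hgg : G.Adj g g' := by
    have := hG hwe (h1.le hwg1) (h1.le hwg') heg heg' n1.symm
    have := swap g hwg1 hfg.symm
    have := swap g' hwg' n2
    tauto
  have h3 := exch1 h1.le hT1 hwg' hgg (by grind [side_self, side_disjoint])
  have hd' : ∀ t, dg (mv (mv T R A) [(w, g')] [(g, g')]) t + (ι e t + ι w t + ι w t) =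
      dg T t + (ι u t + ι x t + ι g t) := fun t => by have := hd t; have := h3.deg t; grind
  have hgw := hwg.ne
  have hg2 : 2 ≤ dg T g := by
    by_cases hgρ' : g = ρ
    · subst hgρ'; omega
    · obtain ⟨g0, h5, h6⟩ := exists_side hT hgρ'
      refine two_le_dg hwg.symm h5 ?_
      rintro rfl
      exact (side_iff_not hT hwg ρ).1 hgρ h6
  have h4 : Exch G T (mv (mv T R A) [(w, g')] [(g, g')]) _ _ := ⟨h3.le, h3.isTree, hd'⟩
  -- The weight is again unchanged, but the branch vertex has moved from `w` to `g`, one step nearer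
  -- to `ρ`.
  obtain ⟨hg2', hW'⟩ := o.leaf_cubic_parent (e := e) (w := w) (u := u) (x := x) (g := g) h4
    hd' hu hx hw4 hg2 hgw.symm
  have hdw := dist_toward hT hwg hgρ
  have hk : ∀ v, T.dist ρ v ≤ T.dist ρ g → side T w g v := fun v hv =>
    side_toward_of_dist_le hT hwg hgρ (by rintro rfl; omega) (by omega)
  have hk' : ∀ v, T.dist ρ v ≤ T.dist ρ g →
      (mv (mv T R A) [(w, g')] [(g, g')]).dist ρ v ≤ T.dist ρ v := fun v hv => by
    refine (mv_dist_le hT1 ?_).trans (hdist v (hk v hv))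
    have h5 := side_disjoint hT1 hwg1 n1.symm hwg' (hside v (hk v hv))
    have h6 := side_disjoint hT1 hwg1 n1.symm hwg' (hside ρ hgρ)
    simp [h5, h6]
  refine o.not_pot h4 hW' ?_ (k := T.dist ρ g) (fun v hv hvk => ⟨?_, hk' v hvk⟩) (g := g) ?_
    (hk' g le_rfl) (by omega)
  · have := hd' ρ
    have : ρ ≠ e := by rintro rfl; exact hge hgρ
    have : ρ ≠ w := Ne.symm hwρ
    grind [ι]
  · have := hd' v
    have : v ≠ e := by rintro rfl; exact hge (hk _ hvk)
    have : v ≠ w := by rintro rfl; omega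
    grind [ι]
  · have := hd' g
    have := heg
    grind [ι]

/-- If `u` is not below `x`, adding `ux` opens a cycle at a branch vertex as in `Opt.ring`. If `u`
is below `x`, then `u`, the other child and the parent of `x` form a claw at `x`. -/
theorem Opt.leaf_nonadj_cubic (o : Opt G T ρ) (hG : NoClaw G) (hu : dg T u = 1) (hx : dg T x = 3)
    (hxρ : x ≠ ρ) : ¬ G.Adj u x := by
  intro hux
  have hT := o.isTree
  have hr := o.root
  have hne : u ≠ x := hux.ne
  obtain ⟨c, hc, hcρ⟩ := exists_side hT hxρ
  obtain ⟨a, ha, hau⟩ := exists_side hT hne.symm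
  by_cases hac : a = c
  · subst hac
    obtain ⟨w, m1, m2, m3, m4, m5⟩ := exists_branch_median hT hr hne (by grind) hxρ
    have n1 : w ≠ u := by grind
    have n2 : w ≠ x := by
      rintro rfl
      obtain ⟨e, he, s1, s2, s3⟩ := m1 n1
      grind [side_disjoint]
    obtain ⟨e, he, s1, s2, s3⟩ := m1 n1
    obtain ⟨f, hf, t1, t2, t3⟩ := m2 n2
    have h := exch1 o.le hT he hux (by grind)
    have hf' : (mv T [(w, e)] [(u, x)]).Adj w f := by rw [mv_adj]; grind [he.ne]
    refine o.ring hG hu hx hxρ (m5 n1 n2) n2 h (fun t => by have := h.deg t; grind) (o.le he) hf'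
      (mv_side hT ?_) ?_
    · intro K h1 h2
      simp only [List.mem_singleton, forall_eq, Prod.mk.injEq, ne_eq] at h1 h2
      grind [side_self, side_disjoint]
    · intro g hg hgρ
      simp only [List.mem_singleton, forall_eq]
      have := not_side hT hg
      grind [side_self, side_disjoint]
  · obtain ⟨b, hb, hba, hbc⟩ := exists_adj_ne_ne (T := T) (w := x) a c hx.ge
    have h1 := o.leaf_nonadj_of_branch hx.ge hb hu (side_disjoint hT ha hba.symm hb hau)
    have h2 := o.leaf_nonadj_of_branch hx.ge hc hu (side_disjoint hT ha hac hc hau)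
    have h3 := o.child_nonadj_parent hx hc hcρ hb hbc
    have := hG hux.symm (o.le hb) (o.le hc) (by grind [side_disjoint, side_self])
      (by grind [side_disjoint, side_self]) hbc
    tauto

end

section

/-! ### A leaf and a cubic vertex adjacent to the ends of a tree edge -/

variable {V : Type*} {G T T' : SimpleGraph V} {ρ u u' v v' w e f y z x a b c : V}

theorem side_of_sep (hyz : T.Adj y z) (h : ¬ side T y z w)
    (h1 : side T y z u) (h2 : side T w e u) : side T w e z ∧ (w ≠ y → side T w e y) := by
  have h3 : side T w e z := (side_branch h h1).1 h2
  refine ⟨h3, fun hne => (side_step hyz ?_ ?_).2 h3⟩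
  · rintro ⟨rfl, -⟩; exact hne rfl
  · rintro ⟨-, rfl⟩; exact h (side_self _ _)

theorem ne_of_adj_of_not_side (h : ¬ side T y z x) (hyx : y ≠ x) (ha : T.Adj x a) : z ≠ a := by
  rintro rfl
  refine h ((side_step ha ?_ ?_).2 (side_self _ _))
  · rintro ⟨rfl, -⟩; exact hyx rfl
  · rintro ⟨rfl, -⟩; exact h (side_self _ _)

theorem side_ends (hyz : T.Adj y z) (h : ¬ side T y z w) (hwy : w ≠ y) :
    side T w e y ↔ side T w e z := by
  refine side_step hyz ?_ ?_
  · rintro ⟨rfl, -⟩; exact hwy rfl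
  · rintro ⟨-, rfl⟩; exact h (side_self _ _)

variable [Fintype V]

theorem Opt.two_le_dg_toward (o : Opt G T ρ) (hc : T.Adj w c) (hs : side T w c ρ) :
    2 ≤ dg T c := by
  have hr := o.root
  by_cases h : c = ρ
  · subst h; omega
  · obtain ⟨g, hg, hgs⟩ := exists_side o.isTree h
    refine two_le_dg hc.symm hg ?_
    rintro rfl
    exact (side_iff_not o.isTree hc ρ).1 hs hgs

/-- No exchange of the same weight turns a vertex `c` of degree two into a branch vertex and keeps
everything as near to `ρ` as `c`. -/
theorem Opt.not_parent_gain (o : Opt G T ρ) {R A : List (V × V)} {r s : V → ℕ}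
    (h : Exch G T (mv T R A) r s) (hW : W (mv T R A) ≤ W T) (hc : T.Adj w c) (hs : side T w c ρ)
    (hc2 : dg T c = 2) (hc3 : 3 ≤ dg (mv T R A) c)
    (hR : ∀ v, side T w c v → ∀ d ∈ R, ¬ side T d.1 d.2 v)
    (hd : ∀ v, side T w c v → v ≠ c → dg (mv T R A) v = dg T v) : False := by
  have hT := o.isTree
  have hr := o.root
  have hdw := dist_toward hT hc hs
  have key : ∀ v, T.dist ρ v ≤ T.dist ρ c → side T w c v := fun v hv =>
    side_toward_of_dist_le hT hc hs (by rintro rfl; omega) (by omega)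
  have hdist : ∀ v, T.dist ρ v ≤ T.dist ρ c → (mv T R A).dist ρ v ≤ T.dist ρ v := fun v hv =>
    mv_dist_le hT fun d hdR => by simp [hR v (key v hv) d hdR, hR ρ hs d hdR]
  refine o.not_pot h hW (hd ρ hs (by rintro rfl; omega)) (k := T.dist ρ c)
    (fun v h3 hv => ⟨?_, hdist v hv⟩) hc3 (hdist c le_rfl) (by omega)
  rw [hd v (key v hv) (by rintro rfl; omega)]; exact h3

/-- If `u` is not below `x`, exchanging `yz` and an edge at the separating branch vertex `w` (or
only `yz` if `w = y`) leads to `Opt.ring`. If `u` is below `x`, then `z`, the parent of `x` and the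
child of `x` not leading to `u` form a claw at `x`. -/
theorem Opt.leaf_cubic_opposite (o : Opt G T ρ) (hG : NoClaw G) (hu : dg T u = 1)
    (hx : dg T x = 3) (hxρ : x ≠ ρ) (hyz : T.Adj y z) (hyx : y ≠ x) (h1 : ¬ side T y z x)
    (h2 : side T y z u) (a1 : G.Adj x z) (a2 : G.Adj u y) : False := by
  have hT := o.isTree
  have hr := o.root
  have hzy := hyz.symm
  have hne : u ≠ x := by grind
  obtain ⟨c, hc, hcρ⟩ := exists_side hT hxρ
  obtain ⟨b, hb, hbu⟩ := exists_side hT hne.symm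
  by_cases hbc : b = c
  · subst hbc
    obtain ⟨w, m1, m2, m3, m4, m5⟩ := exists_branch_median hT hr hne (by grind) hxρ
    have n1 : w ≠ u := by grind
    have n2 : w ≠ x := by
      rintro rfl
      obtain ⟨e, he, s1, s2, s3⟩ := m1 n1
      grind [side_disjoint]
    obtain ⟨e, he, s1, s2, s3⟩ := m1 n1
    obtain ⟨f, hf, t1, t2, t3⟩ := m2 n2
    have hw := m5 n1 n2
    clear m1 m2 m3 m4 m5
    have sep1 := fun h => side_of_sep hyz h h2 s1
    have sep2 := fun h => side_of_sep hzy h ((side_iff_not hT hzy x).2 h1) t1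
    by_cases hwy : w = y
    · subst hwy
      have h := exch1 o.le hT hyz a1 (by grind [side_self])
      have hf' : (mv T [(w, z)] [(x, z)]).Adj w f := by rw [mv_adj]; grind [he.ne]
      refine o.ring hG hu hx hxρ hw n2 h (fun t => by have := h.deg t; grind) a2.symm hf'
        (mv_side hT ?_) ?_
      · intro K h1 h2
        simp only [List.mem_singleton, forall_eq, Prod.mk.injEq, ne_eq] at h1 h2
        grind [side_self, not_side, side_iff_not, side_step, side_disjoint, side_branch]
      · intro g hg hgρ
        simp only [List.mem_singleton, forall_eq]
        have := not_side hT hg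
        grind [side_self, side_disjoint]
    · have h := exch2 o.le hT hyz he (by grind [side_self, not_side])
        (by grind [side_self, not_side, side_iff_not, side_step, side_disjoint, side_branch]) a1 a2 (by
        intro K hK k1 k2
        grind [side_self, not_side, side_iff_not, side_step, side_disjoint, side_branch])
      by_cases hwz : w = z
      · subst hwz
        have hnx : ¬ T.Adj w x := fun hwx => by
          have : side T y w x ↔ side T y w w := side_step hwx.symm (by grind) (by grind)
          grind [side_self]
        have hf' : (mv T [(y, w), (w, e)] [(x, w), (u, y)]).Adj w x := by rw [mv_adj]; grind
        refine o.ring hG hu hx hxρ hw n2 h (fun t => by have := h.deg t; grind)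
          (o.le he) hf' (mv_side hT ?_) ?_
        · intro K k1 k2
          simp only [List.mem_cons, List.not_mem_nil, or_false, forall_eq_or_imp, forall_eq,
            Prod.mk.injEq, ne_eq] at k1 k2
          grind [side_self, not_side, side_iff_not, side_step, side_disjoint, side_branch]
        · intro g hg hgρ
          simp only [List.mem_cons, List.not_mem_nil, or_false, forall_eq_or_imp, forall_eq]
          grind [side_self, not_side, side_iff_not, side_step, side_disjoint, side_branch]
      · have hf' : (mv T [(y, z), (w, e)] [(x, z), (u, y)]).Adj w f := by rw [mv_adj]; grind
        refine o.ring hG hu hx hxρ hw n2 h (fun t => by have := h.deg t; grind)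
          (o.le he) hf' (mv_side hT ?_) ?_
        · intro K k1 k2
          simp only [List.mem_cons, List.not_mem_nil, or_false, forall_eq_or_imp, forall_eq,
            Prod.mk.injEq, ne_eq] at k1 k2
          clear h hf' hG hr s3 t3 hcρ hbu hb hc a1 a2
          grind [side_self, not_side, side_iff_not, side_step, side_disjoint, side_branch]
        · intro g hg hgρ
          simp only [List.mem_cons, List.not_mem_nil, or_false, forall_eq_or_imp, forall_eq]
          grind [side_self, not_side, side_iff_not, side_step, side_disjoint, side_branch]
  · obtain ⟨a, ha, hab, hac⟩ := exists_adj_ne_ne (T := T) (w := x) b c hx.ge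
    have key : ∀ q, T.Adj x q → q ≠ b → ¬ G.Adj z q := fun q hq hqb hzq => by
      have h := exch2 o.le hT hyz hq (by grind [side_self, not_side])
        (by grind [side_self, not_side, side_disjoint, side_branch]) a2 hzq (by
        intro K hK k1 k2
        grind [side_self, not_side, side_iff_not, side_step, side_disjoint, side_branch])
      exact o.leaf_branch (v := x) (u := u) h (fun t => by have := h.deg t; grind) hu hx.ge
    have k1 := key a ha hab
    have k2 := key c hc (Ne.symm hbc)
    have k3 := o.child_nonadj_parent hx hc hcρ ha hac
    have := hG a1 (o.le ha) (o.le hc) (ne_of_adj_of_not_side h1 hyx ha)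
      (ne_of_adj_of_not_side h1 hyx hc) hac
    tauto

end

/-! ### A leaf and a cubic vertex adjacent to the farther end of the same tree edge -/

section

variable {V : Type*} [Fintype V] {G T T' : SimpleGraph V} {ρ u u' v v' w e f y z x a b c : V}

theorem Opt.dg_eq_two_of_same (o : Opt G T ρ) (hu : dg T u = 1) (hyz : T.Adj y z) (hyx : y ≠ x) (h1 : ¬ side T y z x) (h2 : ¬ side T y z u)
    (a2 : G.Adj u z) : dg T y = 2 := by
  have hT := o.isTree
  have h3 := o.pos hT y
  have h4 := fun hy : 3 ≤ dg T y => o.leaf_nonadj_of_branch hy hyz hu h2 a2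
  have h5 : dg T y ≠ 1 := fun hy => by
    obtain ⟨e, he, hs⟩ := exists_side hT hyx
    exact h1 (leaf_unique hy he hyz ▸ hs)
  grind

/-- Replace `xa` by `uz`. The weight can only survive if `z` has degree two, and `z` then becomes a
branch vertex nearer to `ρ` than `x`. -/
theorem Opt.leaf_cubic_same_below (o : Opt G T ρ) (hu : dg T u = 1)
    (hx : dg T x = 3) (hyz : T.Adj y z) (hyx : y ≠ x) (h1 : ¬ side T y z x) (h2 : ¬ side T y z u)
    (hyρ : side T y z ρ) (a2 : G.Adj u z) (hc : T.Adj x c) (hcρ : side T x c ρ) (ha : T.Adj x a)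
    (hac : a ≠ c) (hau : side T x a u) : False := by
  have hT := o.isTree
  have hr := o.root
  have hzy := hyz.symm
  have hxρ : x ≠ ρ := by rintro rfl; exact not_side hT hc hcρ
  have hcz : side T x c z ∧ side T x c y := by
    have := side_of_sep (T := T) hyz h1 hyρ hcρ
    exact ⟨this.1, this.2 hyx.symm⟩
  have haz := side_disjoint hT hc (Ne.symm hac) ha hcz.1
  have h := exch1 o.le hT ha a2 (by grind)
  have hz2 := o.two_le_dg_toward hyz hyρ
  have hzx : z ≠ x := by rintro rfl; exact h1 (side_self _ _)
  have hd : ∀ t, dg (mv T [(x, a)] [(u, z)]) t + (ι a t + ι x t) = dg T t + (ι u t + ι z t) :=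
    fun t => by have := h.deg t; grind
  obtain ⟨hz, hW⟩ := o.leaf_shift (e := a) (x := x) (u := u) (c := z) h hd hu hx hz2 hzx
  have key2 : ∀ v, side T y z v → ¬ side T x a v := fun v hv => by
    grind [side_branch]
  have hne : ∀ v, side T y z v → v ≠ x ∧ v ≠ a := fun v hv =>
    ⟨by rintro rfl; exact h1 hv, by rintro rfl; exact key2 _ hv (side_self _ _)⟩
  refine o.not_parent_gain h hW hyz hyρ hz ?_ (fun v hv => ?_) (fun v hv hvz => ?_)
  · have := hd z; have := hne z (side_self _ _); grind [ι]
  · have := key2 v hv; simpa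
  · have := hd v; have := hne v hv; grind [ι]

/-- Let `w` separate `u`, `y` and `ρ`. If `w ≠ x`, exchanging `yz`, `we` for `xz`, `uy` is a case of
`Opt.ring`. If `w = x`, then `z`, the child `e` towards `u` and the parent `c` would form a claw at
`x`: an edge `ze` saves weight, an edge `zc` makes `c` a branch vertex. -/
theorem Opt.leaf_cubic_same_one (o : Opt G T ρ) (hG : NoClaw G) (hu : dg T u = 1)
    (hx : dg T x = 3) (hxρ : x ≠ ρ) (hyz : T.Adj y z) (hyx : y ≠ x) (h1 : ¬ side T y z x)
    (h2 : ¬ side T y z u) (a1 : G.Adj x z) (a2 : G.Adj u z) (a3 : G.Adj y u)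
    (hy : dg T y = 2) (hyρ : ¬ side T y z ρ) : False := by
  have hT := o.isTree
  have hr := o.root
  have hzy := hyz.symm
  have hne : u ≠ x := by grind
  obtain ⟨c, hc, hcρ⟩ := exists_side hT hxρ
  obtain ⟨w, m1, m2, m3, m4, m5⟩ := exists_branch_median hT hr a3.ne.symm (by grind)
    (by rintro rfl; omega : y ≠ ρ)
  have n1 : w ≠ u := by grind
  obtain ⟨e, he, s1, s2, s3⟩ := m1 n1
  have n2 : w ≠ y := by
    rintro rfl
    obtain ⟨g, hg, r1, r2, r3⟩ := m3 (by rintro rfl; omega)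
    have := three_le_dg he hg hyz (by grind) (by grind) (by grind)
    omega
  obtain ⟨f, hf, t1, t2, t3⟩ := m2 n2
  have hw := m5 n1 n2
  have hyw : ¬ side T y z w := fun h => by
    have := side_of_sep hzy (by grind [side_iff_not]) ((side_iff_not hT hzy u).2 h2) s1
    have := side_of_sep hzy (by grind [side_iff_not]) (side_self _ _) t1
    grind [side_disjoint]
  have hez : ¬ side T w e z := (side_ends hyz hyw n2).not.1 s2
  have hfz : side T w f z := (side_ends hyz hyw n2).1 t1
  by_cases hwx : w = x
  · subst hwx
    have hec : e ≠ c := by rintro rfl; exact s3 hcρ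
    have hfc : f ≠ c := by rintro rfl; exact t3 hcρ
    have hef : e ≠ f := by rintro rfl; exact t2 s1
    have hyf : y ≠ f := by
      rintro rfl; exact o.leaf_nonadj_of_branch hw hf hu t2 a3.symm
    have k0 := o.child_nonadj_parent hx hc hcρ he hec
    have k1 := hG a1 (o.le he) (o.le hc) (ne_of_adj_of_not_side h1 hyx he)
      (ne_of_adj_of_not_side h1 hyx hc) hec
    have hcz : ¬ side T w c z := side_disjoint hT hf hfc hc hfz
    have hcy : ¬ side T w c y := side_disjoint hT hf hfc hc t1
    clear m1 m2 m3 m4 m5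
    rcases k1 with k1 | k1 | k1
    · have h := exch2 o.le hT hyz he (by grind) (by grind [side_self]) a3.symm k1 (by
        intro K hK k1 k2
        grind [side_self, not_side, side_iff_not, side_step, side_disjoint, side_branch])
      exact o.leaf_branch (v := w) (u := u) h (fun t => by have := h.deg t; grind) hu hw
    · have h := exch2 o.le hT hyz hf (by grind) (by grind [side_self]) a3.symm k1 (by
        intro K hK k1 k2
        grind [side_self, not_side, side_iff_not, side_step, side_disjoint, side_branch])
      have hcw := hc.ne
      have hcz' : z ≠ c := k1.ne
      have hcy' : y ≠ c := by rintro rfl; exact hcy (side_self _ _)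
      have hd : ∀ t, dg (mv T [(y, z), (w, f)] [(u, y), (z, c)]) t + (ι f t + ι w t) =
        dg T t + (ι u t + ι c t) := fun t => by have := h.deg t; grind
      obtain ⟨hc2, hW⟩ := o.leaf_shift (e := f) (x := w) (u := u) (c := c) h hd hu hx
        (o.two_le_dg_toward hc hcρ) hcw.symm
      have hfv : ∀ v, side T w c v → ¬ side T w f v := fun v hv =>
        side_disjoint hT hc hfc.symm hf hv
      refine o.not_parent_gain h hW hc hcρ hc2 ?_ (fun v hv => ?_) (fun v hv hvc => ?_)
      · have := hd c
        grind [ι]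
      · have := hfv v hv
        simp only [List.mem_cons, List.not_mem_nil, or_false, forall_eq_or_imp, forall_eq]
        grind [side_branch, side_iff_not, side_self, side_step]
      · have := hd v
        have : v ≠ f := by rintro rfl; exact hfv _ hv (side_self _ _)
        have : v ≠ w := by rintro rfl; exact not_side hT hc hv
        have : v ≠ u := by rintro rfl; exact side_disjoint hT hc hec.symm he hv s1
        grind [ι]
    · exact k0 k1
  · have hf' : (mv T [(y, z), (w, e)] [(x, z), (u, y)]).Adj w f := by
      rw [mv_adj]; grind [side_self]
    have h := exch2 o.le hT hyz he (by grind [side_self]) (by grind [side_self]) a1 a3.symm (by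
      intro K hK k1 k2
      clear m1 m2 m3 m4 m5
      grind [side_self, not_side, side_iff_not, side_step, side_disjoint, side_branch])
    refine o.ring hG hu hx hxρ hw hwx h (fun t => by have := h.deg t; grind)
          (o.le he) hf' (mv_side hT ?_) ?_
    · intro K k1 k2
      simp only [List.mem_cons, List.not_mem_nil, or_false, forall_eq_or_imp, forall_eq,
            Prod.mk.injEq, ne_eq] at k1 k2
      clear h hf' m1 m2 m3 m4 m5
      grind [side_self, not_side, side_iff_not, side_step, side_disjoint, side_branch]
    · intro g hg hgρ
      simp only [List.mem_cons, List.not_mem_nil, or_false, forall_eq_or_imp, forall_eq]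
      clear h hf' m1 m2 m3 m4 m5
      grind [side_self, not_side, side_iff_not, side_step, side_disjoint, side_branch]

end

/-! ### The same configuration: remaining positions of the root -/

section

variable {V : Type*} {G T T' : SimpleGraph V} {ρ u u' v v' w e f y z x a b c : V}

theorem not_side_of_two (hT : T.IsTree) (hyz : T.Adj y z) (h1 : ¬ side T y z x)
    (h2 : ¬ side T y z u) (he : side T w e u) (he' : ¬ side T w e x) (hf : side T w f x)
    (hwe : T.Adj w e) (hwf : T.Adj w f) : ¬ side T y z w := fun h => by
  have h3 := side_of_sep hyz.symm ((side_iff_not hT hyz w).1 h) ((side_iff_not hT hyz.symm u).2 h2) he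
  have h4 := side_of_sep hyz.symm ((side_iff_not hT hyz w).1 h) ((side_iff_not hT hyz.symm x).2 h1) hf
  exact side_disjoint hT hwe (by rintro rfl; exact he' hf) hwf h3.1 h4.1

variable [Fintype V]

/-- The branch vertex separating the leaf `u`, the cubic vertex `x` and the root, if `u` is not
below `x`. -/
theorem Opt.exists_branch_above (o : Opt G T ρ) (hu : dg T u = 1) (hx : dg T x = 3)
    (hc : T.Adj x c) (hcρ : side T x c ρ) (hcu : side T x c u) : ∃ w e f, 3 ≤ dg T w ∧ w ≠ x ∧
      w ≠ u ∧ T.Adj w e ∧ side T w e u ∧ ¬ side T w e x ∧ ¬ side T w e ρ ∧ T.Adj w f ∧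
      side T w f x ∧ ¬ side T w f u ∧ ¬ side T w f ρ := by
  have hT := o.isTree
  have hr := o.root
  have hxρ : x ≠ ρ := by rintro rfl; exact not_side hT hc hcρ
  obtain ⟨w, m1, m2, m3, m4, m5⟩ := exists_branch_median hT hr (a := u) (b := x) (by grind)
    (by grind) hxρ
  have n1 : w ≠ u := by grind
  obtain ⟨e, he, s1, s2, s3⟩ := m1 n1
  have n2 : w ≠ x := by rintro rfl; grind [side_disjoint]
  obtain ⟨f, hf, t1, t2, t3⟩ := m2 n2
  exact ⟨w, e, f, m5 n1 n2, n2, n1, he, s1, s2, s3, hf, t1, t2, t3⟩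

/-- Exchanging `yz`, `we` for `xz`, `uy` keeps the weight at best, and `w` remains a branch vertex.
But `x` now hangs from `z`, at most as far from `ρ` as `y` was, while before it was farther. -/
theorem Opt.leaf_cubic_same_above_one (o : Opt G T ρ) (hu : dg T u = 1)
    (hx : dg T x = 3) (hyz : T.Adj y z) (hyx : y ≠ x) (h1 : ¬ side T y z x)
    (h2 : ¬ side T y z u) (hyρ : side T y z ρ) (a1 : G.Adj x z) (a3 : G.Adj y u)
    (hy : dg T y = 2) (hc : T.Adj x c) (hcρ : side T x c ρ) (hcu : side T x c u) : False := by
  have hT := o.isTree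
  have hr := o.root
  have hzy := hyz.symm
  obtain ⟨w, e, f, hw, n2, n1, he, s1, s2, s3, hf, t1, t2, t3⟩ :=
    o.exists_branch_above hu hx hc hcρ hcu
  have hyw := not_side_of_two hT hyz h1 h2 s1 s2 t1 he hf
  have n3 : w ≠ y := by rintro rfl; omega
  have n4 : w ≠ ρ := by rintro rfl; exact hyw hyρ
  obtain ⟨g, hg, hgρ⟩ := exists_side hT n4
  have hgz := side_of_sep hyz hyw hyρ hgρ
  have hge : g ≠ e := by rintro rfl; exact s3 hgρ
  have hgf : g ≠ f := by rintro rfl; exact t3 hgρ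
  have hez := side_disjoint hT hg hge he hgz.1
  have hey := side_disjoint hT hg hge he (hgz.2 n3)
  have hfz := side_disjoint hT hg hgf hf hgz.1
  have hfy := side_disjoint hT hg hgf hf (hgz.2 n3)
  have h := exch2 o.le hT hyz he (by grind) (by grind [side_self]) a1 a3.symm (by
    intro K hK k1 k2
    clear hr hc hcρ hcu
    grind [side_self, not_side, side_iff_not, side_step, side_disjoint, side_branch])
  have hd : ∀ t, dg (mv T [(y, z), (w, e)] [(x, z), (u, y)]) t + (ι e t + ι w t) =
    dg T t + (ι u t + ι x t) := fun t => by have := h.deg t; grind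
  obtain ⟨hw4, hW⟩ := o.leaf_cubic h hd hu hx hw n2
  have hdy := dist_toward hT hyz hyρ
  have hdw := side_dist hT hzy ((side_iff_not hT hzy w).2 hyw) ((side_iff_not hT hyz ρ).1 hyρ)
  have hdx := side_dist hT hf t1 t3
  have e1 := T.dist_comm (u := x) (v := ρ)
  have e2 := T.dist_comm (u := z) (v := ρ)
  have key : ∀ v, 3 ≤ dg T v → T.dist ρ v ≤ T.dist ρ y → side T y z v := fun v hv hvy =>
    side_toward_of_dist_le hT hyz hyρ (by rintro rfl; omega) hvy
  have key2 : ∀ v, side T y z v → ¬ side T w e v := fun v hv => by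
    have := side_of_sep hyz hyw hv (u := v) (e := e)
    tauto
  have hdist : ∀ v, side T y z v →
      (mv T [(y, z), (w, e)] [(x, z), (u, y)]).dist ρ v ≤ T.dist ρ v :=
    fun v hv => mv_dist_le hT (by
      have := key2 v hv
      have := key2 ρ hyρ
      simp only [List.mem_cons, List.not_mem_nil, or_false, forall_eq_or_imp, forall_eq]
      grind)
  have hne : ∀ v, side T y z v → v ≠ w ∧ v ≠ e ∧ v ≠ u ∧ v ≠ x := fun v hv =>
    ⟨by rintro rfl; exact hyw hv, by rintro rfl; exact key2 _ hv (side_self _ _),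
      by rintro rfl; exact h2 hv, by rintro rfl; exact h1 hv⟩
  refine o.not_pot h hW ?_ (k := T.dist ρ y)
    (fun v h3 hv => ⟨?_, hdist v (key v h3 hv)⟩) (g := x) ?_ ?_ ?_
  · have := hd ρ; have := hne ρ hyρ; grind [ι]
  · have := hd v; have := hne v (key v h3 hv); grind [ι]
  · have := hd x
    have : x ≠ e := by rintro rfl; exact s2 (side_self _ _)
    grind [ι]
  · have h3 := h.isTree.connected.dist_triangle (u := ρ) (v := z) (w := x)
    have h4 : (mv T [(y, z), (w, e)] [(x, z), (u, y)]).Adj z x := by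
      rw [mv_adj]; grind [a1.ne]
    have h5 := dist_eq_one_iff_adj.2 h4
    have h6 := hdist z (side_self _ _)
    omega
  · intro _
    omega

/-- Let `w` separate `y`, `x` and `ρ`. If `w ≠ x`, exchanging `yz`, `we` for `uz`, `xy` leads to
`Opt.ring`. If `w = x`, the two children of `x` are adjacent, and this edge lets `x` lose a degree
to the leaf `u`. -/
theorem Opt.leaf_cubic_same_two (o : Opt G T ρ) (hG : NoClaw G) (hu : dg T u = 1)
    (hx : dg T x = 3) (hxρ : x ≠ ρ) (hyz : T.Adj y z) (hyx : y ≠ x) (h1 : ¬ side T y z x)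
    (h2 : ¬ side T y z u) (a1 : G.Adj x z) (a2 : G.Adj u z) (a3 : G.Adj x y)
    (hy : dg T y = 2) (hyρ : ¬ side T y z ρ) : False := by
  have hT := o.isTree
  have hr := o.root
  have hzy := hyz.symm
  obtain ⟨c, hc, hcρ⟩ := exists_side hT hxρ
  obtain ⟨w, m1, m2, m3, m4, m5⟩ := exists_branch_median hT hr hyx (by rintro rfl; omega) hxρ
  have n1 : w ≠ y := by
    rintro rfl
    obtain ⟨g, hg, r1, r2, r3⟩ := m3 (by rintro rfl; omega)
    obtain ⟨e, he, s1, s2, s3⟩ := m2 hyx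
    have := three_le_dg he hg hyz (by grind) (by grind) (by grind)
    omega
  obtain ⟨e, he, s1, s2, s3⟩ := m1 n1
  have hyw : ¬ side T y z w := fun h => by
    by_cases hwx : w = x
    · exact h1 (hwx ▸ h)
    obtain ⟨f, hf, t1, t2, t3⟩ := m2 hwx
    have := side_of_sep hzy (by grind [side_iff_not]) ((side_iff_not hT hzy x).2 h1) t1
    have := side_of_sep hzy (by grind [side_iff_not]) (side_self _ _) s1
    grind [side_disjoint]
  have hez := (side_ends (e := e) hyz hyw n1).1 s1
  by_cases hwx : w = x
  · subst hwx
    clear m1 m2 m3 m5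
    have hec : e ≠ c := by rintro rfl; exact s3 hcρ
    obtain ⟨a, ha, hae, hac⟩ := exists_adj_ne_ne (T := T) (w := w) e c hx.ge
    have hay := side_disjoint hT he hae.symm ha s1
    have haz := side_disjoint hT he hae.symm ha hez
    have hab := o.children_adj hG hx hc hcρ ha hac he hec hae
    by_cases hye : y = e
    · subst hye
      have h := exch2 o.le hT hyz ha (by grind) (by grind [side_self]) a2 hab (by
        intro K hK k1 k2
        clear hr hc hcρ
        grind [side_self, not_side, side_iff_not, side_step, side_disjoint, side_branch])
      exact o.leaf_branch (v := w) (u := u) h (fun t => by have := h.deg t; grind) hu hx.ge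
    · have h := exch3 o.le hT hyz ha he (by grind) (by grind [side_self]) (by grind)
        (by grind [side_self]) (by grind) (by grind [side_self]) a2 a3 hab (by
        intro K hK k1 k2 k3
        clear hr hc hcρ
        grind [side_self, not_side, side_iff_not, side_step, side_disjoint, side_branch])
      exact o.leaf_branch (v := w) (u := u) h (fun t => by have := h.deg t; grind) hu hx.ge
  · obtain ⟨f, hf, t1, t2, t3⟩ := m2 hwx
    have hw := m5 n1 hwx
    clear m1 m2 m3 m5
    have hf' : (mv T [(y, z), (w, e)] [(u, z), (x, y)]).Adj w f := by
      rw [mv_adj]; grind [side_self]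
    have h := exch2 o.le hT hyz he (by grind) (by grind [side_self]) a2 a3 (by
      intro K hK k1 k2
      grind [side_self, not_side, side_iff_not, side_step, side_disjoint, side_branch])
    refine o.ring hG hu hx hxρ hw hwx h (fun t => by have := h.deg t; grind)
          (o.le he) hf' (mv_side hT ?_) ?_
    · intro K k1 k2
      simp only [List.mem_cons, List.not_mem_nil, or_false, forall_eq_or_imp, forall_eq,
            Prod.mk.injEq, ne_eq] at k1 k2
      clear h hf'
      grind [side_self, not_side, side_iff_not, side_step, side_disjoint, side_branch]
    · intro g hg hgρ
      simp only [List.mem_cons, List.not_mem_nil, or_false, forall_eq_or_imp, forall_eq]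
      clear h hf'
      grind [side_self, not_side, side_iff_not, side_step, side_disjoint, side_branch]

/-- The separating vertex `w` has degree four. No neighbour of `w` other than `g` is adjacent to
`e`, so a claw is avoided only if `f` is adjacent to the fourth neighbour `q`; that edge lets `w`
drop to degree two. -/
theorem Opt.leaf_cubic_same_above_two (o : Opt G T ρ) (hG : NoClaw G) (hu : dg T u = 1)
    (hx : dg T x = 3) (hyz : T.Adj y z) (hyx : y ≠ x) (h1 : ¬ side T y z x)
    (h2 : ¬ side T y z u) (hyρ : side T y z ρ) (a2 : G.Adj u z) (a3 : G.Adj x y)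
    (hy : dg T y = 2) (hc : T.Adj x c) (hcρ : side T x c ρ) (hcu : side T x c u) : False := by
  have hT := o.isTree
  have hr := o.root
  have hzy := hyz.symm
  obtain ⟨w, e, f, hw, n2, n1, he, s1, s2, s3, hf, t1, t2, t3⟩ :=
    o.exists_branch_above hu hx hc hcρ hcu
  have hyw := not_side_of_two hT hyz h1 h2 s1 s2 t1 he hf
  have n3 : w ≠ y := by rintro rfl; omega
  have n4 : w ≠ ρ := by rintro rfl; exact hyw hyρ
  obtain ⟨g, hg, hgρ⟩ := exists_side hT n4
  have hgz := side_of_sep hyz hyw hyρ hgρ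
  have hoff : ∀ q, T.Adj w q → q ≠ g → ¬ side T w q z ∧ ¬ side T w q y := fun q hq hqg =>
    ⟨side_disjoint hT hg hqg.symm hq hgz.1, side_disjoint hT hg hqg.symm hq (hgz.2 n3)⟩
  have hge : e ≠ g := by rintro rfl; exact s3 hgρ
  have hgf : f ≠ g := by rintro rfl; exact t3 hgρ
  have hef : e ≠ f := by rintro rfl; exact s2 t1
  have he' := hoff e he hge
  have hf' := hoff f hf hgf
  have hw4 : dg T w = 4 := by
    have h := exch2 o.le hT hyz hf (by grind) (by grind [side_self]) a2 a3 (by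
      intro K hK k1 k2
      clear hr hc hcρ hcu
      grind [side_self, not_side, side_iff_not, side_step, side_disjoint, side_branch])
    exact (o.leaf_cubic (e := f) (u := u) (x := x) h (fun t => by have := h.deg t; grind) hu hx hw
      n2).1
  have k1 : ∀ q, T.Adj w q → q ≠ g → q ≠ e → ¬ G.Adj e q := fun q hq hqg hqe heq => by
    have hq' := hoff q hq hqg
    have h := exch2 o.le hT he hq (by grind) (by grind [side_self, not_side]) heq a2 (by
      intro K hK k1 k2
      clear hr hc hcρ hcu
      grind [side_self, not_side, side_iff_not, side_step, side_disjoint, side_branch])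
    exact o.leaf_quartic (w := w) (u := u) (z := z) h (fun t => by have := h.deg t; grind) hu hw4
  obtain ⟨q, hq, hqe, hqf, hqg⟩ := exists_adj_ne_ne_ne (T := T) (w := w) e f g hw4.ge
  have hq' := hoff q hq hqg
  have := k1 q hq hqg hqe
  have := k1 f hf hgf hef.symm
  have hfq : G.Adj f q := by
    have := hG (o.le he) (o.le hf) (o.le hq) hef hqe.symm hqf.symm
    tauto
  have h := exch3 o.le hT hyz hf hq (by grind) (by grind [side_self]) (by grind)
        (by grind [side_self]) (by grind) (by grind [side_self]) a2 a3 hfq (by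
    intro K hK k1 k2 k3
    clear hr hc hcρ hcu
    grind [side_self, not_side, side_iff_not, side_step, side_disjoint, side_branch])
  exact o.leaf_quartic (w := w) (u := u) (z := x) h (fun t => by have := h.deg t; grind) hu hw4

/-- At `z` the vertices `x`, `u`, `y` do not form a claw, and `x`, `u` are not adjacent; so `y` is
adjacent to `x` or to `u`. The cases differ in where `ρ` and `u` lie. -/
theorem Opt.leaf_cubic_same (o : Opt G T ρ) (hG : NoClaw G) (hu : dg T u = 1)
    (hx : dg T x = 3) (hxρ : x ≠ ρ) (hyz : T.Adj y z) (hyx : y ≠ x) (h1 : ¬ side T y z x)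
    (h2 : ¬ side T y z u) (a1 : G.Adj x z) (a2 : G.Adj u z) : False := by
  have hT := o.isTree
  have hy := o.dg_eq_two_of_same hu hyz hyx h1 h2 a2
  have hne : x ≠ u := by rintro rfl; omega
  obtain ⟨c, hc, hcρ⟩ := exists_side hT hxρ
  obtain ⟨a, ha, hau⟩ := exists_side hT hne
  have key := hG a1.symm a2.symm (o.le hyz).symm hne hyx.symm (by rintro rfl; omega)
  have k1 : ¬ G.Adj x u := fun h => o.leaf_nonadj_cubic hG hu hx hxρ h.symm
  by_cases hyρ : side T y z ρ
  · by_cases hac : a = c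
    · subst hac
      rcases key with k | k | k
      · exact k1 k
      · exact o.leaf_cubic_same_above_two hG hu hx hyz hyx h1 h2 hyρ a2 k hy hc hcρ hau
      · exact o.leaf_cubic_same_above_one hu hx hyz hyx h1 h2 hyρ a1 k.symm hy hc hcρ hau
    · exact o.leaf_cubic_same_below hu hx hyz hyx h1 h2 hyρ a2 hc hcρ ha hac hau
  · rcases key with k | k | k
    · exact k1 k
    · exact o.leaf_cubic_same_two hG hu hx hxρ hyz hyx h1 h2 a1 a2 k hy hyρ
    · exact o.leaf_cubic_same_one hG hu hx hxρ hyz hyx h1 h2 a1 a2 k.symm hy hyρ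

end

section

/-! ### Pairs of cubic vertices -/

variable {V : Type*} {G T T' : SimpleGraph V} {ρ u u' v v' w e f h y z x x' a b c : V}

/-- The vertices `x`, `x'` are adjacent in `G`, or each is adjacent to the farther end of an edge of
`T` between them. -/
def Conf (G T : SimpleGraph V) (x x' : V) : Prop := G.Adj x x' ∨ ∃ y z, T.Adj y z ∧
  ¬ side T y z x ∧ side T y z x' ∧ y ≠ x ∧ z ≠ x' ∧ G.Adj x z ∧ G.Adj x' y

theorem Conf.symm (hT : T.IsTree) (h : Conf G T x x') : Conf G T x' x := by
  rcases h with h | ⟨y, z, h1, h2, h3, h4, h5, h6, h7⟩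
  · exact Or.inl h.symm
  · exact Or.inr ⟨z, y, h1.symm, (side_iff_not hT h1 _).1 h3, (side_iff_not hT h1.symm _).2 h2,
      h5, h4, h7, h6⟩

variable [Fintype V]

/-- The relation allows a branch edge `we` on the path between `x` and `x'` to be cut at the price 7
+ 7, too cheap if `w` is cubic. An edge `eh` would allow a second edge at `w` to be cut for free.
The case `w = z` is excluded because `we` may then be `yz` itself. -/
theorem Opt.conf_opposite (o : Opt G T ρ) (hx : dg T x = 3) (hx' : dg T x' = 3) (hn : x ≠ x')
    (hyz : T.Adj y z) (h1 : ¬ side T y z x) (h2 : side T y z x') (a1 : G.Adj x z)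
    (a2 : G.Adj x' y) (hw : 3 ≤ dg T w) (he : T.Adj w e) (hf : T.Adj w f) (hef : e ≠ f)
    (hex : side T w e x) (hfx : side T w f x') (hwz : w ≠ z) :
    4 ≤ dg T w ∧ ∀ h, T.Adj w h → h ≠ e → h ≠ f → ¬ G.Adj e h := by
  have hT := o.isTree
  have hzy := hyz.symm
  have hex' := side_disjoint hT hf hef.symm he hfx
  have hfx' := side_disjoint hT he hef hf hex
  have hwx : w ≠ x := by rintro rfl; exact not_side hT he hex
  have hwx' : w ≠ x' := by rintro rfl; exact not_side hT hf hfx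
  have sep1 := fun k => side_of_sep (e := f) hyz k h2 hfx
  have sep2 := fun k => side_of_sep (e := e) hzy k ((side_iff_not hT hzy x).2 h1) hex
  have hw4 : 4 ≤ dg T w := by
    by_cases hwy : w = y
    · subst hwy
      have h := exch1 o.le hT hyz a1 (by grind [side_self])
      exact (o.branch_cubic (w := w) (x := x) h (fun t => by have := h.deg t; grind) hx hw hwx).1.ge
    · by_contra hw4
      have h := exch2 o.le hT hyz he (by grind) (by grind) a1 a2 (by
        intro K hK k1 k2
        grind [side_self, not_side, side_iff_not, side_step, side_disjoint, side_branch])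
      exact o.three_cubics (w := w) (x := x) (x' := x') (e := e) h
        (fun t => by have := h.deg t; grind) hx hx' (by omega) hn hwx hwx'
  refine ⟨hw4, fun h hh hhe hhf hG => ?_⟩
  have hhx := side_disjoint hT he hhe.symm hh hex
  have hhx' := side_disjoint hT hf hhf.symm hh hfx
  have hey : ¬ (e = z ∧ w = y) := by
    rintro ⟨rfl, rfl⟩; exact h1 hex
  have hhz : ¬ (w = y ∧ h = z) := by rintro ⟨rfl, rfl⟩; exact hhx' h2
  have hey' : ¬ (w = z ∧ e = y) := fun k => hwz k.1
  have hm := exch3 o.le hT hyz he hh (by grind) (by grind) (by grind) (by grind) (by grind)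
    (by grind [he.ne]) a1 a2 hG (by
      intro K hK k1 k2 k3
      clear hx hx' hG hw hw4
      grind [side_self, not_side, side_iff_not, side_step, side_disjoint, side_branch])
  exact o.two_cubics (w := w) (x := x) (x' := x') hm (fun t => by have := hm.deg t; grind) hx hx'
    hw4 hn

theorem Opt.conf_adj (o : Opt G T ρ) (hx : dg T x = 3) (hx' : dg T x' = 3) (hn : x ≠ x')
    (a1 : G.Adj x x') (hw : 3 ≤ dg T w) (he : T.Adj w e) (hf : T.Adj w f) (hef : e ≠ f)
    (hex : side T w e x) (hfx : side T w f x') :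
    4 ≤ dg T w ∧ ∀ h, T.Adj w h → h ≠ e → h ≠ f → ¬ G.Adj e h := by
  have hT := o.isTree
  have hex' := side_disjoint hT hf hef.symm he hfx
  have hfx' := side_disjoint hT he hef hf hex
  have hwx : w ≠ x := by rintro rfl; exact not_side hT he hex
  have hwx' : w ≠ x' := by rintro rfl; exact not_side hT hf hfx
  have hw4 : 4 ≤ dg T w := by
    by_contra hw4
    have h := exch1 o.le hT he a1 (by grind)
    exact o.three_cubics (w := w) (x := x) (x' := x') (e := e) h
      (fun t => by have := h.deg t; grind) hx hx' (by omega) hn hwx hwx'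
  refine ⟨hw4, fun h hh hhe hhf hG => ?_⟩
  have hhx := side_disjoint hT he hhe.symm hh hex
  have hhx' := side_disjoint hT hf hhf.symm hh hfx
  have hm := exch2 o.le hT he hh (by grind) (by grind [he.ne]) a1 hG (by
      intro K hK k1 k2
      grind [side_self, not_side, side_iff_not, side_step, side_disjoint, side_branch])
  exact o.two_cubics (w := w) (x := x) (x' := x') hm (fun t => by have := hm.deg t; grind) hx hx'
    hw4 hn

/-- One of the two nonadjacency statements is lost exactly when `w` is an end of the edge `yz`
witnessing the relation; the adjacencies to that edge are recorded instead. -/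
theorem Opt.conf_between (o : Opt G T ρ) (hx : dg T x = 3) (hx' : dg T x' = 3) (hn : x ≠ x')
    (hC : Conf G T x x') (hw : 3 ≤ dg T w) (he : T.Adj w e) (hf : T.Adj w f) (hef : e ≠ f)
    (hex : side T w e x) (hfx : side T w f x') :
    4 ≤ dg T w ∧
    (((∀ h, T.Adj w h → h ≠ e → h ≠ f → ¬ G.Adj e h) ∧
      (∀ h, T.Adj w h → h ≠ e → h ≠ f → ¬ G.Adj f h)) ∨
     ((∀ h, T.Adj w h → h ≠ e → h ≠ f → ¬ G.Adj f h) ∧ G.Adj x w ∧ G.Adj x' e) ∨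
     ((∀ h, T.Adj w h → h ≠ e → h ≠ f → ¬ G.Adj e h) ∧ G.Adj x' w ∧ G.Adj x f)) := by
  have hT := o.isTree
  rcases hC with a1 | ⟨y, z, hyz, h1, h2, h3, h4, a1, a2⟩
  · have k1 := o.conf_adj hx hx' hn a1 hw he hf hef hex hfx
    have k2 := o.conf_adj hx' hx hn.symm a1.symm hw hf he hef.symm hfx hex
    exact ⟨k1.1, Or.inl ⟨k1.2, fun h i j k => k2.2 h i k j⟩⟩
  · have k1 := o.conf_opposite hx hx' hn hyz h1 h2 a1 a2 hw he hf hef hex hfx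
    have k2 := o.conf_opposite hx' hx hn.symm hyz.symm ((side_iff_not hT hyz _).1 h2)
      ((side_iff_not hT hyz.symm _).2 h1) a2 a1 hw hf he hef.symm hfx hex
    by_cases hwz : w = z
    · have hwy : w ≠ y := by rintro rfl; exact hyz.ne hwz
      have h5 := k2 hwy
      refine ⟨h5.1, Or.inr (Or.inl ⟨fun h i j k => h5.2 h i k j, hwz ▸ a1, ?_⟩)⟩
      subst hwz
      by_contra hne
      have : e ≠ y := by rintro rfl; exact hne a2
      have := side_disjoint hT he this hyz.symm hex
      exact this ((side_iff_not hT hyz.symm _).2 h1)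
    · have h5 := k1 hwz
      by_cases hwy : w = y
      · refine ⟨h5.1, Or.inr (Or.inr ⟨h5.2, hwy ▸ a2, ?_⟩)⟩
        subst hwy
        by_contra hne
        have : f ≠ z := by rintro rfl; exact hne a1
        exact side_disjoint hT hf this hyz hfx h2
      · exact ⟨h5.1, Or.inl ⟨h5.2, fun h i j k => (k2 hwy).2 h i k j⟩⟩

/-- Two such partners would have a common branch vertex `w` with `x`, and `w` has degree at least
four. The nonadjacencies around `w` obtained from both pairs leave a claw among four of its
neighbours, or else `x` is adjacent to both `f₁` and `f₂`. -/
theorem Opt.conf_unique (o : Opt G T ρ) (hG : NoClaw G) {x₁ x₂ : V} (hx : dg T x = 3)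
    (hx₁ : dg T x₁ = 3) (hx₂ : dg T x₂ = 3) (hc : T.Adj x c) (h1 : side T x c x₁)
    (h2 : side T x c x₂) (hC₁ : Conf G T x x₁) (hC₂ : Conf G T x x₂) : x₁ = x₂ := by
  by_contra hn
  have hT := o.isTree
  have hn1 : x ≠ x₁ := by rintro rfl; exact not_side hT hc h1
  have hn2 : x ≠ x₂ := by rintro rfl; exact not_side hT hc h2
  obtain ⟨w, m1, m2, m3⟩ := exists_median_sides hT x x₁ x₂
  have hwx : w ≠ x := by
    rintro rfl
    obtain ⟨f, hf, s1, s2, s3⟩ := m2 hn1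
    grind [side_disjoint]
  obtain ⟨e, he, s1, s2, s3⟩ := m1 hwx
  have hw1 : w ≠ x₁ := by
    rintro rfl
    obtain ⟨f, hf, t1, t2, t3⟩ := m3 hn
    have := (o.conf_between hx hx₂ hn2 hC₂ hx₁.ge he hf (by grind) s1 t1).1
    omega
  have hw2 : w ≠ x₂ := by
    rintro rfl
    obtain ⟨f, hf, t1, t2, t3⟩ := m2 hw1
    have := (o.conf_between hx hx₁ hn1 hC₁ hx₂.ge he hf (by grind) s1 t1).1
    omega
  obtain ⟨f₁, hf₁, t1, t2, t3⟩ := m2 hw1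
  obtain ⟨f₂, hf₂, r1, r2, r3⟩ := m3 hw2
  have d1 : e ≠ f₁ := by grind
  have d2 : e ≠ f₂ := by grind
  have d3 : f₁ ≠ f₂ := by grind
  clear m1 m2 m3
  have hw := three_le_dg he hf₁ hf₂ d1 d2 d3
  obtain ⟨hw4, k1⟩ := o.conf_between hx hx₁ hn1 hC₁ hw he hf₁ d1 s1 t1
  obtain ⟨-, k2⟩ := o.conf_between hx hx₂ hn2 hC₂ hw he hf₂ d2 s1 r1
  obtain ⟨h, hh, e1, e2, e3⟩ := exists_adj_ne_ne_ne (T := T) (w := w) e f₁ f₂ hw4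
  have c1 := hG (o.le he) (o.le hf₁) (o.le hf₂) d1 d2 d3
  have c2 := hG (o.le he) (o.le hf₁) (o.le hh) d1 e1.symm e2.symm
  have c3 := hG (o.le he) (o.le hf₂) (o.le hh) d2 e1.symm e3.symm
  have c4 := hG (o.le hf₁) (o.le hf₂) (o.le hh) d3 e2.symm e3.symm
  -- Moving one of `f₁`, `f₂` from `w` to `x` forces degree 4 at `w`, moving both forces degree 5.
  have k3 : ¬ (G.Adj x f₁ ∧ G.Adj x f₂) := by
    rintro ⟨a1, a2⟩
    have hm := exch1 o.le hT hf₁ a1 (by grind [side_self])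
    have := (o.branch_cubic (w := w) (x := x) hm (fun t => by have := hm.deg t; grind) hx hw hwx).1
    have hm := exch2 o.le hT hf₁ hf₂ (by grind) (by grind [hf₁.ne]) a1 a2 (by
      intro K hK l1 l2
      clear c1 c2 c3 c4 hC₁ hC₂ h1 h2 k1 k2 hn hh hG
      grind [side_self, not_side, side_iff_not, side_step, side_disjoint, side_branch])
    have := o.branch_cubic_twice (w := w) (x := x) hm (fun t => by have := hm.deg t; grind) hx hw hwx
    omega
  have k1' : (¬ G.Adj e f₂ ∧ ¬ G.Adj e h ∧ ¬ G.Adj f₁ f₂ ∧ ¬ G.Adj f₁ h) ∨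
      (¬ G.Adj f₁ f₂ ∧ ¬ G.Adj f₁ h) ∨ (¬ G.Adj e f₂ ∧ ¬ G.Adj e h ∧ G.Adj x f₁) := by
    rcases k1 with ⟨a, b⟩ | ⟨a, -, -⟩ | ⟨a, -, b⟩
    · exact Or.inl ⟨a f₂ hf₂ d2.symm d3.symm, a h hh e1 e2, b f₂ hf₂ d2.symm d3.symm, b h hh e1 e2⟩
    · exact Or.inr (Or.inl ⟨a f₂ hf₂ d2.symm d3.symm, a h hh e1 e2⟩)
    · exact Or.inr (Or.inr ⟨a f₂ hf₂ d2.symm d3.symm, a h hh e1 e2, b⟩)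
  have k2' : (¬ G.Adj e f₁ ∧ ¬ G.Adj e h ∧ ¬ G.Adj f₂ f₁ ∧ ¬ G.Adj f₂ h) ∨
      (¬ G.Adj f₂ f₁ ∧ ¬ G.Adj f₂ h) ∨ (¬ G.Adj e f₁ ∧ ¬ G.Adj e h ∧ G.Adj x f₂) := by
    rcases k2 with ⟨a, b⟩ | ⟨a, -, -⟩ | ⟨a, -, b⟩
    · exact Or.inl ⟨a f₁ hf₁ d1.symm d3, a h hh e1 e3, b f₁ hf₁ d1.symm d3, b h hh e1 e3⟩
    · exact Or.inr (Or.inl ⟨a f₁ hf₁ d1.symm d3, a h hh e1 e3⟩)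
    · exact Or.inr (Or.inr ⟨a f₁ hf₁ d1.symm d3, a h hh e1 e3, b⟩)
  rw [G.adj_comm f₂ f₁] at k2'
  clear k1 k2
  grind

end

section

variable {V : Type*} [Fintype V] {G T T' : SimpleGraph V}
  {ρ u u' v v' w e f h y z x x' a b c p p' m e₁ e₂ z' : V}

/-! ### Two cubic vertices adjacent to the farther end of a tree edge -/

theorem exch4 (hTG : T ≤ G) (hT : T.IsTree) {p₁ q₁ p₂ q₂ p₃ q₃ p₄ q₄ r₁ s₁ r₂ s₂ r₃ s₃ r₄ s₄ : V}
    (h1 : T.Adj p₁ q₁) (h2 : T.Adj p₂ q₂) (h3 : T.Adj p₃ q₃) (h4 : T.Adj p₄ q₄)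
    (hp : [(p₁, q₁), (p₂, q₂), (p₃, q₃), (p₄, q₄)].Pairwise fun e f => f ≠ e ∧ f ≠ e.swap)
    (a1 : G.Adj r₁ s₁) (a2 : G.Adj r₂ s₂) (a3 : G.Adj r₃ s₃) (a4 : G.Adj r₄ s₄)
    (H : ∀ K : V → Prop, (∀ a b, (side T p₁ q₁ a ↔ side T p₁ q₁ b) →
      (side T p₂ q₂ a ↔ side T p₂ q₂ b) → (side T p₃ q₃ a ↔ side T p₃ q₃ b) →
      (side T p₄ q₄ a ↔ side T p₄ q₄ b) → (K a ↔ K b)) → (K r₁ ↔ K s₁) → (K r₂ ↔ K s₂) →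
      (K r₃ ↔ K s₃) → (K r₄ ↔ K s₄) →
      (K p₁ ↔ K q₁) ∧ (K p₂ ↔ K q₂) ∧ (K p₃ ↔ K q₃) ∧ (K p₄ ↔ K q₄)) :
    Exch G T (mv T [(p₁, q₁), (p₂, q₂), (p₃, q₃), (p₄, q₄)]
      [(r₁, s₁), (r₂, s₂), (r₃, s₃), (r₄, s₄)])
      (fun v => ι p₁ v + ι q₁ v + (ι p₂ v + ι q₂ v + (ι p₃ v + ι q₃ v + (ι p₄ v + ι q₄ v))))
      fun v => ι r₁ v + ι s₁ v + (ι r₂ v + ι s₂ v + (ι r₃ v + ι s₃ v + (ι r₄ v + ι s₄ v))) := by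
  have := exch_mv (A := [(r₁, s₁), (r₂, s₂), (r₃, s₃), (r₄, s₄)]) hTG hT
    (by simp [h1, h2, h3, h4]) hp rfl (by simp [a1, a2, a3, a4]) (by
      simp only [List.mem_cons, List.not_mem_nil, or_false, forall_eq_or_imp, forall_eq]
      intro K hK hA
      exact H K (fun a b h h' h'' h''' => hK a b ⟨h, h', h'', h'''⟩) hA.1 hA.2.1 hA.2.2.1 hA.2.2.2)
  simpa using this

theorem exch5 (hTG : T ≤ G) (hT : T.IsTree)
    {p₁ q₁ p₂ q₂ p₃ q₃ p₄ q₄ p₅ q₅ r₁ s₁ r₂ s₂ r₃ s₃ r₄ s₄ r₅ s₅ : V}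
    (h1 : T.Adj p₁ q₁) (h2 : T.Adj p₂ q₂) (h3 : T.Adj p₃ q₃) (h4 : T.Adj p₄ q₄) (h5 : T.Adj p₅ q₅)
    (hp : [(p₁, q₁), (p₂, q₂), (p₃, q₃), (p₄, q₄), (p₅, q₅)].Pairwise
      fun e f => f ≠ e ∧ f ≠ e.swap)
    (a1 : G.Adj r₁ s₁) (a2 : G.Adj r₂ s₂) (a3 : G.Adj r₃ s₃) (a4 : G.Adj r₄ s₄)
    (a5 : G.Adj r₅ s₅)
    (H : ∀ K : V → Prop, (∀ a b, (side T p₁ q₁ a ↔ side T p₁ q₁ b) →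
      (side T p₂ q₂ a ↔ side T p₂ q₂ b) → (side T p₃ q₃ a ↔ side T p₃ q₃ b) →
      (side T p₄ q₄ a ↔ side T p₄ q₄ b) → (side T p₅ q₅ a ↔ side T p₅ q₅ b) → (K a ↔ K b)) →
      (K r₁ ↔ K s₁) → (K r₂ ↔ K s₂) → (K r₃ ↔ K s₃) → (K r₄ ↔ K s₄) → (K r₅ ↔ K s₅) →
      (K p₁ ↔ K q₁) ∧ (K p₂ ↔ K q₂) ∧ (K p₃ ↔ K q₃) ∧ (K p₄ ↔ K q₄) ∧ (K p₅ ↔ K q₅)) :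
    Exch G T (mv T [(p₁, q₁), (p₂, q₂), (p₃, q₃), (p₄, q₄), (p₅, q₅)]
      [(r₁, s₁), (r₂, s₂), (r₃, s₃), (r₄, s₄), (r₅, s₅)])
      (fun v => ι p₁ v + ι q₁ v + (ι p₂ v + ι q₂ v + (ι p₃ v + ι q₃ v +
        (ι p₄ v + ι q₄ v + (ι p₅ v + ι q₅ v)))))
      fun v => ι r₁ v + ι s₁ v + (ι r₂ v + ι s₂ v + (ι r₃ v + ι s₃ v +
        (ι r₄ v + ι s₄ v + (ι r₅ v + ι s₅ v)))) := by
  have := exch_mv (A := [(r₁, s₁), (r₂, s₂), (r₃, s₃), (r₄, s₄), (r₅, s₅)]) hTG hT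
    (by simp [h1, h2, h3, h4, h5]) hp rfl (by simp [a1, a2, a3, a4, a5]) (by
      simp only [List.mem_cons, List.not_mem_nil, or_false, forall_eq_or_imp, forall_eq]
      intro K hK hA
      exact H K (fun a b h h' h'' h''' h'''' => hK a b ⟨h, h', h'', h''', h''''⟩)
        hA.1 hA.2.1 hA.2.2.1 hA.2.2.2.1 hA.2.2.2.2)
  simpa using this

/-- A claw at `m` is avoided only by an edge `e₂h`, which frees a second edge at `m`. Claws at `z`
involving a further neighbour `z'` then supply the new edges at `p` and `p'`. Every outcome is a
gain, except that `p'` may take two edges from an `m` of degree 5. -/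
theorem Opt.cubics_same_far (o : Opt G T ρ) (hG : NoClaw G) (hp : dg T p = 3) (hp' : dg T p' = 3)
    (hn : p ≠ p') (hnG : ¬ G.Adj p p') (hyz : T.Adj y z) (h1 : ¬ side T y z p)
    (h2 : ¬ side T y z p') (a1 : G.Adj p z) (a2 : G.Adj p' z) (a3 : G.Adj p y)
    (hyp' : y ≠ p') (hzz : T.Adj z z')
    (hz' : z' ≠ y) (hm : 4 ≤ dg T m) (he₁ : T.Adj m e₁) (he₂ : T.Adj m e₂) (hh : T.Adj m h)
    (s1 : side T m e₁ p) (s2 : side T m e₂ p') (d1 : e₁ ≠ e₂) (d2 : h ≠ e₁) (d3 : h ≠ e₂)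
    (y1 : ¬ side T m e₁ y) (z1 : ¬ side T m e₁ z) (y2 : ¬ side T m e₂ y) (z2 : ¬ side T m e₂ z)
    (y3 : ¬ side T m h y) (z3 : ¬ side T m h z) (hmz : ¬ side T y z m) : False := by
  have hT := o.isTree
  have hzy := hyz.symm
  have hmz' : m ≠ z := by rintro rfl; exact hmz (side_self _ _)
  have t1 := side_disjoint hT he₂ d1.symm he₁ s2
  have t2 := side_disjoint hT he₁ d1 he₂ s1
  have t3 := side_disjoint hT he₁ d2.symm hh s1
  have t4 := side_disjoint hT he₂ d3.symm hh s2
  have key : ∀ q, T.Adj m q → q ≠ e₁ → ¬ side T m q y → ¬ side T m q z → ¬ side T m q p →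
      ¬ G.Adj e₁ q := by
    intro q hq hqe hqy hqz hqp hG'
    have hx := exch3 o.le hT hyz he₁ hq (by grind [side_self]) (by grind) (by grind [side_self])
      (by grind) (by grind) (by grind [he₁.ne]) a2 a3 hG' (by
        intro K hK l1 l2 l3
        clear hnG a1 a2 a3 hz' hzz hh d2 d3 y3 z3 t3 t4 hG' hm hp hp'
        grind [side_self, not_side, side_iff_not, side_step, side_disjoint, side_branch])
    exact o.two_cubics (w := m) (x := p) (x' := p') hx (fun t => by have := hx.deg t; grind) hp hp'
      hm hn
  have k1 := key e₂ he₂ d1.symm y2 z2 t2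
  have k2 := key h hh d2 y3 z3 t3
  have k3 : G.Adj e₂ h := by
    have := hG (o.le he₁) (o.le he₂) (o.le hh) d1 d2.symm d3.symm
    tauto
  clear key k1 k2
  have hzz' : side T z z' z' := side_self _ _
  have hyz' := hyz.ne
  have zm : ¬ side T z z' m ∧ ¬ side T z z' y ∧ ¬ side T z z' p ∧ ¬ side T z z' p' ∧
      ¬ side T z z' e₁ ∧ ¬ side T z z' e₂ ∧ ¬ side T z z' h ∧ ¬ side T z z' z := by
    have h0 : ∀ v, ¬ side T y z v → ¬ side T z z' v := fun v hv =>
      side_disjoint hT hzy hz'.symm hzz ((side_iff_not hT hzy v).2 hv)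
    refine ⟨h0 _ hmz, h0 _ (not_side hT hyz), h0 _ h1, h0 _ h2, h0 _ ?_, h0 _ ?_, h0 _ ?_,
      not_side hT hzz⟩
    all_goals rw [← side_step (by assumption)] <;> grind [side_self]
  have hme : ∀ q, T.Adj m q → ¬ side T m q z → ¬ side T m q z' := fun q hq hqz => by
    rwa [← side_step hzz]
    · rintro ⟨rfl, -⟩; exact hmz' rfl
    · rintro ⟨rfl, rfl⟩; exact zm.1 hzz'
  have z1' := hme e₁ he₁ z1
  have z2' := hme e₂ he₂ z2
  have z3' := hme h hh z3
  obtain ⟨zm, zy, zp, zp', ze₁, ze₂, zh, zz⟩ := zm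
  have ym := not_side hT hyz
  have ye : ∀ q, T.Adj m q → ¬ side T m q z → ¬ side T y z q := fun q hq hqz => by
    rw [← side_step hq] <;> grind [side_self]
  have ye₁ := ye e₁ he₁ z1
  have ye₂ := ye e₂ he₂ z2
  have yh := ye h hh z3
  have yz' : side T y z z' := by
    rw [← side_step hzz] <;> grind [side_self]
  have n1 := not_side hT he₁
  have n2 := not_side hT he₂
  have n3 := not_side hT hh
  have q1 := side_self (T := T) m e₁
  have q2 := side_self (T := T) m e₂
  have q3 := side_self (T := T) m h
  have q4 := side_self (T := T) y z
  have r1 := side_disjoint hT he₁ d1 he₂ q1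
  have r2 := side_disjoint hT he₁ d2.symm hh q1
  have r3 := side_disjoint hT he₂ d1.symm he₁ q2
  have r4 := side_disjoint hT he₂ d3.symm hh q2
  have r5 := side_disjoint hT hh d2 he₁ q3
  have r6 := side_disjoint hT hh d3 he₂ q3
  have c1 : G.Adj p z' ∨ G.Adj p' z' := by
    have := hG a1.symm a2.symm (o.le hzz) hn (by grind) (by grind)
    tauto
  have nz : m ≠ z' := by rintro rfl; exact zm hzz'
  by_cases c2 : G.Adj p' z'
  · have hx := exch3 o.le hT hzz he₂ hh (by grind) (by grind) (by grind)
      (by grind) (by grind) (by grind) a2 c2 k3 (by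
        intro K hK l1 l2 l3
        clear hnG a1 a2 a3 hG
        grind)
    have hm5 := o.branch_cubic_twice (w := m) (x := p') hx (fun t => by have := hx.deg t; grind)
      hp' (by omega) (by grind)
    -- In the tie with `m` of degree 5, `m` gives up three edges and `p`, `p'` gain two each: cost
    -- at most 16 + 16 + K against 9 + 7 + 2K + 9.
    have hx := exch5 o.le hT hyz hzz he₁ he₂ hh (by simp; grind) a1.symm a2.symm c2.symm a3 k3 (by
        intro K hK l1 l2 l3 l4 l5
        clear hnG a1 a2 a3 hG hx
        grind)
    exact o.quintic (w := m) (p := p) (p' := p') (e := e₁) hx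
      (fun t => by have := hx.deg t; grind) hp hp' hm5 hn.symm
  · have c3 := hG a2.symm (o.le hzy) (o.le hzz) hyp'.symm (by grind) hz'.symm
    rcases c3 with c3 | c3 | c3
    · have hx := exch3 o.le hT hyz he₂ hh (by grind) (by grind) (by grind)
        (by grind) (by grind) (by grind) a1 c3 k3 (by
          intro K hK l1 l2 l3
          clear hnG a1 a2 a3 hG
          grind)
      exact o.two_cubics (w := m) (x := p) (x' := p') hx (fun t => by have := hx.deg t; grind) hp
        hp' hm hn
    · exact c2 c3
    · have hx := exch4 o.le hT hyz hzz he₂ hh (by simp; grind) c3 a1.symm a2.symm k3 (by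
          intro K hK l1 l2 l3 l4
          clear hnG a1 a2 a3 hG
          grind)
      exact o.two_cubics (w := m) (x := p) (x' := p') hx (fun t => by have := hx.deg t; grind) hp
        hp' hm hn

/-- The median `m` of `p`, `p'` and `y` may be `p'`, `p` or a further branch vertex. The first two
cases end by exchanges near `p`, in part using that the children of `p` are adjacent; in the last,
`m` has degree at least four. -/
theorem Opt.cubics_same_aux (o : Opt G T ρ) (hG : NoClaw G) (hp : dg T p = 3) (hp' : dg T p' = 3)
    (hpρ : p ≠ ρ) (hn : p ≠ p') (hnG : ¬ G.Adj p p') (hyz : T.Adj y z) (hyp : y ≠ p) (hyp' : y ≠ p')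
    (h1 : ¬ side T y z p) (h2 : ¬ side T y z p') (a1 : G.Adj p z) (a2 : G.Adj p' z)
    (a3 : G.Adj p y) : False := by
  have hT := o.isTree
  have hzy := hyz.symm
  have hz2 : 2 ≤ dg T z := by
    by_contra h
    exact o.leaf_nonadj_cubic hG (by have := o.pos hT z; omega) hp hpρ a1.symm
  obtain ⟨z', hzz, hz'⟩ := exists_adj_ne y hz2
  obtain ⟨m, m1, m2, m3⟩ := exists_median_sides hT p p' y
  have hyz' := not_side hT hyz
  have hmz : ¬ side T y z m := fun hm => by
    have hmp : m ≠ p := by rintro rfl; exact h1 hm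
    have hmp' : m ≠ p' := by rintro rfl; exact h2 hm
    obtain ⟨e₁, he₁, s1, s2, s3⟩ := m1 hmp
    obtain ⟨e₂, he₂, t1, t2, t3⟩ := m2 hmp'
    exact not_side_of_two hT hyz h1 h2 t1 t2 s1 he₂ he₁ hm
  by_cases hmp' : m = p'
  · subst hmp'
    obtain ⟨e, he, s1, s2, s3⟩ := m1 hn.symm
    have hz := (side_ends (e := e) hyz hmz hyp'.symm).not.1 s3
    have hx := exch2 o.le hT hyz he (by grind) (by grind [side_self]) a1 a3 (by
      intro K hK l1 l2
      clear m1 m2 m3 hG hnG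
      grind [side_self, not_side, side_iff_not, side_step, side_disjoint, side_branch])
    exact o.cubic_cubic_twice (p := p) (p' := m) (e := e) hx
      (fun t => by have := hx.deg t; grind) hp hp' hn.symm
  by_cases hmp : m = p
  · subst hmp
    obtain ⟨b, hb, s1, s2, s3⟩ := m3 hyp.symm
    obtain ⟨b', hb', t1, t2, t3⟩ := m2 hn
    clear m1 m2 m3
    have hz := (side_ends (e := b) hyz hmz hyp.symm).1 s1
    obtain ⟨c, hc, hcρ⟩ := exists_side hT hpρ
    by_cases hbc : b = c
    · subst hbc
      have hbb : b' ≠ b := by rintro rfl; exact s3 t1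
      obtain ⟨a, ha, hab, hab'⟩ := exists_adj_ne_ne (T := T) (w := m) b b' hp.ge
      have haa := o.children_adj hG hp hb hcρ ha hab hb' hbb hab'
      have hyz2 : side T y z z' := (side_step hzz (by grind [hyz.ne]) (by grind)).1 (side_self _ _)
      have c1 : G.Adj m z' ∨ G.Adj p' z' := by
        have := hG a1.symm a2.symm (o.le hzz) hn (by rintro rfl; exact h1 hyz2)
          (by rintro rfl; exact h2 hyz2)
        tauto
      have n1 : ¬ side T z z' m := side_disjoint hT hzy hz'.symm hzz ((side_iff_not hT hzy _).2 hmz)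
      have n2 : ¬ side T z z' p' := side_disjoint hT hzy hz'.symm hzz ((side_iff_not hT hzy _).2 h2)
      have n3 : ¬ side T z z' y :=
        side_disjoint hT hzy hz'.symm hzz ((side_iff_not hT hzy _).2 (not_side hT hyz))
      have n4 : m ≠ z' := by rintro rfl; exact hmz hyz2
      have n5 : m ≠ z := a1.ne
      have n6 : ¬ side T m a z := side_disjoint hT hb hab.symm ha hz
      have n7 : ¬ side T m b' z := side_disjoint hT hb hbb.symm hb' hz
      have n8 : ∀ q, side T m q z ↔ side T m q z' := fun q => side_step hzz (by grind) (by grind)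
      have n9 : ∀ q, T.Adj m q → ¬ side T z z' q := fun q hq => by
        rw [← side_step hq] <;> grind
      have n10 := n9 a ha
      have n11 := n9 b' hb'
      have n12 := not_side hT hzz
      have n13 := not_side hT ha
      have n14 := not_side hT hb'
      have n15 := side_self (T := T) z z'
      have n16 := side_self (T := T) m a
      have n17 := side_self (T := T) m b'
      have n18 := side_disjoint hT ha hab' hb' n16
      have n19 := side_disjoint hT hb' hab'.symm ha n17
      rcases c1 with c1 | c1
      · have hx := exch3 o.le hT ha hb' hzz (by grind) (by grind) (by grind) (by grind) (by grind)
          (by grind) haa c1 a2 (by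
            intro K hK l1 l2 l3
            clear hG hnG
            grind [side_disjoint])
        have := o.shift_cubic (x := m) (c := p') hx (fun t => by have := hx.deg t; grind) hp hn.symm
        omega
      · have hx := exch3 o.le hT ha hb' hzz (by grind) (by grind) (by grind) (by grind) (by grind)
          (by grind) haa c1 a2 (by
            intro K hK l1 l2 l3
            clear hG hnG
            grind [side_disjoint])
        have := o.branch_cubic_twice (w := m) (x := p') hx (fun t => by have := hx.deg t; grind) hp'
          hp.ge hn
        omega
    · obtain ⟨a, ha, hab, hac⟩ := exists_adj_ne_ne (T := T) (w := m) b c hp.ge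
      have haa := o.children_adj hG hp hc hcρ ha hac hb hbc hab
      have ya := side_disjoint hT hb hab.symm ha s1
      have za := side_disjoint hT hb hab.symm ha hz
      by_cases hyb : y = b
      · subst hyb
        have hx := exch2 o.le hT hyz ha (by grind) (by grind [side_self]) a2 haa (by
          intro K hK l1 l2
          clear hG hnG
          grind [side_self, not_side, side_iff_not, side_step, side_disjoint, side_branch])
        have := o.shift_cubic (x := m) (c := p') hx (fun t => by have := hx.deg t; grind) hp hn.symm
        omega
      · have hx := exch3 o.le hT hyz ha hb (by grind) (by grind [side_self]) (by grind)
          (by grind [side_self]) (by grind) (by grind [side_self]) a2 a3 haa (by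
          intro K hK l1 l2 l3
          clear hG hnG
          grind [side_self, not_side, side_iff_not, side_step, side_disjoint, side_branch])
        have := o.shift_cubic (x := m) (c := p') hx (fun t => by have := hx.deg t; grind) hp hn.symm
        omega
  obtain ⟨e₁, he₁, s1, s2, s3⟩ := m1 hmp
  obtain ⟨e₂, he₂, t1, t2, t3⟩ := m2 hmp'
  have d1 : e₁ ≠ e₂ := by rintro rfl; exact s2 t1
  by_cases hmy : m = y
  · subst hmy
    have d2 : e₁ ≠ z := by rintro rfl; exact h1 s1
    have d3 : e₂ ≠ z := by rintro rfl; exact h2 t1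
    have hx := exch1 o.le hT hyz a1 (by grind [side_self])
    have hm := (o.branch_cubic (w := m) (x := p) hx (fun t => by have := hx.deg t; grind) hp
      (three_le_dg he₁ he₂ hyz d1 d2 d3) hyp).1
    obtain ⟨h, hh, f1, f2, f3⟩ := exists_adj_ne_ne_ne (T := T) (w := m) e₁ e₂ z hm.ge
    have hz := side_self (T := T) m z
    exact o.cubics_same_far hG hp hp' hn hnG hyz h1 h2 a1 a2 a3 hyp' hzz hz' hm.ge he₁ he₂ hh s1 t1
      d1 f1 f2 s3 (side_disjoint hT hyz d2.symm he₁ hz) t3 (side_disjoint hT hyz d3.symm he₂ hz)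
      (not_side hT hh) (side_disjoint hT hyz f3.symm hh hz) hmz
  · obtain ⟨g, hg, r1, r2, r3⟩ := m3 hmy
    have hz := fun q => (side_ends (e := q) hyz hmz hmy)
    have d2 : e₁ ≠ g := by rintro rfl; exact r2 s1
    have d3 : e₂ ≠ g := by rintro rfl; exact r3 t1
    have hm3 := three_le_dg he₁ he₂ hg d1 d2 d3
    have hm : 4 ≤ dg T m := by
      by_contra hm
      have z1 := (hz e₁).not.1 s3
      have hx := exch2 o.le hT hyz he₁ (by grind) (by grind [side_self]) a2 a3 (by
        intro K hK l1 l2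
        clear m1 m2 m3 hG hnG
        grind [side_self, not_side, side_iff_not, side_step, side_disjoint, side_branch])
      exact o.three_cubics (w := m) (e := e₁) (x := p) (x' := p') hx
        (fun t => by have := hx.deg t; grind) hp hp' (by omega) hn hmp hmp'
    obtain ⟨h, hh, f1, f2, f3⟩ := exists_adj_ne_ne_ne (T := T) (w := m) e₁ e₂ g hm
    have y3 := side_disjoint hT hg f3.symm hh r1
    exact o.cubics_same_far hG hp hp' hn hnG hyz h1 h2 a1 a2 a3 hyp' hzz hz' hm he₁ he₂ hh s1 t1
      d1 f1 f2 s3 ((hz _).not.1 s3) t3 ((hz _).not.1 t3) y3 ((hz _).not.1 y3) hmz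

theorem Opt.cubics_same (o : Opt G T ρ) (hG : NoClaw G) (hp : dg T p = 3) (hp' : dg T p' = 3)
    (hpρ : p ≠ ρ) (hpρ' : p' ≠ ρ) (hn : p ≠ p') (hnG : ¬ G.Adj p p') (hyz : T.Adj y z)
    (h1 : ¬ side T y z p) (h2 : ¬ side T y z p') (a1 : G.Adj p z) (a2 : G.Adj p' z) : False := by
  have hT := o.isTree
  have hend : ∀ q q', dg T q = 3 → dg T q' = 3 → q ≠ q' → T.Adj q z → ¬ side T q z q' →
      ¬ G.Adj q' z := fun q q' hq hq' hqq h k l => by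
    have hx := exch1 o.le hT h l (by grind [side_self])
    have := o.shift_cubic (x := q) (c := q') hx (fun t => by have := hx.deg t; grind) hq hqq.symm
    omega
  have hyp : y ≠ p := by rintro rfl; exact hend y p' hp hp' hn hyz h2 a2
  have hyp' : y ≠ p' := by rintro rfl; exact hend y p hp' hp hn.symm hyz h1 a1
  rcases hG a1.symm a2.symm (o.le hyz).symm hn hyp.symm hyp'.symm with h | h | h
  · exact hnG h
  · exact o.cubics_same_aux hG hp hp' hpρ hn hnG hyz hyp hyp' h1 h2 a1 a2 h
  · exact o.cubics_same_aux hG hp' hp hpρ' hn.symm (fun k => hnG k.symm) hyz hyp' hyp h2 h1 a2 a1 h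

end

section

variable {V : Type*} [Fintype V] {G T T' : SimpleGraph V}
  {ρ u u' v v' w e f h y z x x' a b c s s' g g' g₁ g₂ g₃ : V} {S : Finset V}

/-! ### Leaves together with pairwise unrelated cubic vertices -/

/-- A set of leaves and pairwise unrelated cubic vertices other than the root. -/
structure Sel (G T : SimpleGraph V) (ρ : V) (S : Finset V) : Prop where
  deg : ∀ s ∈ S, dg T s = 1 ∨ (dg T s = 3 ∧ s ≠ ρ)
  conf : ∀ s ∈ S, ∀ s' ∈ S, dg T s = 3 → dg T s' = 3 → s ≠ s' → ¬ Conf G T s s'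

/-- The vertex `s` is adjacent in `G` to the end of the edge `yz` of `T` farther from it. -/
def Hit (G T : SimpleGraph V) (y z s : V) : Prop :=
  (¬ side T y z s ∧ G.Adj s z) ∨ (side T y z s ∧ G.Adj s y)

theorem Sel.nonadj (q : Sel G T ρ S) (o : Opt G T ρ) (hG : NoClaw G) (hs : s ∈ S) (hs' : s' ∈ S) :
    ¬ G.Adj s s' := by
  intro k
  have hn := k.ne
  rcases q.deg s hs with h | ⟨h, hρ⟩ <;> rcases q.deg s' hs' with h' | ⟨h', hρ'⟩
  · exact o.leaves_nonadj h h' hn k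
  · exact o.leaf_nonadj_cubic hG h h' hρ' k
  · exact o.leaf_nonadj_cubic hG h' h hρ k.symm
  · exact q.conf s hs s' hs' h h' hn (Or.inl k)

theorem Sel.same (q : Sel G T ρ S) (o : Opt G T ρ) (hG : NoClaw G) (hs : s ∈ S) (hs' : s' ∈ S)
    (hyz : T.Adj y z) (h1 : ¬ side T y z s) (h2 : ¬ side T y z s') (a1 : G.Adj s z)
    (a2 : G.Adj s' z) : s = s' := by
  by_contra hn
  have aux : ∀ u x, dg T u = 1 → dg T x = 3 → x ≠ ρ → ¬ side T y z u → ¬ side T y z x →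
      G.Adj u z → ¬ G.Adj x z := by
    intro u x hu hx hρ k1 k2 b1 b2
    by_cases hyx : y = x
    · subst hyx; exact o.leaf_nonadj_of_branch hx.ge hyz hu k1 b1
    · exact o.leaf_cubic_same hG hu hx hρ hyz hyx k2 k1 b2 b1
  rcases q.deg s hs with h | ⟨h, hρ⟩ <;> rcases q.deg s' hs' with h' | ⟨h', hρ'⟩
  · exact o.leaves_same hG h h' hn hyz h1 h2 a1 a2
  · exact aux s s' h h' hρ' h1 h2 a1 a2
  · exact aux s' s h' h hρ h2 h1 a2 a1
  · exact o.cubics_same hG h h' hρ hρ' hn (fun k => q.conf s hs s' hs' h h' hn (Or.inl k)) hyz h1 h2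
      a1 a2

theorem Sel.opposite (q : Sel G T ρ S) (o : Opt G T ρ) (hG : NoClaw G) (hs : s ∈ S) (hs' : s' ∈ S)
    (hyz : T.Adj y z) (h1 : ¬ side T y z s) (h2 : side T y z s') (a1 : G.Adj s z)
    (a2 : G.Adj s' y) : False := by
  have hT := o.isTree
  have hn : s ≠ s' := by rintro rfl; exact h1 h2
  have aux : ∀ y z u x, T.Adj y z → dg T u = 1 → dg T x = 3 → x ≠ ρ → ¬ side T y z x →
      side T y z u → G.Adj u y → ¬ G.Adj x z := by
    intro y z u x hyz hu hx hρ k1 k2 b1 b2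
    by_cases hyx : y = x
    · subst hyx; exact o.leaf_nonadj_cubic hG hu hx hρ b1
    · exact o.leaf_cubic_opposite hG hu hx hρ hyz hyx k1 k2 b2 b1
  rcases q.deg s hs with h | ⟨h, hρ⟩ <;> rcases q.deg s' hs' with h' | ⟨h', hρ'⟩
  · exact o.leaves_opposite h h' hyz h1 h2 a1 a2
  · exact aux z y s s' hyz.symm h h' hρ' ((side_iff_not hT hyz _).1 h2)
      ((side_iff_not hT hyz.symm _).2 h1) a1 a2
  · exact aux y z s' s hyz h' h hρ h1 h2 a2 a1
  · refine q.conf s hs s' hs' h h' hn ?_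
    by_cases h3 : y = s
    · subst h3; exact Or.inl a2.symm
    by_cases h4 : z = s'
    · subst h4; exact Or.inl a1
    exact Or.inr ⟨y, z, hyz, h1, h2, h3, h4, a1, a2⟩

theorem Sel.hit_unique (q : Sel G T ρ S) (o : Opt G T ρ) (hG : NoClaw G) (hs : s ∈ S)
    (hs' : s' ∈ S) (hyz : T.Adj y z) (h : Hit G T y z s) (h' : Hit G T y z s') : s = s' := by
  have hT := o.isTree
  rcases h with ⟨h1, a1⟩ | ⟨h1, a1⟩ <;> rcases h' with ⟨h2, a2⟩ | ⟨h2, a2⟩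
  · exact q.same o hG hs hs' hyz h1 h2 a1 a2
  · exact (q.opposite o hG hs hs' hyz h1 h2 a1 a2).elim
  · exact (q.opposite o hG hs' hs hyz h2 h1 a2 a1).elim
  · exact q.same o hG hs hs' hyz.symm ((side_iff_not hT hyz _).1 h1)
      ((side_iff_not hT hyz _).1 h2) a1 a2

/-- Moving `g` from `v` to `s` is a strict gain if `s` is a leaf; if `s` is cubic, it balances only
at degree 4. -/
theorem Sel.quartic (q : Sel G T ρ S) (o : Opt G T ρ) (hv : 3 ≤ dg T v) (hvS : v ∉ S)
    (hs : s ∈ S) (hg : T.Adj v g) (h1 : ¬ side T v g s) (a1 : G.Adj s g) :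
    dg T s = 3 ∧ dg T v = 4 := by
  have hT := o.isTree
  have hn : v ≠ s := by rintro rfl; exact hvS hs
  rcases q.deg s hs with h | ⟨h, hρ⟩
  · exact (o.leaf_nonadj_of_branch hv hg h h1 a1).elim
  · have hx := exch1 o.le hT hg a1 (by grind [side_self])
    exact ⟨h, (o.branch_cubic (w := v) (x := s) hx (fun t => by have := hx.deg t; grind) h hv hn).1⟩

/-- If the two moves `g` to `s` and `g'` to `s'` could be made together, `v` of degree four would
stop being a branch vertex. They disconnect the graph only if each of `s`, `s'` lies in the branch
moved to the other. -/
theorem Sel.crossing (q : Sel G T ρ S) (o : Opt G T ρ) (hv : 3 ≤ dg T v) (hvS : v ∉ S)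
    (hs : s ∈ S) (hs' : s' ∈ S) (hg : T.Adj v g) (hg' : T.Adj v g') (hgg : g ≠ g')
    (h1 : ¬ side T v g s) (a1 : G.Adj s g) (h2 : ¬ side T v g' s') (a2 : G.Adj s' g') :
    side T v g' s ∧ side T v g s' := by
  by_contra hcr
  have hT := o.isTree
  obtain ⟨d1, hv4⟩ := q.quartic o hv hvS hs hg h1 a1
  obtain ⟨d2, -⟩ := q.quartic o hv hvS hs' hg' h2 a2
  have hx := exch2 o.le hT hg hg' (by grind) (by grind [hg.ne]) a1 a2 (by
    intro K hK l1 l2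
    clear hv hv4
    have n1 := side_self (T := T) v g
    have n2 := side_self (T := T) v g'
    have n3 := side_disjoint hT hg hgg hg' n1
    have n4 := side_disjoint hT hg' hgg.symm hg n2
    have n5 := not_side hT hg
    have n6 := not_side hT hg'
    grind)
  by_cases hss : s = s'
  · subst hss
    have := o.branch_cubic_twice (w := v) (x := s) hx (fun t => by have := hx.deg t; grind) d1 hv
      (by rintro rfl; exact hvS hs)
    omega
  · exact o.two_cubics (w := v) (x := s) (x' := s') hx (fun t => by have := hx.deg t; grind) d1 d2
      hv4.ge hss

/-- A claw at `v` with a third neighbour `g` forces, say, `s₁` to be adjacent to `g`, so `v` has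
degree four. The same argument with the fourth neighbour gives a pair of moves that do not cross. -/
theorem Sel.not_two_near (q : Sel G T ρ S) (o : Opt G T ρ) (hG : NoClaw G) (hv : 3 ≤ dg T v)
    (hvS : v ∉ S) {s₁ s₂ : V} (hs₁ : s₁ ∈ S) (hs₂ : s₂ ∈ S) (hg₁ : T.Adj v g₁) (hg₂ : T.Adj v g₂)
    (d1 : g₁ ≠ g₂) (h1 : side T v g₁ s₁) (h2 : side T v g₂ s₂) (a1 : G.Adj s₁ v)
    (a2 : G.Adj s₂ v) : False := by
  obtain ⟨g, hg, d2, d3⟩ := exists_adj_ne_ne (T := T) (w := v) g₁ g₂ hv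
  replace d2 := d2.symm
  replace d3 := d3.symm
  have hT := o.isTree
  have key : ∀ s₁ s₂ g₁ g₂, s₁ ∈ S → s₂ ∈ S → T.Adj v g₁ → T.Adj v g₂ → g₁ ≠ g₂ → g₁ ≠ g → g₂ ≠ g →
      side T v g₁ s₁ → side T v g₂ s₂ → G.Adj s₁ v → G.Adj s₂ v → ¬ G.Adj s₁ g := by
    intro s₁ s₂ g₁ g₂ hs₁ hs₂ hg₁ hg₂ d1 d2 d3 h1 h2 a1 a2 a
    have e1 := side_disjoint hT hg₁ d2 hg h1
    obtain ⟨-, hv4⟩ := q.quartic o hv hvS hs₁ hg e1 a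
    obtain ⟨k, hk, k1, k2, k3⟩ := exists_adj_ne_ne_ne (T := T) (w := v) g₁ g₂ g hv4.ge
    have e2 := side_disjoint hT hg₁ k1.symm hk h1
    have e3 := side_disjoint hT hg₂ k2.symm hk h2
    have e4 := side_disjoint hT hg₁ d1 hg₂ h1
    rcases hG a1.symm a2.symm (o.le hk) (by grind) (by grind [side_self]) (by grind [side_self])
      with c | c | c
    · exact q.nonadj o hG hs₁ hs₂ c
    · exact e2 (q.crossing o hv hvS hs₁ hs₁ hg hk k3.symm e1 a e2 c).1
    · exact e2 (q.crossing o hv hvS hs₁ hs₂ hg hk k3.symm e1 a e3 c).1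
  have k1 := key s₁ s₂ g₁ g₂ hs₁ hs₂ hg₁ hg₂ d1 d2 d3 h1 h2 a1 a2
  have k2 := key s₂ s₁ g₂ g₁ hs₂ hs₁ hg₂ hg₁ d1.symm d3 d2 h2 h1 a2 a1
  have e1 := side_disjoint hT hg₁ d2 hg h1
  have e2 := side_disjoint hT hg₂ d3 hg h2
  have e4 := side_disjoint hT hg₁ d1 hg₂ h1
  have := hG a1.symm a2.symm (o.le hg) (by grind) (by grind [side_self]) (by grind [side_self])
  have := q.nonadj o hG hs₁ hs₂
  tauto

/-- The vertex `s` makes the neighbours `e` and `k` of `v` adjacent, which frees the edge `vk`. A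
claw at `e`, with `e'` its neighbour towards `x`, provides the edge needed to reconnect the crossing
moves. -/
theorem Sel.not_crossing (q : Sel G T ρ S) (o : Opt G T ρ) (hG : NoClaw G) (hv : 3 ≤ dg T v)
    (hvS : v ∉ S) (hx : x ∈ S) (hx' : x' ∈ S) (hs : s ∈ S) (hz : T.Adj v z)
    (he : T.Adj v e) (hg : T.Adj v g) (d1 : z ≠ e) (d2 : z ≠ g) (d3 : e ≠ g)
    (h1 : side T v e x) (h2 : side T v z x') (a1 : G.Adj x z) (a2 : G.Adj x' e)
    (h3 : side T v g s) (a3 : G.Adj s v) : False := by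
  have hT := o.isTree
  have xz := side_disjoint hT he d1.symm hz h1
  have xe := side_disjoint hT hz d1 he h2
  have sz := side_disjoint hT hg d2.symm hz h3
  have se := side_disjoint hT hg d3.symm he h3
  have hn : x ≠ x' := by rintro rfl; exact xz h2
  have hn1 : s ≠ x' := by rintro rfl; exact sz h2
  obtain ⟨dx, hv4⟩ := q.quartic o hv hvS hx hz xz a1
  obtain ⟨dx', -⟩ := q.quartic o hv hvS hx' he xe a2
  obtain ⟨k, hk, k1, k2, k3⟩ := exists_adj_ne_ne_ne (T := T) (w := v) z e g hv4.ge
  have xk := side_disjoint hT he k2.symm hk h1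
  have xk' := side_disjoint hT hz k1.symm hk h2
  have sk := side_disjoint hT hg k3.symm hk h3
  have c1 : ¬ G.Adj x v := fun c =>
    hn (q.hit_unique o hG hx hx' he (Or.inr ⟨h1, c⟩) (Or.inl ⟨xe, a2⟩))
  have c2 : ¬ G.Adj x' v := fun c =>
    hn (q.hit_unique o hG hx hx' hz (Or.inl ⟨xz, a1⟩) (Or.inr ⟨h2, c⟩))
  have c3 : ¬ G.Adj s e := fun c =>
    hn1 (q.hit_unique o hG hs hx' he (Or.inl ⟨se, c⟩) (Or.inl ⟨xe, a2⟩))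
  have c4 : ¬ G.Adj s k := fun c =>
    xk (q.crossing o hv hvS hx hs hz hk k1.symm xz a1 sk c).1
  have c5 : G.Adj e k := by
    have := hG a3.symm (o.le he) (o.le hk) (by grind [side_self]) (by grind [side_self]) k2.symm
    tauto
  have hex : e ≠ x := by rintro rfl; exact c1 (o.le he).symm
  obtain ⟨e', he', hs'⟩ := exists_side hT hex
  have hev : e' ≠ v := by
    rintro rfl; exact (side_iff_not hT he _).1 h1 hs'
  have e1 := side_self (T := T) v e
  have e2 : side T v e e' := (side_step he' (by grind [he.ne]) (by grind)).1 e1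
  have e3 := side_disjoint hT he d1.symm hz e2
  have e4 := side_disjoint hT he k2.symm hk e2
  have e5 := side_disjoint hT he d1.symm hz e1
  have e6 := side_disjoint hT he k2.symm hk e1
  have z1 := side_self (T := T) v z
  have z2 := side_disjoint hT hz d1 he z1
  have z3 := side_disjoint hT hz k1.symm hk z1
  have w1 := side_self (T := T) v k
  have w2 := side_disjoint hT hk k2 he w1
  have w3 := side_disjoint hT hk k1 hz w1
  have v1 := not_side hT he
  have v2 := not_side hT hz
  have v3 := not_side hT hk
  have f1 := not_side hT he'
  have f2 := side_self (T := T) e e'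
  have f3 : ∀ t, ¬ side T v e t → ¬ side T e e' t := fun t ht =>
    side_disjoint hT he.symm hev.symm he' ((side_iff_not hT he.symm t).2 ht)
  have f4 := f3 v v1
  have f5 := f3 z z2
  have f6 := f3 k w2
  have f7 := f3 x' xe
  have p1 := he.ne
  have p2 := hz.ne
  have p3 := hk.ne
  have p4 := he'.ne
  have hvx : v ≠ x := by rintro rfl; exact hvS hx
  have hvx' : v ≠ x' := by rintro rfl; exact hvS hx'
  rcases hG a2.symm (o.le he).symm (o.le he') hvx'.symm (by grind) hev.symm with c | c | c
  · exact c2 c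
  · have hm := exch3 o.le hT he hk he' (by grind) (by grind) (by grind) (by grind) (by grind)
      (by grind) a2 c5 c (by
        intro K hK l1 l2 l3
        clear c1 c2 c3 c4 hG a3 h3 hs
        grind)
    have := o.branch_cubic_twice (w := v) (x := x') hm (fun t => by have := hm.deg t; grind) dx' hv
      hvx'
    omega
  · have hm := exch4 o.le hT he hz hk he' (by simp; grind) c a1 a2 c5 (by
        intro K hK l1 l2 l3 l4
        clear c1 c2 c3 c4 hG a3 h3 hs
        grind)
    exact o.two_cubics (w := v) (x := x) (x' := x') hm (fun t => by have := hm.deg t; grind) dx dx'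
      hv4.ge hn

theorem Sel.not_three_hit (q : Sel G T ρ S) (o : Opt G T ρ) (hG : NoClaw G) (hv : 3 ≤ dg T v)
    (hvS : v ∉ S) {s₁ s₂ s₃ : V}
    (hs₁ : s₁ ∈ S) (hs₂ : s₂ ∈ S) (hs₃ : s₃ ∈ S) (hg₁ : T.Adj v g₁) (hg₂ : T.Adj v g₂)
    (hg₃ : T.Adj v g₃) (d1 : g₁ ≠ g₂) (d2 : g₁ ≠ g₃) (d3 : g₂ ≠ g₃) (h1 : Hit G T v g₁ s₁)
    (h2 : Hit G T v g₂ s₂) (h3 : Hit G T v g₃ s₃) : False := by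
  have hT := o.isTree
  have two : ∀ g₁ g₂ g₃ s₁ s₂ s₃, s₁ ∈ S → s₂ ∈ S → s₃ ∈ S → T.Adj v g₁ → T.Adj v g₂ → T.Adj v g₃ →
      g₁ ≠ g₂ → g₁ ≠ g₃ → g₂ ≠ g₃ → ¬ side T v g₁ s₁ → G.Adj s₁ g₁ → ¬ side T v g₂ s₂ →
      G.Adj s₂ g₂ → Hit G T v g₃ s₃ → False := by
    intro g₁ g₂ g₃ s₁ s₂ s₃ hs₁ hs₂ hs₃ hg₁ hg₂ hg₃ d1 d2 d3 n1 a1 n2 a2 h3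
    obtain ⟨c1, c2⟩ := q.crossing o hv hvS hs₁ hs₂ hg₁ hg₂ d1 n1 a1 n2 a2
    rcases h3 with ⟨n3, a3⟩ | ⟨n3, a3⟩
    · exact side_disjoint hT hg₂ d3 hg₃ c1 (q.crossing o hv hvS hs₁ hs₃ hg₁ hg₃ d2 n1 a1 n3 a3).1
    · exact q.not_crossing o hG hv hvS hs₁ hs₂ hs₃ hg₁ hg₂ hg₃ d1 d2 d3 c1 c2 a1 a2 n3 a3
  rcases id h1 with ⟨n1, a1⟩ | ⟨n1, a1⟩ <;> rcases id h2 with ⟨n2, a2⟩ | ⟨n2, a2⟩ <;>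
    rcases id h3 with ⟨n3, a3⟩ | ⟨n3, a3⟩
  · exact two _ _ _ _ _ _ hs₁ hs₂ hs₃ hg₁ hg₂ hg₃ d1 d2 d3 n1 a1 n2 a2 h3
  · exact two _ _ _ _ _ _ hs₁ hs₂ hs₃ hg₁ hg₂ hg₃ d1 d2 d3 n1 a1 n2 a2 h3
  · exact two _ _ _ _ _ _ hs₁ hs₃ hs₂ hg₁ hg₃ hg₂ d2 d1 d3.symm n1 a1 n3 a3 h2
  · exact q.not_two_near o hG hv hvS hs₂ hs₃ hg₂ hg₃ d3 n2 n3 a2 a3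
  · exact two _ _ _ _ _ _ hs₂ hs₃ hs₁ hg₂ hg₃ hg₁ d3 d1.symm d2.symm n2 a2 n3 a3 h1
  · exact q.not_two_near o hG hv hvS hs₁ hs₃ hg₁ hg₃ d2 n1 n3 a1 a3
  · exact q.not_two_near o hG hv hvS hs₁ hs₂ hg₁ hg₂ d1 n1 n2 a1 a2
  · exact q.not_two_near o hG hv hvS hs₁ hs₂ hg₁ hg₂ d1 n1 n2 a1 a2

theorem Sel.not_two_hit (q : Sel G T ρ S) (o : Opt G T ρ) (hG : NoClaw G) (hv : dg T v = 3)
    (hvS : v ∉ S) {s₁ s₂ : V} (hs₁ : s₁ ∈ S) (hs₂ : s₂ ∈ S) (hg₁ : T.Adj v g₁) (hg₂ : T.Adj v g₂)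
    (d1 : g₁ ≠ g₂) (h1 : Hit G T v g₁ s₁) (h2 : Hit G T v g₂ s₂) : False := by
  have hT := o.isTree
  have no : ∀ s g, s ∈ S → T.Adj v g → ¬ side T v g s → ¬ G.Adj s g := fun s g hs hg n a => by
    have := (q.quartic o hv.ge hvS hs hg n a).2
    omega
  rcases h1 with ⟨n1, a1⟩ | ⟨n1, a1⟩
  · exact no _ _ hs₁ hg₁ n1 a1
  rcases h2 with ⟨n2, a2⟩ | ⟨n2, a2⟩
  · exact no _ _ hs₂ hg₂ n2 a2
  exact q.not_two_near o hG hv.ge hvS hs₁ hs₂ hg₁ hg₂ d1 n1 n2 a1 a2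

end

section

variable {V : Type*} {G T T' : SimpleGraph V}
  {ρ u u' v v' w e f h y z x x' a b c s s' g g' : V} {S : Finset V}

/-! ### Counting -/

/-- A relation in which every element has at most one partner that is not after it has an
independent set containing half of the elements. -/
theorem exists_half_indep {α : Type*} (r : α → α → Prop) (hr : ∀ x y, r x y → r y x) (d : α → ℕ)
    (C : Finset α) (hC : ∀ x ∈ C, ∀ y ∈ C, ∀ z ∈ C, x ≠ y → x ≠ z → r x y → r x z → d y ≤ d x →
      d z ≤ d x → y = z) :
    ∃ X ⊆ C, (∀ x ∈ X, ∀ y ∈ X, x ≠ y → ¬ r x y) ∧ C.card ≤ 2 * X.card := by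
  induction hn : C.card using Nat.strong_induction_on generalizing C with
  | _ n ih =>
    rcases C.eq_empty_or_nonempty with rfl | hne
    · exact ⟨∅, by simp, by simp, by simp [← hn]⟩
    -- With `x` last in the order, every partner of `x` is not after it, so there is at most one;
    -- keep `x` and discard the partner.
    obtain ⟨x, hx, hmax⟩ := C.exists_max_image d hne
    set P := C.filter fun y => y ≠ x ∧ r x y with hP
    have hP1 : P.card ≤ 1 := Finset.card_le_one.2 fun y hy z hz => by
      simp only [hP, Finset.mem_filter] at hy hz
      exact hC x hx y hy.1 z hz.1 hy.2.1.symm hz.2.1.symm hy.2.2 hz.2.2 (hmax y hy.1) (hmax z hz.1)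
    set D := C \ insert x P with hD
    have hsub : insert x P ⊆ C := Finset.insert_subset hx (Finset.filter_subset _ _)
    have h1 : D.card + (insert x P).card = C.card := Finset.card_sdiff_add_card_eq_card hsub
    have h2 : (insert x P).card ≤ 2 := (Finset.card_insert_le _ _).trans (by omega)
    have h3 : 0 < (insert x P).card := Finset.card_pos.2 ⟨x, by simp⟩
    have hDC : D ⊆ C := Finset.sdiff_subset
    obtain ⟨X, hX, hX1, hX2⟩ := ih D.card (by omega) D
      (fun x hx y hy z hz => hC x (hDC hx) y (hDC hy) z (hDC hz)) rfl
    have hxX : x ∉ X := fun h => by simpa [hD] using hX h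
    have hrX : ∀ y ∈ X, ¬ r x y := fun y hy hxy => by
      have h4 := hX hy
      simp only [hD, hP, Finset.mem_sdiff, Finset.mem_insert, Finset.mem_filter, not_or] at h4
      exact h4.2.2 ⟨h4.1, h4.2.1, hxy⟩
    refine ⟨insert x X, Finset.insert_subset hx (hX.trans hDC), ?_, ?_⟩
    · intro a ha b hb hab
      rcases Finset.mem_insert.1 ha with h5 | h5 <;> rcases Finset.mem_insert.1 hb with h6 | h6
      · exact absurd (h5.trans h6.symm) hab
      · exact h5 ▸ hrX b h6
      · exact fun k => hrX a h5 (h6 ▸ hr _ _ k)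
      · exact hX1 a h5 b h6 hab
    · rw [Finset.card_insert_of_notMem hxX]; omega

theorem exists_parent (hT : T.IsTree) (ρ : V) : ∃ par : V → V, ∀ v, v ≠ ρ →
    T.Adj v (par v) ∧ side T v (par v) ρ := by
  have : ∀ v, ∃ p, v ≠ ρ → T.Adj v p ∧ side T v p ρ := fun v => by
    by_cases h : v = ρ
    · exact ⟨v, fun h' => absurd h h'⟩
    · obtain ⟨p, hp⟩ := exists_side hT h
      exact ⟨p, fun _ => hp⟩
  choose par hpar using this
  exact ⟨par, hpar⟩

theorem parent_eq (hT : T.IsTree) {par : V → V}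
    (hpar : ∀ v, v ≠ ρ → T.Adj v (par v) ∧ side T v (par v) ρ) (hvg : T.Adj v g)
    (h : v ≠ ρ → g ≠ par v) : g ≠ ρ ∧ par g = v := by
  have h1 : ¬ side T v g ρ := by
    by_cases hv : v = ρ
    · subst hv; exact not_side hT hvg
    · obtain ⟨h2, h3⟩ := hpar v hv
      exact side_disjoint hT h2 (h hv).symm hvg h3
  have hg : g ≠ ρ := by rintro rfl; exact h1 (side_self _ _)
  refine ⟨hg, ?_⟩
  by_contra hne
  obtain ⟨h2, h3⟩ := hpar g hg
  exact side_disjoint hT h2 hne hvg.symm h3 ((side_iff_not hT hvg.symm ρ).2 h1)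

theorem noClaw_of_clawFree (h : G.ClawFree) : NoClaw G := by
  intro v a b c ha hb hc hab hac hbc
  by_contra hcon
  push Not at hcon
  have hva := ha.ne
  have hvb := hb.ne
  have hvc := hc.ne
  have h1 := G.adj_comm a b
  have h2 := G.adj_comm a c
  have h3 := G.adj_comm b c
  let F : Fin 1 ⊕ Fin 3 → V := Sum.elim (fun _ => v) ![a, b, c]
  have hF : Function.Injective F := by
    rintro (i | i) (j | j) hij
    · rw [Subsingleton.elim i j]
    · fin_cases j <;> simp [F] at hij <;> contradiction
    · fin_cases i <;> simp [F] at hij <;> exact absurd hij.symm ‹_›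
    · fin_cases i <;> fin_cases j <;> simp [F] at hij ⊢ <;> grind
  refine h ⟨⟨⟨F, hF⟩, ?_⟩⟩
  intro x y
  change G.Adj (F x) (F y) ↔ _
  rcases x with i | i <;> rcases y with j | j
  · simp [F]
  · fin_cases j <;> simp [F, ha, hb, hc]
  · fin_cases i <;> simp [F, ha.symm, hb.symm, hc.symm]
  · fin_cases i <;> fin_cases j <;> simp [F] <;> tauto

variable [Fintype V]

theorem Opt.exists_sel (o : Opt G T ρ) (hG : NoClaw G) :
    ∃ X : Finset V, (∀ x ∈ X, dg T x = 3) ∧ ρ ∉ X ∧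
      Sel G T ρ ((Finset.univ.filter fun v => dg T v = 1) ∪ X) ∧
      (Finset.univ.filter fun v => dg T v = 3).card ≤ 2 * X.card + 1 := by
  have hT := o.isTree
  obtain ⟨X, hX, hX1, hX2⟩ := exists_half_indep (Conf G T) (fun x y => Conf.symm hT)
    (fun v => T.dist ρ v) (Finset.univ.filter fun v => dg T v = 3 ∧ v ≠ ρ) (by
      intro x hx y hy z hz hxy hxz r1 r2 d1 d2
      simp only [Finset.mem_filter, Finset.mem_univ, true_and] at hx hy hz
      obtain ⟨c, hc, hcρ⟩ := exists_side hT hx.2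
      exact o.conf_unique hG hx.1 hy.1 hz.1 hc
        (side_toward_of_dist_le hT hc hcρ hxy.symm d1)
        (side_toward_of_dist_le hT hc hcρ hxz.symm d2) r1 r2)
  have hX3 : ∀ x ∈ X, dg T x = 3 ∧ x ≠ ρ := fun x hx => by simpa using hX hx
  refine ⟨X, fun x hx => (hX3 x hx).1, fun h => (hX3 ρ h).2 rfl, ⟨fun s hs => ?_, ?_⟩, ?_⟩
  · rcases Finset.mem_union.1 hs with h | h
    · exact Or.inl (by simpa using h)
    · exact Or.inr (hX3 s h)
  · intro s hs s' hs' h h' hn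
    have key : ∀ t, t ∈ (Finset.univ.filter fun v => dg T v = 1) ∪ X → dg T t = 3 → t ∈ X := by
      intro t ht h3
      rcases Finset.mem_union.1 ht with h | h
      · simp [h3] at h
      · exact h
    exact hX1 s (key s hs h) s' (key s' hs' h') hn
  · have : (Finset.univ.filter fun v => dg T v = 3) ⊆
        insert ρ (Finset.univ.filter fun v => dg T v = 3 ∧ v ≠ ρ) := by
      intro v; simp; tauto
    have := (Finset.card_le_card this).trans (Finset.card_insert_le _ _)
    omega

/-- A neighbour `z` of `s` is sent to the edge of `T` at `z` towards `s`, which `s` hits. Two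
neighbours with the same edge would be its two ends, each nearer to `s` than the other. -/
theorem degree_le_hits (hT : T.IsTree) {par : V → V}
    (hpar : ∀ v, v ≠ ρ → T.Adj v (par v) ∧ side T v (par v) ρ) (s : V) :
    dg G s ≤ (Finset.univ.filter fun g => g ≠ ρ ∧ Hit G T (par g) g s).card := by
  have hch : ∀ z, ∃ y, z ≠ s → T.Adj z y ∧ side T z y s := fun z => by
    by_cases h : z = s
    · exact ⟨z, fun h' => absurd h h'⟩
    · obtain ⟨p, hp⟩ := exists_side hT h
      exact ⟨p, fun _ => hp⟩
  choose t ht using hch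
  -- An edge of `T` is named by its end farther from `ρ`: this is `z` if the edge leads to the
  -- parent of `z`, and `t z` otherwise.
  let F : V → V := fun z => if z ≠ ρ ∧ par z = t z then z else t z
  have hF : ∀ z, z ≠ s → (F z = z ∧ z ≠ ρ ∧ par z = t z) ∨
      (F z = t z ∧ t z ≠ ρ ∧ par (t z) = z) := fun z hz => by
    by_cases h : z ≠ ρ ∧ par z = t z
    · exact Or.inl ⟨if_pos h, h⟩
    · refine Or.inr ⟨if_neg h, parent_eq hT hpar (ht z hz).1 fun h1 h2 => h ⟨h1, h2.symm⟩⟩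
  refine Finset.card_le_card_of_injOn F ?_ ?_
  · intro z hz
    have hz : G.Adj s z := by simpa using hz
    obtain ⟨h1, h2⟩ := ht z hz.ne'
    simp only [Finset.coe_filter, Finset.mem_univ, true_and, Set.mem_ofPred_eq]
    rcases hF z hz.ne' with ⟨e1, e2, e3⟩ | ⟨e1, e2, e3⟩
    · rw [e1, e3]
      exact ⟨e2, Or.inl ⟨(side_iff_not hT h1 s).1 h2, hz⟩⟩
    · rw [e1, e3]
      exact ⟨e2, Or.inr ⟨h2, hz⟩⟩
  · intro z hz z' hz' hzz
    have hz : z ≠ s := (show G.Adj s z by simpa using hz).ne'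
    have hz' : z' ≠ s := (show G.Adj s z' by simpa using hz').ne'
    obtain ⟨h1, h2⟩ := ht z hz
    obtain ⟨h1', h2'⟩ := ht z' hz'
    have key : ∀ z z', z' = t z → z = t z' → T.Adj z (t z) → side T z (t z) s →
        side T z' (t z') s → False := by
      intro z z' e e' hA k k'
      rw [← e'] at k'
      rw [← e] at k hA
      exact (side_iff_not hT hA s).1 k k'
    rcases hF z hz with ⟨e1, e2, e3⟩ | ⟨e1, e2, e3⟩ <;>
      rcases hF z' hz' with ⟨f1, f2, f3⟩ | ⟨f1, f2, f3⟩ <;> rw [e1, f1] at hzz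
    · exact hzz
    · exact (key z z' (by rw [← e3, hzz, f3]) hzz h1 h2 h2').elim
    · exact (key z z' hzz.symm (by rw [← f3, ← hzz, e3]) h1 h2 h2').elim
    · rw [← e3, hzz, f3]

/-- The |V| - 1 edges of `T`, indexed by their lower ends, split into hit edges `H` and unhit edges
`U`. The former bound the degree sum, as none is hit twice; the latter are counted below the branch
vertices outside `S`. -/
theorem Sel.sum_degree_le (q : Sel G T ρ S) (o : Opt G T ρ) (hG : NoClaw G) :
    ∑ s ∈ S, dg G s + ((Finset.univ.filter fun v => 3 ≤ dg T v ∧ v ∉ S).card +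
      if ρ ∈ S then 0 else 1) + 1 ≤ Fintype.card V := by
  have hT := o.isTree
  obtain ⟨par, hpar⟩ := exists_parent hT ρ
  set H := Finset.univ.filter fun g => g ≠ ρ ∧ ∃ s ∈ S, Hit G T (par g) g s with hH
  set U := Finset.univ.filter fun g => g ≠ ρ ∧ ¬ ∃ s ∈ S, Hit G T (par g) g s with hU
  have hHU : H.card + U.card + 1 = Fintype.card V := by
    have h1 : H.card + U.card = (Finset.univ.erase ρ).card := by
      rw [← Finset.card_filter_add_card_filter_not (s := Finset.univ.erase ρ)
        (fun g => ∃ s ∈ S, Hit G T (par g) g s)]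
      congr 2 <;> ext g <;> simp [hH, hU]
    rw [h1, Finset.card_erase_of_mem (Finset.mem_univ _), Finset.card_univ]
    have := Fintype.card_pos_iff.2 ⟨ρ⟩
    omega
  have hHs : ∑ s ∈ S, dg G s ≤ H.card := by
    refine (Finset.sum_le_sum fun s _ => degree_le_hits hT hpar s).trans ?_
    rw [← Finset.card_biUnion]
    · refine Finset.card_le_card fun g hg => ?_
      simp only [Finset.mem_biUnion, Finset.mem_filter, Finset.mem_univ, true_and, hH] at hg ⊢
      obtain ⟨s, hs, h1, h2⟩ := hg
      exact ⟨h1, s, hs, h2⟩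
    · intro s hs s' hs' hn
      refine Finset.disjoint_left.2 fun g hg hg' => hn ?_
      simp only [Finset.mem_filter, Finset.mem_univ, true_and] at hg hg'
      exact q.hit_unique o hG hs hs' (hpar g hg.1).1.symm hg.2 hg'.2
  have hUs : (Finset.univ.filter fun v => 3 ≤ dg T v ∧ v ∉ S).card + (if ρ ∈ S then 0 else 1) ≤
      U.card := by
    set B := Finset.univ.filter fun v => 3 ≤ dg T v ∧ v ∉ S with hB
    have h1 : ∑ v ∈ B, (U.filter fun g => par g = v).card ≤ U.card := by
      rw [← Finset.card_biUnion]
      · refine Finset.card_le_card fun g hg => ?_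
        simp only [Finset.mem_biUnion, Finset.mem_filter] at hg
        exact hg.choose_spec.2.1
      · intro v hv v' hv' hn
        refine Finset.disjoint_left.2 fun g hg hg' => hn ?_
        rw [← (Finset.mem_filter.1 hg).2, (Finset.mem_filter.1 hg').2]
    refine le_trans ?_ h1
    -- Two edges at `v` are unhit; one of them may lead to the parent, unless `v` is the root.
    have h2 : ∀ v ∈ B, 1 + (if v = ρ then 1 else 0) ≤ (U.filter fun g => par g = v).card := by
      intro v hv
      simp only [hB, Finset.mem_filter, Finset.mem_univ, true_and] at hv
      obtain ⟨hv3, hvS⟩ := hv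
      set N := Finset.univ.filter fun g => T.Adj v g with hN
      have hNc : N.card = dg T v := rfl
      set Hv := N.filter fun g => ∃ s ∈ S, Hit G T v g s with hHv
      have hHv2 : Hv.card + 2 ≤ N.card := by
        rcases (by omega : dg T v = 3 ∨ 4 ≤ dg T v) with h3 | h4
        · have : Hv.card ≤ 1 := Finset.card_le_one.2 fun g hg g' hg' => by
            simp only [hHv, hN, Finset.mem_filter, Finset.mem_univ, true_and] at hg hg'
            obtain ⟨a, s, hs, k⟩ := hg
            obtain ⟨a', s', hs', k'⟩ := hg'
            by_contra hn
            exact q.not_two_hit o hG h3 hvS hs hs' a a' hn k k'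
          omega
        · have : Hv.card ≤ 2 := by
            by_contra hcard
            obtain ⟨g₁, g₂, g₃, m₁, m₂, m₃, d1, d2, d3⟩ := Finset.two_lt_card_iff.1
              (by omega : 2 < Hv.card)
            simp only [hHv, hN, Finset.mem_filter, Finset.mem_univ, true_and] at m₁ m₂ m₃
            obtain ⟨a₁, s₁, hs₁, k₁⟩ := m₁
            obtain ⟨a₂, s₂, hs₂, k₂⟩ := m₂
            obtain ⟨a₃, s₃, hs₃, k₃⟩ := m₃
            exact q.not_three_hit o hG hv3 hvS hs₁ hs₂ hs₃ a₁ a₂ a₃ d1 d2 d3 k₁ k₂ k₃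
          omega
      have hsub : ((N \ Hv).filter fun g => v ≠ ρ → g ≠ par v) ⊆ U.filter fun g => par g = v := by
        intro g hg
        simp only [hHv, hN, Finset.mem_filter, Finset.mem_sdiff, Finset.mem_univ, true_and] at hg
        obtain ⟨⟨hA, hun⟩, hp⟩ := hg
        obtain ⟨h5, h6⟩ := parent_eq hT hpar hA hp
        simp only [hU, Finset.mem_filter, Finset.mem_univ, true_and]
        refine ⟨⟨h5, ?_⟩, h6⟩
        rw [h6]
        exact fun h => hun ⟨hA, h⟩
      have hcard : (N \ Hv).card + Hv.card = N.card :=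
        Finset.card_sdiff_add_card_eq_card (Finset.filter_subset _ _)
      refine le_trans ?_ (Finset.card_le_card hsub)
      by_cases hvρ : v = ρ
      · rw [Finset.filter_true_of_mem (fun g _ h => absurd hvρ h)]
        simp [hvρ] at hcard hHv2 ⊢; omega
      · have : (N \ Hv).erase (par v) ⊆ (N \ Hv).filter fun g => v ≠ ρ → g ≠ par v := by
          intro g hg
          rw [Finset.mem_erase] at hg
          exact Finset.mem_filter.2 ⟨hg.2, fun _ => hg.1⟩
        have h7 := Finset.card_le_card this
        have h8 := Finset.pred_card_le_card_erase (s := N \ Hv) (a := par v)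
        simp only [hvρ, if_false]
        omega
    refine le_trans ?_ (Finset.sum_le_sum h2)
    rw [Finset.sum_add_distrib, Finset.sum_ite_eq' B ρ]
    have hρB : ρ ∈ B ↔ ρ ∉ S := by simp [hB, o.root]
    by_cases hρS : ρ ∈ S <;> simp [hρB, hρS]
  omega

/-- Summed over all vertices, d - 2 gives -2. At a branch vertex d - 2 ≥ 2, except at cubic ones,
where the deficit is 1. -/
theorem count_leaves (hT : T.IsTree) (hpos : ∀ v, 1 ≤ dg T v) :
    2 + 2 * (Finset.univ.filter fun v => 3 ≤ dg T v).card ≤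
      (Finset.univ.filter fun v => dg T v = 1).card +
      (Finset.univ.filter fun v => dg T v = 3).card := by
  have h1 := sum_dg_tree hT
  have h2 : ∑ v : V, (2 + if 3 ≤ dg T v then 2 else 0) ≤
      ∑ v, (dg T v + (if dg T v = 1 then 1 else 0) + if dg T v = 3 then 1 else 0) := by
    refine Finset.sum_le_sum fun v _ => ?_
    have := hpos v
    split_ifs <;> omega
  simp only [Finset.sum_add_distrib, Finset.sum_const, Finset.card_univ, smul_eq_mul,
    ← Finset.sum_filter, mul_one] at h2
  omega

theorem exists_branch (hT : T.IsTree) {n : ℕ} (hn : 2 ≤ n)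
    (h : n < (Finset.univ.filter fun v => dg T v = 1).card +
      (Finset.univ.filter fun v => 3 ≤ dg T v).card) : ∃ v, 3 ≤ dg T v := by
  by_contra hB
  push Not at hB
  have h1 := sum_dg_tree hT
  have h2 : ∑ v, (dg T v + if dg T v = 1 then 1 else 0) ≤ ∑ _v : V, 2 :=
    Finset.sum_le_sum fun v _ => by have := hB v; split_ifs <;> omega
  simp only [Finset.sum_add_distrib, Finset.sum_const, Finset.card_univ, smul_eq_mul,
    ← Finset.sum_filter, mul_one] at h2
  have h3 : (Finset.univ.filter fun v => 3 ≤ dg T v) = ∅ :=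
    Finset.filter_eq_empty_iff.2 fun v _ => by have := hB v; omega
  rw [h3] at h
  simp at h
  omega

theorem exists_tree {m n : ℕ} (hn : 2 ≤ n) (hmn : 3 * m ≤ 2 * n + 2) (hconn : G.Connected)
    (hG : NoClaw G) (hsigma : ∀ S : Finset V, (∀ s ∈ S, ∀ s' ∈ S, ¬ G.Adj s s') → S.card = m + 1 →
      Fintype.card V + m ≤ ∑ s ∈ S, dg G s + n + 1) :
    ∃ T ≤ G, T.IsTree ∧ (Finset.univ.filter fun v => dg T v = 1).card +
      (Finset.univ.filter fun v => 3 ≤ dg T v).card ≤ n := by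
  by_contra hcon
  push Not at hcon
  obtain ⟨T, ρ, o⟩ := exists_opt hconn.exists_isTree_le
    fun T h1 h2 => exists_branch h2 hn (hcon T h1 h2)
  have hT := o.isTree
  obtain ⟨X, hX3, hρX, q, hX⟩ := o.exists_sel hG
  set L := Finset.univ.filter fun v => dg T v = 1 with hL
  set B := Finset.univ.filter fun v => 3 ≤ dg T v with hB
  set S := L ∪ X with hS
  have hLX : Disjoint L X := Finset.disjoint_left.2 fun v hv hv' => by
    have := hX3 v hv'
    simp [hL, this] at hv
  have hScard : S.card = L.card + X.card := Finset.card_union_of_disjoint hLX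
  have hρS : ρ ∉ S := by
    have := o.root
    simp only [hS, hL, Finset.mem_union, Finset.mem_filter, Finset.mem_univ, true_and]
    rintro (h | h)
    · omega
    · exact hρX h
  have h1 := q.sum_degree_le o hG
  rw [if_neg hρS] at h1
  have h2 : (Finset.univ.filter fun v => 3 ≤ dg T v ∧ v ∉ S) = B \ X := by
    ext v
    simp only [hS, hL, hB, Finset.mem_filter, Finset.mem_univ, true_and, Finset.mem_union,
      Finset.mem_sdiff, not_or]
    refine ⟨fun h => ⟨h.1, h.2.2⟩, fun h => ⟨h.1, ?_, h.2⟩⟩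
    have := h.1
    omega
  have h3 : (B \ X).card + X.card = B.card := Finset.card_sdiff_add_card_eq_card fun x hx => by
    simp [hB, hX3 x hx]
  rw [h2] at h1
  have h4 := count_leaves hT (o.pos hT)
  have h5 := hcon T o.le hT
  rw [← hL, ← hB] at h4 h5
  -- By `h4` and `hX`, 2|S| ≥ |L| + 2|B| + 1. Adding |S| ≥ |L| gives 3|S| ≥ 2(|L| + |B|) + 1 ≥ 2n +
  -- 3 ≥ 3m + 1, so |S| ≥ m + 1.
  obtain ⟨S', hS', hcard⟩ := Finset.exists_subset_card_eq (s := S) (n := m + 1) (by omega)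
  have h6 := hsigma S' (fun s hs s' hs' => q.nonadj o hG (hS' hs) (hS' hs')) hcard
  have h7 : ∑ s ∈ S', dg G s + (S \ S').card ≤ ∑ s ∈ S, dg G s := by
    rw [← Finset.sum_sdiff hS', add_comm, Finset.card_eq_sum_ones]
    refine Nat.add_le_add_right (Finset.sum_le_sum fun s _ => ?_) _
    refine (o.pos hT s).trans (Finset.card_le_card fun x hx => ?_)
    simp only [Finset.mem_filter, Finset.mem_univ, true_and] at hx ⊢
    exact o.le hx
  have h8 : (S \ S').card + S'.card = S.card := Finset.card_sdiff_add_card_eq_card hS'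
  -- The bounds combine to |V| - n + m - 1 + (|S| - m - 1) ≤ |V| - 2 - |B| + |X|; as |S| = |L| +
  -- |X|, this is |L| + |B| ≤ n.
  omega

end

end LeafBranch

/-- The lower bound `σ_{m+1}(G) ≥ |G| - n + m - 1` is written with the negative terms moved to the
other side, so that no truncated subtraction occurs. -/
theorem theorem1p9 {V : Type*} [Fintype V] (G : SimpleGraph V) (m n : ℕ) (hm : 1 ≤ m) (hn : 2 ≤ n)
    (hmn : m ≤ ⌈(2 * n / 3 : ℝ)⌉₊) (hconn : G.Connected) (hclaw : G.ClawFree)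
    (hsigma : (Fintype.card V : ℕ∞) + m ≤ G.sigmaIndep (m + 1) + n + 1) :
    ∃ T : SimpleGraph V, T.IsSpanningTreeOf G ∧ T.leafSet.card + T.branchSet.card ≤ n := by
  classical
  have hmn' : 3 * m ≤ 2 * n + 2 := by
    have h1 : ((m : ℕ) : ℝ) < 2 * n / 3 + 1 :=
      lt_of_le_of_lt (by exact_mod_cast hmn) (Nat.ceil_lt_add_one (by positivity))
    have h2 : ((3 * m : ℕ) : ℝ) < ((2 * n + 3 : ℕ) : ℝ) := by push_cast; linarith
    have h3 : 3 * m < 2 * n + 3 := by exact_mod_cast h2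
    omega
  obtain ⟨T, h1, h2, h3⟩ := LeafBranch.exists_tree (m := m) hn hmn' hconn
    (LeafBranch.noClaw_of_clawFree hclaw) (fun S hS hcard => by
      have h4 : G.sigmaIndep (m + 1) ≤ ((∑ v ∈ S, LeafBranch.dg G v : ℕ) : ℕ∞) := by
        simp only [LeafBranch.dg_eq_degree]
        have h5 : G.IsNIndepSet (m + 1) S := ⟨fun s hs s' hs' _ => hS s hs s' hs', hcard⟩
        refine (iInf₂_le S h5).trans (le_of_eq ?_)
        congr!
      have h5 : (Fintype.card V : ℕ∞) + m ≤ ((∑ v ∈ S, LeafBranch.dg G v : ℕ) : ℕ∞) + n + 1 :=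
        hsigma.trans (by gcongr)
      exact_mod_cast h5)
  have hL : T.leafSet = Finset.univ.filter fun v => LeafBranch.dg T v = 1 := by
    ext v; simp [SimpleGraph.leafSet, LeafBranch.dg_eq_degree]
  have hB : T.branchSet = Finset.univ.filter fun v => 3 ≤ LeafBranch.dg T v := by
    ext v; simp only [SimpleGraph.branchSet, LeafBranch.dg_eq_degree, Finset.mem_filter,
      Finset.mem_univ, true_and, ← Nat.succ_le_iff]
  exact ⟨T, ⟨h1, h2⟩, by rw [hL, hB]; exact h3⟩
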